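/- Given linear functions $f_1,\dots,f_n:\mathbb{R}\to\mathbb{R}$, $f_i(x)=a_ix+b_i$ with $a_i,b_i\in\mathbb{R}$, call a permutation $\sigma$ of $\{1,\dots,n\}$ \emph{minimum} (resp. \emph{maximum}) if for every permutation $\tau$ and every $x\in\mathbb{R}$ $$f_{\sigma(n)}\circ\cdots\circ f_{\sigma(1)}(x)\ \le\ f_{\tau(n)}\circ\cdots\circ f_{\tau(1)}(x)\qquad(\text{resp. } \ge).$$ Let $k=|\{i : a_i<0\}|$ denote the number of monotone decreasing functions. Theorem. There is an algorithm which, given $n$ and linear functions $f_1,\dots,f_n$ (by their coefficients $a_i,b_i$) with $k>0$, computes a minimum permutation for $f_1,\dots,f_n$ in $O(k\,2^k\,n^6)$ time. Likewise, there is an algorithm which computes a maximum permutation in $O(k\,2^k\,n^6)$ time whenever $k>0$. Here an algorithm is a fixed program (the same for all $n$, $k$ and all inputs) of a real random access machine, which has array memory for real numbers and for natural numbers (counters and addresses) and performs at unit cost each of: $+,-,\times,\div$ and comparison on real numbers; $+$, truncated subtraction and comparison on natural numbers; indirectly addressed reading and writing of memory. The implied constant in $O(\cdot)$ is absolute: it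 depends neither on $n$, nor on $k$, nor on the functions. -/

import Mathlib

namespace CompositionOrdering

/-! ### Linear functions and composition orderings -/

/-- A linear function `x ↦ slope * x + intercept` (a polynomial function of degree at most one). -/
structure LinFun where
  slope : ℝ
  intercept : ℝ

/-- The value of a linear function at a point. -/
def LinFun.eval (f : LinFun) (x : ℝ) : ℝ := f.slope * x + f.intercept

/-- The composite `f_{σ(n)} ∘ ⋯ ∘ f_{σ(1)}`: the function `f_{σ(1)}` is applied first. -/
def composite {n : ℕ} (f : Fin n → LinFun) (σ : Equiv.Perm (Fin n)) (x : ℝ) : ℝ :=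
  (List.ofFn fun i => f (σ i)).foldl (fun y g => g.eval y) x

/-- `σ` is a minimum permutation: its composite is (pointwise) the minimum of all composites. -/
def IsMinimumPerm {n : ℕ} (f : Fin n → LinFun) (σ : Equiv.Perm (Fin n)) : Prop :=
  ∀ (τ : Equiv.Perm (Fin n)) (x : ℝ), composite f σ x ≤ composite f τ x

/-- `σ` is a maximum permutation: its composite is (pointwise) the maximum of all composites. -/
def IsMaximumPerm {n : ℕ} (f : Fin n → LinFun) (σ : Equiv.Perm (Fin n)) : Prop :=
  ∀ (τ : Equiv.Perm (Fin n)) (x : ℝ), composite f τ x ≤ composite f σ x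

/-- The number of monotone decreasing functions among `f_1, …, f_n`. -/
noncomputable def numDecreasing {n : ℕ} (f : Fin n → LinFun) : ℕ :=
  (Finset.univ.filter fun i => (f i).slope < 0).card

/-! ### The machine model: a unit-cost real RAM

The memory consists of arrays of natural numbers (used for counters, indices and addresses) and
arrays of real numbers; a program refers to finitely many of them.  The only operations are
`+`, truncated `-`, comparisons on natural numbers, `+`, `-`, `*`, `/`, comparisons on real
numbers, and indirectly addressed memory access; each of them takes one unit of time.  There is no
rounding, and no conversion between the two kinds of numbers. -/

/-- The memory: the contents of cell `i` of the natural array `a` is `nat a i`, and that of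
cell `i` of the real array `a` is `real a i`. -/
structure Mem where
  nat : ℕ → ℕ → ℕ
  real : ℕ → ℕ → ℝ

/-- Store a natural number `v` in cell `i` of the natural array `a`. -/
def Mem.setNat (s : Mem) (a i v : ℕ) : Mem :=
  { s with nat := Function.update s.nat a (Function.update (s.nat a) i v) }

/-- Store a real number `v` in cell `i` of the real array `a`. -/
noncomputable def Mem.setReal (s : Mem) (a i : ℕ) (v : ℝ) : Mem :=
  { s with real := Function.update s.real a (Function.update (s.real a) i v) }

/-- Expressions with natural number values. -/
inductive NExp where
  | const (c : ℕ)
  | get (a : ℕ) (i : NExp)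
  | add (e₁ e₂ : NExp)
  | sub (e₁ e₂ : NExp)

/-- The value of a natural expression. -/
def NExp.eval (s : Mem) : NExp → ℕ
  | .const c => c
  | .get a i => s.nat a (i.eval s)
  | .add e₁ e₂ => e₁.eval s + e₂.eval s
  | .sub e₁ e₂ => e₁.eval s - e₂.eval s

/-- The number of operations needed to evaluate a natural expression. -/
def NExp.cost : NExp → ℕ
  | .const _ => 1
  | .get _ i => i.cost + 1
  | .add e₁ e₂ => e₁.cost + e₂.cost + 1
  | .sub e₁ e₂ => e₁.cost + e₂.cost + 1

/-- Expressions with real values.  Only integer constants are available. -/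
inductive RExp where
  | const (c : ℤ)
  | get (a : ℕ) (i : NExp)
  | add (e₁ e₂ : RExp)
  | sub (e₁ e₂ : RExp)
  | mul (e₁ e₂ : RExp)
  | div (e₁ e₂ : RExp)

/-- The value of a real expression (with the convention `x / 0 = 0`, which a program could
also implement at constant cost by a test for zero). -/
noncomputable def RExp.eval (s : Mem) : RExp → ℝ
  | .const c => (c : ℝ)
  | .get a i => s.real a (i.eval s)
  | .add e₁ e₂ => e₁.eval s + e₂.eval s
  | .sub e₁ e₂ => e₁.eval s - e₂.eval s
  | .mul e₁ e₂ => e₁.eval s * e₂.eval s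
  | .div e₁ e₂ => e₁.eval s / e₂.eval s

/-- The number of operations needed to evaluate a real expression. -/
def RExp.cost : RExp → ℕ
  | .const _ => 1
  | .get _ i => i.cost + 1
  | .add e₁ e₂ => e₁.cost + e₂.cost + 1
  | .sub e₁ e₂ => e₁.cost + e₂.cost + 1
  | .mul e₁ e₂ => e₁.cost + e₂.cost + 1
  | .div e₁ e₂ => e₁.cost + e₂.cost + 1

/-- Tests. -/
inductive Cond where
  | natLt (e₁ e₂ : NExp)
  | natEq (e₁ e₂ : NExp)
  | realLt (e₁ e₂ : RExp)
  | realEq (e₁ e₂ : RExp)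
  | not (c : Cond)
  | and (c₁ c₂ : Cond)

/-- The truth value of a test. -/
def Cond.eval (s : Mem) : Cond → Prop
  | .natLt e₁ e₂ => e₁.eval s < e₂.eval s
  | .natEq e₁ e₂ => e₁.eval s = e₂.eval s
  | .realLt e₁ e₂ => e₁.eval s < e₂.eval s
  | .realEq e₁ e₂ => e₁.eval s = e₂.eval s
  | .not c => ¬ c.eval s
  | .and c₁ c₂ => c₁.eval s ∧ c₂.eval s

/-- The number of operations needed to evaluate a test. -/
def Cond.cost : Cond → ℕ
  | .natLt e₁ e₂ => e₁.cost + e₂.cost + 1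
  | .natEq e₁ e₂ => e₁.cost + e₂.cost + 1
  | .realLt e₁ e₂ => e₁.cost + e₂.cost + 1
  | .realEq e₁ e₂ => e₁.cost + e₂.cost + 1
  | .not c => c.cost + 1
  | .and c₁ c₂ => c₁.cost + c₂.cost + 1

/-- Programs. -/
inductive Program where
  | skip
  | setNat (a : ℕ) (i e : NExp)
  | setReal (a : ℕ) (i : NExp) (e : RExp)
  | seq (p q : Program)
  | ite (c : Cond) (p q : Program)
  | while (c : Cond) (p : Program)

/-- `Exec p s s' t`: the program `p`, started with memory `s`, halts after exactly `t` steps with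
memory `s'`. -/
inductive Exec : Program → Mem → Mem → ℕ → Prop where
  | skip (s : Mem) : Exec .skip s s 1
  | setNat (s : Mem) (a : ℕ) (i e : NExp) :
      Exec (.setNat a i e) s (s.setNat a (i.eval s) (e.eval s)) (i.cost + e.cost + 1)
  | setReal (s : Mem) (a : ℕ) (i : NExp) (e : RExp) :
      Exec (.setReal a i e) s (s.setReal a (i.eval s) (e.eval s)) (i.cost + e.cost + 1)
  | seq {p q : Program} {s s₁ s₂ : Mem} {t₁ t₂ : ℕ} :
      Exec p s s₁ t₁ → Exec q s₁ s₂ t₂ → Exec (.seq p q) s s₂ (t₁ + t₂)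
  | iteTrue {c : Cond} {p q : Program} {s s' : Mem} {t : ℕ} :
      c.eval s → Exec p s s' t → Exec (.ite c p q) s s' (c.cost + t + 1)
  | iteFalse {c : Cond} {p q : Program} {s s' : Mem} {t : ℕ} :
      ¬ c.eval s → Exec q s s' t → Exec (.ite c p q) s s' (c.cost + t + 1)
  | whileFalse {c : Cond} {p : Program} {s : Mem} :
      ¬ c.eval s → Exec (.while c p) s s (c.cost + 1)
  | whileTrue {c : Cond} {p : Program} {s s₁ s₂ : Mem} {t₁ t₂ : ℕ} :
      c.eval s → Exec p s s₁ t₁ → Exec (.while c p) s₁ s₂ t₂ →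
        Exec (.while c p) s s₂ (c.cost + t₁ + t₂ + 1)

/-- The machine is deterministic: final memory and running time are determined by program and
initial memory. -/
theorem Exec.deterministic {p : Program} {s s₁ s₂ : Mem} {t₁ t₂ : ℕ}
    (h₁ : Exec p s s₁ t₁) (h₂ : Exec p s s₂ t₂) : s₁ = s₂ ∧ t₁ = t₂ := by
  induction h₁ generalizing s₂ t₂ with
  | skip => cases h₂; exact ⟨rfl, rfl⟩
  | setNat => cases h₂; exact ⟨rfl, rfl⟩
  | setReal => cases h₂; exact ⟨rfl, rfl⟩
  | seq _ _ ih₁ ih₂ =>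
    cases h₂ with
    | seq a b =>
      obtain ⟨rfl, rfl⟩ := ih₁ a
      obtain ⟨rfl, rfl⟩ := ih₂ b
      exact ⟨rfl, rfl⟩
  | iteTrue hc _ ih =>
    cases h₂ with
    | iteTrue _ a => obtain ⟨rfl, rfl⟩ := ih a; exact ⟨rfl, rfl⟩
    | iteFalse hn _ => exact absurd hc hn
  | iteFalse hn _ ih =>
    cases h₂ with
    | iteTrue hc _ => exact absurd hc hn
    | iteFalse _ a => obtain ⟨rfl, rfl⟩ := ih a; exact ⟨rfl, rfl⟩
  | whileFalse hn =>
    cases h₂ with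
    | whileFalse _ => exact ⟨rfl, rfl⟩
    | whileTrue hc _ _ => exact absurd hc hn
  | whileTrue hc _ _ ih₁ ih₂ =>
    cases h₂ with
    | whileFalse hn => exact absurd hc hn
    | whileTrue _ a b =>
      obtain ⟨rfl, rfl⟩ := ih₁ a
      obtain ⟨rfl, rfl⟩ := ih₂ b
      exact ⟨rfl, rfl⟩

/-- The initial memory on input `f_1, …, f_n`: natural array `0` holds `n` in its first cell, real
arrays `0` and `1` hold the slopes and the intercepts, and all other cells contain zero. -/
noncomputable def inputMem {n : ℕ} (f : Fin n → LinFun) : Mem where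
  nat a i := if a = 0 ∧ i = 0 then n else 0
  real a i :=
    if h : i < n then
      if a = 0 then (f ⟨i, h⟩).slope else if a = 1 then (f ⟨i, h⟩).intercept else 0
    else 0

/-- `OutputsIn p f σ t`: on input `f_1, …, f_n` the program `p` halts after exactly `t` steps, with
`σ(1), …, σ(n)` in the first `n` cells of the natural array `1` (indices counted from zero). -/
def OutputsIn {n : ℕ} (p : Program) (f : Fin n → LinFun) (σ : Equiv.Perm (Fin n)) (t : ℕ) : Prop :=
  ∃ s : Mem, Exec p (inputMem f) s t ∧ ∀ i : Fin n, s.nat 1 (i : ℕ) = (σ i : ℕ)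

end CompositionOrdering

/-!
# Minimum and maximum composition orderings of linear functions

The slope of the composite does not depend on the ordering, so a minimum permutation is one that
minimizes the constant term, and a maximum permutation is a minimum permutation after negating all
intercepts. An ordering is written as a list, its head being applied first.

Interchanging two adjacent blocks `X`, `Y` of an ordering, with a suffix `Q` behind them, changes
the constant term by `slopeProd Q` times the cross product of the vectors
`(constTerm, 1 - slopeProd)` of the two blocks (`constTerm_swap`). For an optimal ordering of a
generic input this determines the orientation of every triangle of vectors belonging to three
suffixes. Hence these vectors are the vertices of a convex polygon, which is toured
counterclockwise by first visiting the suffixes with positive slope and then, in the opposite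
direction of time, those with negative slope. Up to positive factors, the edges of this polygon
include the vectors `(b i, 1 - a i)` of the nondecreasing functions, and therefore these functions,
in the order of the tour (`boundary`), are cyclically sorted by the angle of their vectors
(`triplewise_boundary`). For arbitrary inputs, and any rule for breaking ties between equal angles,
there still is an optimal ordering with this property, because the set of inputs that have one is
closed and every input is a limit of generic ones (`hasOptimalBoundary_of_keyLe`).

Prepending functions one by one, such an ordering is built up so that at each time the
nondecreasing functions used so far form an interval of the sorted cyclic sequence, growing at
either end, while the set of decreasing functions used is arbitrary
(`IsLayout.exists_optimal_suffixState`). A state consists of a set of the `k` decreasing functions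
and the length and position of an interval, so there are `O(2 ^ k * n ^ 2)` states, and each has at
most `k + 2` predecessors. All lists of a state have the same slope, so that prepending a function
changes their constant terms by the same amount; hence a best list of a state arises from a best
list of a predecessor (`isSolved_of_isBest`).

The program sorts by counting ranks, fills the table of all states in the order of their numbers,
and reads off the ordering along the links to the predecessors. It is verified by weakest
preconditions for the parts without loops and by invariants for the loops (`Runs.of_wp`,
`Runs.loop`), which also bound the running time.
-/

namespace CompositionOrdering

/-! ### Slope and constant term of a composite -/

section Algebra

variable {ι R : Type*} [CommRing R]

/-- The slope of the composite of the functions listed in `l`. -/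
def slopeProd (a : ι → R) (l : List ι) : R := (l.map a).prod

/-- The value at `0` of the composite of the functions `x ↦ a i * x + b i` listed in `l`, where the
head of the list is applied first. -/
def constTerm (a b : ι → R) : List ι → R
  | [] => 0
  | x :: l => constTerm a b l + slopeProd a l * b x

/-- The cross product of the vectors `(constTerm, 1 - slopeProd)` of two composites. -/
def blockCross (a b : ι → R) (X Y : List ι) : R :=
  constTerm a b X * (1 - slopeProd a Y) - constTerm a b Y * (1 - slopeProd a X)

/-- The cross product of the vectors `(b x, 1 - a x)` and `(b y, 1 - a y)`. -/
def cross (a b : ι → R) (x y : ι) : R := b x * (1 - a y) - b y * (1 - a x)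

@[simp] theorem slopeProd_nil (a : ι → R) : slopeProd a [] = 1 := rfl

@[simp] theorem slopeProd_cons (a : ι → R) (x : ι) (l : List ι) :
    slopeProd a (x :: l) = a x * slopeProd a l := by simp [slopeProd]

@[simp] theorem slopeProd_append (a : ι → R) (l l' : List ι) :
    slopeProd a (l ++ l') = slopeProd a l * slopeProd a l' := by simp [slopeProd]

theorem slopeProd_perm (a : ι → R) {l l' : List ι} (h : l.Perm l') :
    slopeProd a l = slopeProd a l' := (h.map a).prod_eq

@[simp] theorem constTerm_nil (a b : ι → R) : constTerm a b [] = 0 := rfl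

@[simp] theorem constTerm_cons (a b : ι → R) (x : ι) (l : List ι) :
    constTerm a b (x :: l) = constTerm a b l + slopeProd a l * b x := rfl

theorem constTerm_append (a b : ι → R) (l l' : List ι) :
    constTerm a b (l ++ l') = constTerm a b l' + slopeProd a l' * constTerm a b l := by
  induction l with
  | nil => simp
  | cons x l ih => simp only [List.cons_append, constTerm_cons, ih, slopeProd_append]; ring

theorem blockCross_singleton (a b : ι → R) (x y : ι) :
    blockCross a b [x] [y] = cross a b x y := by simp [blockCross, cross]

theorem cross_swap (a b : ι → R) (x y : ι) : cross a b y x = -cross a b x y := by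
  unfold cross; ring

/-- The effect on the constant term of interchanging two adjacent blocks. -/
theorem constTerm_swap (a b : ι → R) (P X Y Q : List ι) :
    constTerm a b (P ++ (Y ++ (X ++ Q))) - constTerm a b (P ++ (X ++ (Y ++ Q)))
      = slopeProd a Q * blockCross a b X Y := by
  simp only [constTerm_append, slopeProd_append, blockCross]; ring

end Algebra

/-! ### Convex polygons -/

/-- Twice the signed area of the triangle `P Q R`. -/
def orient (P Q R : ℝ × ℝ) : ℝ := (Q.1 - P.1) * (R.2 - Q.2) - (Q.2 - P.2) * (R.1 - Q.1)

/-- The cross product of the edges `P P'` and `Q Q'`. -/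
def edgeCross (P P' Q Q' : ℝ × ℝ) : ℝ :=
  (P'.1 - P.1) * (Q'.2 - Q.2) - (P'.2 - P.2) * (Q'.1 - Q.1)

theorem orient_rotate (P Q R : ℝ × ℝ) : orient Q R P = orient P Q R := by unfold orient; ring

theorem orient_swap (P Q R : ℝ × ℝ) : orient P R Q = -orient P Q R := by unfold orient; ring

/-- Along a convex polygon, the distance from the line through an edge `P P'` has no valley. -/
theorem orient_no_valley {P P' A B C : ℝ × ℝ} (hB : 0 ≤ orient P P' B)
    (hAB : 0 ≤ orient P' A B) (hBC : 0 ≤ orient P' B C) (hAC : 0 ≤ orient P' A C)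
    (hABC : 0 < orient A B C) (h₁ : orient P P' B < orient P P' A)
    (h₂ : orient P P' B < orient P P' C) : False := by
  have e₁ : (orient P P' A - orient P P' B) * orient P' B C
      + (orient P P' C - orient P P' B) * orient P' A B
      + orient P P' B * orient A B C = 0 := by unfold orient; ring
  have e₂ : orient P' B C + orient P' A B = orient P' A C + orient A B C := by
    unfold orient; ring
  have t₁ := mul_nonneg (sub_pos.2 h₁).le hBC
  have t₂ := mul_nonneg (sub_pos.2 h₂).le hAB
  have t₃ := mul_nonneg hB hABC.le
  have z₁ : (orient P P' A - orient P P' B) * orient P' B C = 0 := by linarith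
  have z₂ : (orient P P' C - orient P P' B) * orient P' A B = 0 := by linarith
  have w₁ := (mul_eq_zero.1 z₁).resolve_left (sub_pos.2 h₁).ne'
  have w₂ := (mul_eq_zero.1 z₂).resolve_left (sub_pos.2 h₂).ne'
  linarith

/-- The turning angle along a convex polygon is less than a full turn: for three edges in
counterclockwise order, two consecutive right turns are impossible. -/
theorem no_two_right_turns {I I' J J' K K' : ℝ × ℝ}
    (h₁ : 0 ≤ orient J J' K') (h₂ : 0 ≤ orient J J' I)
    (h₃ : 0 ≤ orient J' K K') (h₄ : 0 ≤ orient J' K' I') (h₅ : 0 ≤ orient J' K I')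
    (h₆ : 0 < orient K K' I') (h₇ : 0 ≤ orient J' K I) (h₈ : 0 ≤ orient J' I I')
    (h₉ : 0 < orient K I I')
    (hIJ : edgeCross I I' J J' < 0) (hJK : edgeCross J J' K K' < 0) : False := by
  have e₁ : orient J J' K' - orient J J' K = edgeCross J J' K K' := by
    unfold orient edgeCross; ring
  have e₂ : orient J J' I - orient J J' I' = edgeCross I I' J J' := by
    unfold orient edgeCross; ring
  rcases le_or_gt (orient J J' K') (orient J J' I) with h | h
  · exact orient_no_valley h₁ h₃ h₄ h₅ h₆ (by linarith) (by linarith)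
  · exact orient_no_valley h₂ h₇ h₈ h₅ h₉ (by linarith) (by linarith)

/-- Three edges of a convex polygon in counterclockwise order: the points `V x` are the vertices,
in the order given by `ρ`, and the edges run from `i`, `j`, `k` to the next vertex. -/
theorem edges_ccw {V : ℕ → ℝ × ℝ} {ρ : ℕ → ℕ} {n : ℕ}
    (hinj : ∀ x ≤ n, ∀ y ≤ n, ρ x = ρ y → x = y)
    (hV : ∀ x ≤ n, ∀ y ≤ n, ∀ z ≤ n, ρ x < ρ y → ρ y < ρ z → 0 < orient (V x) (V y) (V z))
    {i i' j j' k k' : ℕ} (hi : i ≤ n) (hi' : i' ≤ n) (hj : j ≤ n) (hj' : j' ≤ n) (hk : k ≤ n)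
    (hk' : k' ≤ n) (ei : ρ i' = ρ i + 1) (ej : ρ j' = ρ j + 1) (ek : ρ k' = ρ k + 1)
    (hij : ρ i < ρ j) (hjk : ρ j < ρ k) (nij : edgeCross (V i) (V i') (V j) (V j') ≠ 0)
    (njk : edgeCross (V j) (V j') (V k) (V k') ≠ 0)
    (nki : edgeCross (V k) (V k') (V i) (V i') ≠ 0) :
    (0 < edgeCross (V i) (V i') (V j) (V j') ∧ 0 < edgeCross (V j) (V j') (V k) (V k')) ∨
    (0 < edgeCross (V j) (V j') (V k) (V k') ∧ 0 < edgeCross (V k) (V k') (V i) (V i')) ∨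
    (0 < edgeCross (V k) (V k') (V i) (V i') ∧ 0 < edgeCross (V i) (V i') (V j) (V j')) := by
  have S : ∀ x ≤ n, ∀ y ≤ n, ∀ z ≤ n,
      (ρ x < ρ y ∧ ρ y < ρ z) ∨ (ρ y < ρ z ∧ ρ z < ρ x) ∨ (ρ z < ρ x ∧ ρ x < ρ y) →
      0 < orient (V x) (V y) (V z) := by
    rintro x hx y hy z hz (⟨h₁, h₂⟩ | ⟨h₁, h₂⟩ | ⟨h₁, h₂⟩)
    · exact hV x hx y hy z hz h₁ h₂
    · rw [← orient_rotate]; exact hV y hy z hz x hx h₁ h₂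
    · rw [← orient_rotate, ← orient_rotate]; exact hV z hz x hx y hy h₁ h₂
  have W : ∀ x ≤ n, ∀ y ≤ n, ∀ z ≤ n,
      (ρ x ≤ ρ y ∧ ρ y ≤ ρ z) ∨ (ρ y ≤ ρ z ∧ ρ z ≤ ρ x) ∨ (ρ z ≤ ρ x ∧ ρ x ≤ ρ y) →
      0 ≤ orient (V x) (V y) (V z) := by
    intro x hx y hy z hz h
    by_cases h₁ : ρ x = ρ y
    · rw [hinj x hx y hy h₁]; simp [orient]
    by_cases h₂ : ρ y = ρ z
    · rw [hinj y hy z hz h₂]; simp [orient]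
    by_cases h₃ : ρ z = ρ x
    · rw [hinj z hz x hx h₃, ← orient_rotate, ← orient_rotate]; simp [orient]
    exact (S x hx y hy z hz (by omega)).le
  have hc : ∀ x y z : ℝ, x ≠ 0 → y ≠ 0 → z ≠ 0 →
      ((0 < x ∧ 0 < y) ∨ (0 < y ∧ 0 < z) ∨ (0 < z ∧ 0 < x)) ∨
      ((x < 0 ∧ y < 0) ∨ (y < 0 ∧ z < 0) ∨ (z < 0 ∧ x < 0)) := by
    intro x y z hx hy hz
    rcases hx.lt_or_gt with hx | hx <;> rcases hy.lt_or_gt with hy | hy <;>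
      rcases hz.lt_or_gt with hz | hz <;> tauto
  rcases hc _ _ _ nij njk nki with h | ⟨c₁, c₂⟩ | ⟨c₁, c₂⟩ | ⟨c₁, c₂⟩
  · exact h
  all_goals
    exfalso
    refine no_two_right_turns ?_ ?_ ?_ ?_ ?_ ?_ ?_ ?_ ?_ c₁ c₂
    all_goals first
      | (refine W _ ?_ _ ?_ _ ?_ ?_ <;> first | assumption | omega)
      | (refine S _ ?_ _ ?_ _ ?_ ?_ <;> first | assumption | omega)

/-! ### Cyclically sorted lists -/

/-- Two permutations of each other that are sorted with respect to the same cyclic order agree up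
to rotation. -/
theorem isRotated_of_triplewise {α : Type*} {p : α → α → α → Prop}
    (hrot : ∀ a b c, p a b c → p b c a) (hasymm : ∀ a b c, p a b c → ¬ p a c b)
    {l l' : List α} (h : l.Perm l') (hl : l.Triplewise p) (hl' : l'.Triplewise p) : l ~r l' := by
  cases l' with
  | nil => rw [h.eq_nil]
  | cons x t =>
    obtain ⟨C, D, rfl⟩ := List.append_of_mem (h.mem_iff.2 (List.mem_cons_self))
    have hr : (C ++ x :: D) ~r (x :: D ++ C) := List.isRotated_append
    rw [List.triplewise_append, List.triplewise_cons] at hl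
    rw [List.triplewise_cons] at hl'
    have hp : (D ++ C).Pairwise (p x) := by
      rw [List.pairwise_append]
      refine ⟨hl.2.1.1, ?_, ?_⟩
      · exact (hl.2.2.2 x List.mem_cons_self).imp fun {a b} hab => hrot _ _ _ (hrot _ _ _ hab)
      · intro a ha b hb
        have := hl.2.2.1 b hb
        rw [List.pairwise_cons] at this
        exact hrot _ _ _ (this.1 a ha)
    have hperm : (D ++ C).Perm t := by
      have : (x :: (D ++ C)).Perm (x :: t) := (hr.perm.symm.trans h)
      exact (List.perm_cons _).1 this
    have : D ++ C = t := hperm.eq_of_pairwise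
      (fun a b _ _ hab hba => absurd hba (hasymm _ _ _ hab)) hp hl'.1
    rw [← this]; exact hr

/-- The vectors `(b i, 1 - a i)`, for `i = x, y, z`, are in counterclockwise cyclic order. -/
def IsCcw (a b : ℕ → ℝ) (x y z : ℕ) : Prop :=
  (0 < cross a b x y ∧ 0 < cross a b y z) ∨ (0 < cross a b y z ∧ 0 < cross a b z x) ∨
    (0 < cross a b z x ∧ 0 < cross a b x y)

theorem IsCcw.rotate {a b : ℕ → ℝ} {x y z : ℕ} (h : IsCcw a b x y z) : IsCcw a b y z x := by
  unfold IsCcw at *; tauto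

theorem IsCcw.not_swap {a b : ℕ → ℝ} {x y z : ℕ} (h : IsCcw a b x y z) : ¬ IsCcw a b x z y := by
  unfold IsCcw at *
  rw [cross_swap a b z x, cross_swap a b y z, cross_swap a b x y]
  rcases h with h | h | h <;> rintro (h' | h' | h') <;> linarith [h.1, h.2, h'.1, h'.2]

/-! ### The boundary of the polygon of an ordering -/

/-- The nondecreasing functions of an ordering, in the order in which a counterclockwise tour of
the polygon of the ordering meets them: a function followed by an even number of decreasing ones
lies on the lower chain, which is traversed forwards, and the others lie on the upper chain, which
is traversed backwards. -/
def boundary (neg : ℕ → Prop) [DecidablePred neg] : List ℕ → List ℕ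
  | [] => []
  | z :: t => if neg z then boundary neg t else
      if Even (t.countP (fun i => decide (neg i))) then z :: boundary neg t
      else boundary neg t ++ [z]

theorem boundary_perm (neg : ℕ → Prop) [DecidablePred neg] (l : List ℕ) :
    (boundary neg l).Perm (l.filter fun i => ¬ neg i) := by
  induction l with
  | nil => simp [boundary]
  | cons z t ih =>
    unfold boundary
    by_cases h : neg z
    · simpa [h] using ih
    · simp only [h, if_false, not_false_eq_true, decide_true, List.filter_cons_of_pos]
      split_ifs
      · exact ih.cons z
      · exact (List.perm_append_singleton z _).trans (ih.cons z)

/-- The signs of the slopes are given by `neg`, and no slope of a listed function vanishes. -/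
def HasSigns (neg : ℕ → Prop) (a : ℕ → ℝ) (l : List ℕ) : Prop :=
  ∀ i ∈ l, (neg i → a i < 0) ∧ (¬ neg i → 0 < a i)

theorem HasSigns.slopeProd {neg : ℕ → Prop} [DecidablePred neg] {a : ℕ → ℝ} {l : List ℕ}
    (h : HasSigns neg a l) :
    (Even (l.countP (fun i => decide (neg i))) → 0 < slopeProd a l) ∧
    (¬ Even (l.countP (fun i => decide (neg i))) → slopeProd a l < 0) := by
  induction l with
  | nil => simp
  | cons z t ih =>
    have hz := h z List.mem_cons_self
    have := ih fun i hi => h i (List.mem_cons_of_mem _ hi)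
    rw [slopeProd_cons, List.countP_cons]
    by_cases hn : neg z
    · have hz' := hz.1 hn
      simp only [hn, decide_true, if_true, Nat.even_add_one]
      exact ⟨fun h => mul_pos_of_neg_of_neg hz' (this.2 h),
        fun h => mul_neg_of_neg_of_pos hz' (this.1 (not_not.1 h))⟩
    · have hz' := hz.2 hn
      simp only [hn, decide_false, Bool.false_eq_true, if_false, add_zero]
      exact ⟨fun h => mul_pos hz' (this.1 h), fun h => mul_neg_of_pos_of_neg hz' (this.2 h)⟩

/-- The vertex of the polygon belonging to the suffix `l` of an ordering. -/
def vertex (a b : ℕ → ℝ) (l : List ℕ) : ℝ × ℝ := (-constTerm a b l, -(1 - slopeProd a l))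

theorem orient_vertex (a b : ℕ → ℝ) (X Y Q : List ℕ) :
    orient (vertex a b (X ++ (Y ++ Q))) (vertex a b (Y ++ Q)) (vertex a b Q)
      = slopeProd a (Y ++ Q) * (slopeProd a Q * blockCross a b X Y) := by
  simp only [orient, vertex, constTerm_append, slopeProd_append, blockCross]; ring

/-- No two disjoint blocks of functions have parallel vectors. -/
def IsGeneric (a b : ℕ → ℝ) (n : ℕ) : Prop :=
  ∀ X Y : List ℕ, X ≠ [] → Y ≠ [] → (X ++ Y).Nodup → (∀ i ∈ X ++ Y, i < n) →
    blockCross a b X Y ≠ 0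

/-- The boundary as a list of positions, sorted along the polygon. The position `i` stands for the
edge between the vertices of the suffixes starting at `i` and `i + 1`. -/
theorem exists_boundary_positions {neg : ℕ → Prop} [DecidablePred neg] {a : ℕ → ℝ} {s : List ℕ}
    (hs : HasSigns neg a s) (P t : List ℕ) (hPt : s = P ++ t) :
    ∃ I : List ℕ, I.map (fun i => s.getD i 0) = boundary neg t ∧
      I.Pairwise (fun i j => (if 0 < slopeProd a (s.drop (i + 1)) then i else 2 * s.length - i) <
        (if 0 < slopeProd a (s.drop (j + 1)) then j else 2 * s.length - j)) ∧
      ∀ i ∈ I, P.length ≤ i ∧ i < s.length ∧ ¬ neg (s.getD i 0) := by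
  induction t generalizing P with
  | nil => exact ⟨[], by simp [boundary]⟩
  | cons z t ih =>
    obtain ⟨I, h₁, h₂, h₃⟩ := ih (P ++ [z]) (by simp [hPt])
    have hlen : P.length < s.length := by rw [hPt]; simp
    have hz : s.getD P.length 0 = z := by rw [hPt]; simp
    have hd : s.drop (P.length + 1) = t := by rw [hPt]; simp
    have hst : HasSigns neg a t := fun i hi => hs i (by rw [hPt]; simp [hi])
    simp only [List.length_append, List.length_singleton] at h₃
    unfold boundary
    by_cases hn : neg z
    · exact ⟨I, by simpa [hn] using h₁, h₂,
        fun i hi => ⟨by have := (h₃ i hi).1; omega, (h₃ i hi).2⟩⟩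
    by_cases he : Even (t.countP (fun i => decide (neg i)))
    · refine ⟨P.length :: I,
        by simp only [List.map_cons, hn, he, if_true, if_false, hz, h₁], ?_, ?_⟩
      · rw [List.pairwise_cons]
        refine ⟨fun i hi => ?_, h₂⟩
        have := h₃ i hi
        rw [hd, if_pos (hst.slopeProd.1 he)]
        split_ifs <;> omega
      · intro i hi
        rcases List.mem_cons.1 hi with rfl | hi
        · exact ⟨le_rfl, hlen, by rwa [hz]⟩
        · exact ⟨by have := (h₃ i hi).1; omega, (h₃ i hi).2⟩
    · refine ⟨I ++ [P.length], by
        simp only [List.map_append, List.map_cons, List.map_nil, hn, he, if_false, hz, h₁], ?_, ?_⟩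
      · rw [List.pairwise_append]
        refine ⟨h₂, List.pairwise_singleton _ _, fun i hi j hj => ?_⟩
        have := h₃ i hi
        rw [List.mem_singleton] at hj
        subst hj
        rw [hd, if_neg (not_lt.2 (hst.slopeProd.2 he).le)]
        split_ifs <;> omega
      · intro i hi
        rcases List.mem_append.1 hi with hi | hi
        · exact ⟨by have := (h₃ i hi).1; omega, (h₃ i hi).2⟩
        · rw [List.mem_singleton] at hi
          subst hi
          exact ⟨le_rfl, hlen, by rwa [hz]⟩

theorem drop_eq_block_append (s : List ℕ) {i j : ℕ} (h : i ≤ j) :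
    s.drop i = (s.drop i).take (j - i) ++ s.drop j := by
  conv_lhs => rw [← List.take_append_drop (j - i) (s.drop i)]
  rw [List.drop_drop, Nat.add_sub_cancel' h]

/-- The sign of the orientation of three vertices depends only on the middle one: this is the
optimality of the ordering under the exchange of adjacent blocks. -/
theorem orient_vertex_drop {a b : ℕ → ℝ} {n : ℕ} {s : List ℕ} (hnd : s.Nodup)
    (hlt : ∀ i ∈ s, i < n) (hgen : IsGeneric a b n) (ha : ∀ i ∈ s, a i ≠ 0)
    (hopt : ∀ t : List ℕ, t.Perm s → constTerm a b s ≤ constTerm a b t) {i j k : ℕ}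
    (hij : i < j) (hjk : j < k) (hk : k ≤ s.length) :
    ∃ c : ℝ, 0 < c ∧ orient (vertex a b (s.drop i)) (vertex a b (s.drop j))
      (vertex a b (s.drop k)) = slopeProd a (s.drop j) * c := by
  set Q := s.drop k with hQ
  set Y := (s.drop j).take (k - j) with hY
  set X := (s.drop i).take (j - i) with hX
  have ej : s.drop j = Y ++ Q := drop_eq_block_append s hjk.le
  have ei : s.drop i = X ++ (Y ++ Q) := by rw [← ej]; exact drop_eq_block_append s hij.le
  have es : s = s.take i ++ (X ++ (Y ++ Q)) := by rw [← ei, List.take_append_drop]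
  refine ⟨slopeProd a Q * blockCross a b X Y, ?_, by rw [ei, ej, orient_vertex]⟩
  have h0 : 0 ≤ slopeProd a Q * blockCross a b X Y := by
    have hp : (s.take i ++ (Y ++ (X ++ Q))).Perm s := by
      conv_rhs => rw [es]
      refine List.Perm.append_left _ ?_
      rw [← List.append_assoc, ← List.append_assoc]
      exact List.Perm.append_right _ List.perm_append_comm
    have := hopt _ hp
    rw [← constTerm_swap a b (s.take i) X Y Q, ← es]
    linarith
  refine lt_of_le_of_ne h0 (Ne.symm (mul_ne_zero ?_ ?_))
  · unfold slopeProd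
    refine List.prod_ne_zero fun h => ?_
    obtain ⟨z, hz, hz0⟩ := List.mem_map.1 h
    exact ha z (List.mem_of_mem_drop hz) hz0
  · have hsub : (X ++ Y).Sublist s := by
      conv_rhs => rw [es, ← List.append_assoc X]
      exact (List.sublist_append_left _ _).trans (List.sublist_append_right _ _)
    refine hgen X Y ?_ ?_ (hnd.sublist hsub) fun z hz => hlt z (hsub.subset hz)
    · rw [hX, ← List.length_pos_iff]; simp; omega
    · rw [hY, ← List.length_pos_iff]; simp; omega

/-- In the generic case, the boundary of an optimal ordering is sorted by angle, cyclically. -/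
theorem triplewise_boundary {neg : ℕ → Prop} [DecidablePred neg] {a b : ℕ → ℝ} {n : ℕ}
    {s : List ℕ} (hnd : s.Nodup) (hlt : ∀ i ∈ s, i < n) (hgen : IsGeneric a b n)
    (hs : HasSigns neg a s)
    (hopt : ∀ t : List ℕ, t.Perm s → constTerm a b s ≤ constTerm a b t) :
    (boundary neg s).Triplewise (IsCcw a b) := by
  have ha : ∀ i ∈ s, a i ≠ 0 := fun i hi => by
    by_cases h : neg i
    · exact ((hs i hi).1 h).ne
    · exact ((hs i hi).2 h).ne'
  obtain ⟨I, h₁, h₂, h₃⟩ := exists_boundary_positions hs [] s rfl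
  set N := s.length with hN
  set A : ℕ → ℝ := fun i => slopeProd a (s.drop i) with hA
  set V : ℕ → ℝ × ℝ := fun i => vertex a b (s.drop i) with hVdef
  -- `ρ` is the rank of the vertex `V i` on the tour: the suffixes of positive slope by increasing
  -- starting position, followed by those of negative slope by decreasing starting position.
  set ρ : ℕ → ℕ := fun i => if 0 < A i then i else 2 * N + 1 - i with hρ
  have hA0 : ∀ i, ¬ 0 < A i → A i < 0 := by
    intro i hi
    refine lt_of_le_of_ne (not_lt.1 hi) ?_
    simp only [hA, slopeProd]
    refine List.prod_ne_zero fun h => ?_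
    obtain ⟨z, hz, hz0⟩ := List.mem_map.1 h
    exact ha z (List.mem_of_mem_drop hz) hz0
  have hpos : ∀ i j k, i < j → j < k → k ≤ N → 0 < A j → 0 < orient (V i) (V j) (V k) := by
    intro i j k hij hjk hk h
    obtain ⟨c, hc, e⟩ := orient_vertex_drop hnd hlt hgen ha hopt hij hjk hk
    simp only [hVdef, e]; exact mul_pos h hc
  have hneg : ∀ i j k, i < j → j < k → k ≤ N → ¬ 0 < A j → 0 < orient (V i) (V k) (V j) := by
    intro i j k hij hjk hk h
    obtain ⟨c, hc, e⟩ := orient_vertex_drop hnd hlt hgen ha hopt hij hjk hk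
    rw [orient_swap]; simp only [hVdef, e]
    exact neg_pos.2 (mul_neg_of_neg_of_pos (hA0 j h) hc)
  have hinj : ∀ x ≤ N, ∀ y ≤ N, ρ x = ρ y → x = y := by
    intro x hx y hy h
    simp only [hρ] at h
    split_ifs at h <;> omega
  have hV : ∀ x ≤ N, ∀ y ≤ N, ∀ z ≤ N, ρ x < ρ y → ρ y < ρ z →
      0 < orient (V x) (V y) (V z) := by
    intro x hx y hy z hz hxy hyz
    simp only [hρ] at hxy hyz
    by_cases sx : 0 < A x <;> by_cases sy : 0 < A y <;> by_cases sz : 0 < A z <;>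
      simp only [sx, sy, sz, if_true, if_false] at hxy hyz
    · exact hpos x y z hxy hyz hz sy
    · rcases lt_trichotomy z x with h | rfl | h
      · rw [← orient_rotate, ← orient_rotate]; exact hpos z x y h hxy hy sx
      · exact absurd sx sz
      rcases lt_trichotomy z y with h' | rfl | h'
      · exact hneg x z y h h' hy sz
      · exact absurd sy sz
      · exact hpos x y z hxy h' hz sy
    · omega
    · have hzy : z < y := by omega
      rcases lt_trichotomy x z with h | rfl | h
      · exact hneg x z y h hzy hy sz
      · exact absurd sx sz
      rcases lt_trichotomy x y with h' | rfl | h'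
      · rw [← orient_rotate, ← orient_rotate]; exact hpos z x y h h' hy sx
      · exact absurd sx sy
      · rw [← orient_rotate]
        rw [← orient_rotate, ← orient_rotate, ← orient_rotate, ← orient_rotate]
        exact hneg z y x hzy h' hx sy
    · omega
    · omega
    · omega
    · have hzy : z < y := by omega
      have hyx : y < x := by omega
      rw [← orient_rotate, ← orient_rotate]
      exact hneg z y x hzy hyx hx sy
  -- A nondecreasing function does not change the sign of the slope, so the vertices before and
  -- after it have consecutive ranks and span an edge of the polygon, directed according to `ρ`.
  have hedge : ∀ i ∈ I, ∃ p q, p ≤ N ∧ q ≤ N ∧ ρ q = ρ p + 1 ∧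
      ρ p = (if 0 < A (i + 1) then i else 2 * N - i) ∧ ∃ c : ℝ, 0 < c ∧
      (V q).1 - (V p).1 = c * b (s.getD i 0) ∧
      (V q).2 - (V p).2 = c * (1 - a (s.getD i 0)) := by
    intro i hi
    obtain ⟨-, hiN, hni⟩ := h₃ i hi
    have hd : s.drop i = s.getD i 0 :: s.drop (i + 1) := by
      rw [List.drop_eq_getElem_cons hiN, List.getD_eq_getElem _ _ hiN]
    have hmem : s.getD i 0 ∈ s := by
      rw [List.getD_eq_getElem _ _ hiN]; exact List.getElem_mem _
    have hai := (hs _ hmem).2 hni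
    have hAi : A i = a (s.getD i 0) * A (i + 1) := by simp only [hA]; rw [hd, slopeProd_cons]
    have hVi : V i = (-(constTerm a b (s.drop (i + 1)) + A (i + 1) * b (s.getD i 0)),
        -(1 - a (s.getD i 0) * A (i + 1))) := by
      simp only [hVdef, vertex, hA]; rw [hd, constTerm_cons, slopeProd_cons]
    have hVi' : V (i + 1) = (-constTerm a b (s.drop (i + 1)), -(1 - A (i + 1))) := rfl
    by_cases h : 0 < A (i + 1)
    · have h' : 0 < A i := by rw [hAi]; exact mul_pos hai h
      refine ⟨i, i + 1, hiN.le, hiN, by simp [hρ, h, h'], by simp [hρ, h, h'], A (i + 1), h, ?_, ?_⟩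
      · rw [hVi, hVi']; simp
      · rw [hVi, hVi']; simp only; ring
    · have h' : ¬ 0 < A i := by
        rw [hAi]; exact not_lt.2 (mul_neg_of_pos_of_neg hai (hA0 _ h)).le
      refine ⟨i + 1, i, hiN, hiN.le, ?_, ?_, -A (i + 1), neg_pos.2 (hA0 _ h), ?_, ?_⟩
      · simp only [hρ, h, h', if_false]; omega
      · simp only [hρ, h, if_false]; omega
      · rw [hVi, hVi']; simp only; ring
      · rw [hVi, hVi']; simp only; ring
  rw [← h₁, List.triplewise_map, List.triplewise_iff_getElem]
  rw [List.pairwise_iff_getElem] at h₂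
  intro i j k hij hjk hk
  have mi : I[i] ∈ I := List.getElem_mem _
  have mj : I[j] ∈ I := List.getElem_mem _
  have mk : I[k] ∈ I := List.getElem_mem _
  have rij := h₂ i j (by omega) (by omega) hij
  have rjk := h₂ j k (by omega) (by omega) hjk
  obtain ⟨p, p', hp, hp', ep, rp, c, hc, c₁, c₂⟩ := hedge _ mi
  obtain ⟨q, q', hq, hq', eq, rq, d, hd, d₁, d₂⟩ := hedge _ mj
  obtain ⟨r, r', hr, hr', er, rr, e, he, e₁, e₂⟩ := hedge _ mk
  have hcr : ∀ i ∈ I, ∀ j ∈ I, i ≠ j → cross a b (s.getD i 0) (s.getD j 0) ≠ 0 := by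
    intro i hi j hj hne
    have hi' := (h₃ i hi).2.1
    have hj' := (h₃ j hj).2.1
    rw [← blockCross_singleton, List.getD_eq_getElem _ _ hi', List.getD_eq_getElem _ _ hj']
    have hne' : s[i] ≠ s[j] := fun h => hne ((List.Nodup.getElem_inj_iff hnd).1 h)
    refine hgen _ _ (by simp) (by simp) (by simpa using hne') ?_
    simp only [List.mem_append, List.mem_singleton]
    rintro z (rfl | rfl) <;> exact hlt _ (List.getElem_mem _)
  have key : ∀ {i j p p' q q' : ℕ} {c d : ℝ}, (V p').1 - (V p).1 = c * b (s.getD i 0) →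
      (V p').2 - (V p).2 = c * (1 - a (s.getD i 0)) →
      (V q').1 - (V q).1 = d * b (s.getD j 0) →
      (V q').2 - (V q).2 = d * (1 - a (s.getD j 0)) →
      edgeCross (V p) (V p') (V q) (V q') = c * d * cross a b (s.getD i 0) (s.getD j 0) := by
    intro i j p p' q q' c d h₁ h₂ h₃ h₄
    unfold edgeCross cross; rw [h₁, h₂, h₃, h₄]; ring
  have k₁ := key c₁ c₂ d₁ d₂
  have k₂ := key d₁ d₂ e₁ e₂
  have k₃ := key e₁ e₂ c₁ c₂
  have hρij : ρ p < ρ q := by rw [rp, rq]; exact rij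
  have hρjk : ρ q < ρ r := by rw [rq, rr]; exact rjk
  have nij : I[i] ≠ I[j] := fun h => by rw [rp, rq, h] at hρij; exact lt_irrefl _ hρij
  have njk : I[j] ≠ I[k] := fun h => by rw [rq, rr, h] at hρjk; exact lt_irrefl _ hρjk
  have nki : I[k] ≠ I[i] := fun h => by rw [rq, rr, h, ← rp] at hρjk; omega
  have p₁ : 0 < c * d := mul_pos hc hd
  have p₂ : 0 < d * e := mul_pos hd he
  have p₃ : 0 < e * c := mul_pos he hc
  have := edges_ccw hinj hV hp hp' hq hq' hr hr' ep eq er hρij hρjk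
    (by rw [k₁]; exact mul_ne_zero p₁.ne' (hcr _ mi _ mj nij))
    (by rw [k₂]; exact mul_ne_zero p₂.ne' (hcr _ mj _ mk njk))
    (by rw [k₃]; exact mul_ne_zero p₃.ne' (hcr _ mk _ mi nki))
  rw [k₁, k₂, k₃, mul_pos_iff_of_pos_left p₁, mul_pos_iff_of_pos_left p₂,
    mul_pos_iff_of_pos_left p₃] at this
  exact this

section

open Filter Topology

/-! ### Degenerate inputs as limits of generic ones -/

/-- Some optimal ordering of `0, …, n - 1` has the list `L` as its boundary, up to rotation. The
functions are given by the pair `z` of their slopes and intercepts. -/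
def HasOptimalBoundary (neg : ℕ → Prop) [DecidablePred neg] (n : ℕ) (L : List ℕ)
    (z : (ℕ → ℝ) × (ℕ → ℝ)) : Prop :=
  ∃ s : List ℕ, s.Perm (List.range n) ∧
    (∀ t : List ℕ, t.Perm (List.range n) → constTerm z.1 z.2 s ≤ constTerm z.1 z.2 t) ∧
    boundary neg s ~r L

theorem continuous_slopeProd (l : List ℕ) :
    Continuous fun z : (ℕ → ℝ) × (ℕ → ℝ) => slopeProd z.1 l := by
  induction l with
  | nil => simpa using continuous_const
  | cons x l ih => simp only [slopeProd_cons]; fun_prop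

theorem continuous_constTerm (l : List ℕ) :
    Continuous fun z : (ℕ → ℝ) × (ℕ → ℝ) => constTerm z.1 z.2 l := by
  induction l with
  | nil => simpa using continuous_const
  | cons x l ih =>
    have := continuous_slopeProd l
    simp only [constTerm_cons]; fun_prop

theorem isClosed_hasOptimalBoundary (neg : ℕ → Prop) [DecidablePred neg] (n : ℕ) (L : List ℕ) :
    IsClosed {z | HasOptimalBoundary neg n L z} := by
  have e : {z | HasOptimalBoundary neg n L z} =
      ⋃ s ∈ {s : List ℕ | s.Perm (List.range n) ∧ boundary neg s ~r L},
        {z | ∀ t : List ℕ, t.Perm (List.range n) →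
          constTerm z.1 z.2 s ≤ constTerm z.1 z.2 t} := by
    ext z
    simp only [HasOptimalBoundary, Set.mem_ofPred_eq, Set.mem_iUnion, exists_prop]
    exact ⟨fun ⟨s, h₁, h₂, h₃⟩ => ⟨s, ⟨h₁, h₃⟩, h₂⟩, fun ⟨s, ⟨h₁, h₃⟩, h₂⟩ => ⟨s, h₁, h₂, h₃⟩⟩
  rw [e]
  refine Set.Finite.isClosed_biUnion ?_ fun s _ => ?_
  · refine (List.finite_toSet (List.range n).permutations).subset fun s hs => ?_
    exact List.mem_permutations.2 hs.1
  · simp only [Set.ofPred_forall]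
    exact isClosed_iInter fun t => isClosed_iInter fun _ =>
      isClosed_le (continuous_constTerm s) (continuous_constTerm t)

theorem map_slopeProd {R R' : Type*} [CommRing R] [CommRing R'] (φ : R →+* R') (a : ℕ → R)
    (l : List ℕ) : φ (slopeProd a l) = slopeProd (fun i => φ (a i)) l := by
  induction l with
  | nil => simp
  | cons x l ih => simp [ih]

theorem map_constTerm {R R' : Type*} [CommRing R] [CommRing R'] (φ : R →+* R') (a b : ℕ → R)
    (l : List ℕ) :
    φ (constTerm a b l) = constTerm (fun i => φ (a i)) (fun i => φ (b i)) l := by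
  induction l with
  | nil => simp
  | cons x l ih => simp [ih, map_slopeProd]

theorem map_blockCross {R R' : Type*} [CommRing R] [CommRing R'] (φ : R →+* R') (a b : ℕ → R)
    (X Y : List ℕ) : φ (blockCross a b X Y) =
      blockCross (fun i => φ (a i)) (fun i => φ (b i)) X Y := by
  simp [blockCross, map_constTerm, map_slopeProd]

/-- For disjoint blocks, some choice of the functions makes the vectors of the blocks
nonparallel. -/
theorem exists_blockCross_ne_zero {X Y : List ℕ} (hX : X ≠ []) (hY : Y ≠ [])
    (hnd : (X ++ Y).Nodup) :
    ∃ z : (ℕ → ℝ) × (ℕ → ℝ), blockCross z.1 z.2 X Y ≠ 0 := by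
  obtain ⟨x, X, rfl⟩ := List.exists_cons_of_ne_nil hX
  refine ⟨(fun _ => 2, Pi.single x 1), ?_⟩
  have hS : ∀ l : List ℕ, slopeProd (fun _ => (2 : ℝ)) l = 2 ^ l.length := by
    intro l; simp [slopeProd]
  have hB : ∀ l : List ℕ, x ∉ l →
      constTerm (fun _ => (2 : ℝ)) (Pi.single x 1 : ℕ → ℝ) l = 0 := by
    intro l hl
    induction l with
    | nil => rfl
    | cons y l ih =>
      rw [List.mem_cons, not_or] at hl
      rw [constTerm_cons, ih hl.2, Pi.single_eq_of_ne (Ne.symm hl.1)]; simp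
  rw [List.cons_append, List.nodup_cons, List.mem_append, not_or] at hnd
  have h2 : (1 : ℝ) < 2 ^ Y.length := one_lt_pow₀ (by norm_num) (by simpa using hY)
  simp only [blockCross, hB Y hnd.1.2, constTerm_cons, hB X hnd.1.1, hS, Pi.single_eq_same]
  have h3 : (0 : ℝ) < 2 ^ X.length := by positivity
  have : (2 : ℝ) ^ X.length * (1 - 2 ^ Y.length) ≠ 0 := mul_ne_zero h3.ne' (by linarith)
  simpa using this

/-- On the line from any input to a nondegenerate one, the cross product of two blocks is a nonzero
polynomial, so it vanishes only on a nowhere dense set of inputs. -/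
theorem dense_blockCross_ne_zero {X Y : List ℕ} (hX : X ≠ []) (hY : Y ≠ [])
    (hnd : (X ++ Y).Nodup) :
    Dense {z : (ℕ → ℝ) × (ℕ → ℝ) | blockCross z.1 z.2 X Y ≠ 0} := by
  obtain ⟨w, hw⟩ := exists_blockCross_ne_zero hX hY hnd
  intro z
  set φ : ℝ → (ℕ → ℝ) × (ℕ → ℝ) :=
    fun t => (fun i => z.1 i + t * (w.1 i - z.1 i), fun i => z.2 i + t * (w.2 i - z.2 i)) with hφ
  obtain ⟨p, hev⟩ : ∃ p : Polynomial ℝ, ∀ t, p.eval t = blockCross (φ t).1 (φ t).2 X Y := by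
    refine ⟨blockCross
      (fun i => Polynomial.C (z.1 i) + Polynomial.X * Polynomial.C (w.1 i - z.1 i))
      (fun i => Polynomial.C (z.2 i) + Polynomial.X * Polynomial.C (w.2 i - z.2 i)) X Y,
      fun t => ?_⟩
    rw [← Polynomial.coe_evalRingHom, map_blockCross]
    simp only [Polynomial.coe_evalRingHom, Polynomial.eval_add, Polynomial.eval_mul,
      Polynomial.eval_C, Polynomial.eval_X, hφ]
  have hp0 : p ≠ 0 := by
    intro h
    have h1 := hev 1
    rw [h] at h1
    apply hw
    simpa [hφ] using h1.symm
  have hfin : {t : ℝ | p.IsRoot t}.Finite := Polynomial.finite_setOfPred_isRoot hp0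
  have hd : Dense {t : ℝ | p.IsRoot t}ᶜ := hfin.countable.dense_compl ℝ
  have hc : Continuous φ := by
    refine Continuous.prodMk (continuous_pi fun i => ?_) (continuous_pi fun i => ?_) <;> fun_prop
  have h0 : φ 0 = z := by simp [hφ]
  rw [← h0]
  refine closure_mono ?_ (image_closure_subset_closure_image hc ⟨0, hd 0, rfl⟩)
  rintro _ ⟨t, ht, rfl⟩
  have : p.eval t ≠ 0 := ht
  rwa [hev] at this

theorem dense_isGeneric (n : ℕ) : Dense {z : (ℕ → ℝ) × (ℕ → ℝ) | IsGeneric z.1 z.2 n} := by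
  set S : Set (List ℕ × List ℕ) := {p | p.1 ≠ [] ∧ p.2 ≠ [] ∧ (p.1 ++ p.2).Nodup}
  have := dense_biInter_of_isOpen (S := S)
    (f := fun p => {z : (ℕ → ℝ) × (ℕ → ℝ) | blockCross z.1 z.2 p.1 p.2 ≠ 0})
    (fun p _ => by
      refine isOpen_ne_fun ?_ continuous_const
      have h₁ := continuous_slopeProd p.1
      have h₂ := continuous_slopeProd p.2
      have h₃ := continuous_constTerm p.1
      have h₄ := continuous_constTerm p.2
      unfold blockCross
      fun_prop)
    S.to_countable (fun p hp => dense_blockCross_ne_zero hp.1 hp.2.1 hp.2.2)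
  refine this.mono fun z hz X Y hX hY hnd _ => ?_
  exact Set.mem_iInter₂.1 hz (X, Y) ⟨hX, hY, hnd⟩

/-- `x` comes strictly before `y` in the order by angle, and neither vector is horizontal: the
angles are measured from the positive horizontal axis. -/
def AngleLt (z : (ℕ → ℝ) × (ℕ → ℝ)) (x y : ℕ) : Prop :=
  (0 < 1 - z.1 x ∧ 1 - z.1 y < 0) ∨
    ((0 < 1 - z.1 x ∧ 0 < 1 - z.1 y ∨ 1 - z.1 x < 0 ∧ 1 - z.1 y < 0) ∧ 0 < cross z.1 z.2 x y)

theorem continuous_cross (x y : ℕ) :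
    Continuous fun z : (ℕ → ℝ) × (ℕ → ℝ) => cross z.1 z.2 x y := by
  unfold cross; fun_prop

theorem isOpen_angleLt (x y : ℕ) : IsOpen {z | AngleLt z x y} := by
  have h₁ : ∀ x, IsOpen {z : (ℕ → ℝ) × (ℕ → ℝ) | 0 < 1 - z.1 x} := fun x =>
    isOpen_lt continuous_const (by fun_prop)
  have h₂ : ∀ x, IsOpen {z : (ℕ → ℝ) × (ℕ → ℝ) | 1 - z.1 x < 0} := fun x =>
    isOpen_lt (by fun_prop) continuous_const
  exact ((h₁ x).inter (h₂ y)).union ((((h₁ x).inter (h₁ y)).union ((h₂ x).inter (h₂ y))).inter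
    (isOpen_lt continuous_const (continuous_cross x y)))

theorem isOpen_pairwise {X : Type*} [TopologicalSpace X] {R : X → ℕ → ℕ → Prop}
    (h : ∀ i j, IsOpen {z | R z i j}) (L : List ℕ) : IsOpen {z | L.Pairwise (R z)} := by
  induction L with
  | nil => simp
  | cons x L ih =>
    simp only [List.pairwise_cons, Set.ofPred_and, Set.ofPred_forall]
    exact ((List.finite_toSet L).isOpen_biInter fun j _ => h x j).inter ih

theorem isOpen_hasSigns (neg : ℕ → Prop) (l : List ℕ) :
    IsOpen {z : (ℕ → ℝ) × (ℕ → ℝ) | HasSigns neg z.1 l} := by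
  have : {z : (ℕ → ℝ) × (ℕ → ℝ) | HasSigns neg z.1 l} =
      ⋂ i ∈ {i | i ∈ l}, {z | (neg i → z.1 i < 0) ∧ (¬ neg i → 0 < z.1 i)} := by
    ext z; simp [HasSigns]
  rw [this]
  refine (List.finite_toSet l).isOpen_biInter fun i _ => ?_
  by_cases h : neg i
  · simp only [h, true_imp_iff, not_true, false_imp_iff, and_true]
    exact isOpen_lt (by fun_prop) continuous_const
  · simp only [h, true_imp_iff, not_false_eq_true, false_imp_iff, true_and]
    exact isOpen_lt continuous_const (by fun_prop)

theorem AngleLt.isCcw {z : (ℕ → ℝ) × (ℕ → ℝ)} {u v w : ℕ} (huv : AngleLt z u v)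
    (hvw : AngleLt z v w) : IsCcw z.1 z.2 u v w := by
  have id : (1 - z.1 w) * cross z.1 z.2 u v + (1 - z.1 v) * cross z.1 z.2 w u
      + (1 - z.1 u) * cross z.1 z.2 v w = 0 := by unfold cross; ring
  unfold IsCcw
  rcases huv with ⟨yu, yv⟩ | ⟨⟨yu, yv⟩ | ⟨yu, yv⟩, c₁⟩ <;>
    rcases hvw with ⟨yv', yw⟩ | ⟨⟨yv', yw⟩ | ⟨yv', yw⟩, c₂⟩ <;> try linarith
  · by_cases h : 0 < cross z.1 z.2 w u
    · exact Or.inr (Or.inl ⟨c₂, h⟩)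
    · by_cases h' : 0 < cross z.1 z.2 u v
      · exact Or.inl ⟨h', c₂⟩
      · nlinarith [mul_nonneg_of_nonpos_of_nonpos yw.le (not_lt.1 h'),
          mul_nonneg_of_nonpos_of_nonpos yv.le (not_lt.1 h), mul_pos yu c₂]
  · by_cases h : 0 < cross z.1 z.2 w u
    · exact Or.inr (Or.inr ⟨h, c₁⟩)
    · by_cases h' : 0 < cross z.1 z.2 v w
      · exact Or.inl ⟨c₁, h'⟩
      · nlinarith [mul_neg_of_neg_of_pos yw c₁, mul_nonpos_of_nonneg_of_nonpos yv.le (not_lt.1 h),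
          mul_nonpos_of_nonneg_of_nonpos yu.le (not_lt.1 h')]
  · exact Or.inl ⟨c₁, c₂⟩
  · exact Or.inl ⟨c₁, c₂⟩

theorem triplewise_of_pairwise {α : Type*} {R : α → α → Prop} {p : α → α → α → Prop}
    (h : ∀ u v w, R u v → R u w → R v w → p u v w) {L : List α} (hL : L.Pairwise R) :
    L.Triplewise p := by
  induction L with
  | nil => exact .nil
  | cons x L ih =>
    rw [List.pairwise_cons] at hL
    rw [List.triplewise_cons]
    refine ⟨?_, ih hL.2⟩
    exact hL.2.imp_of_mem fun {u v} hu hv huv => h _ _ _ (hL.1 u hu) (hL.1 v hv) huv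

theorem exists_optimal (a b : ℕ → ℝ) (n : ℕ) : ∃ s : List ℕ, s.Perm (List.range n) ∧
    ∀ t : List ℕ, t.Perm (List.range n) → constTerm a b s ≤ constTerm a b t := by
  obtain ⟨s, hs, h⟩ := Set.exists_min_image {s : List ℕ | s.Perm (List.range n)} (constTerm a b)
    ((List.finite_toSet (List.range n).permutations).subset fun s hs =>
      List.mem_permutations.2 hs) ⟨_, List.Perm.refl _⟩
  exact ⟨s, hs, h⟩

section

variable {neg : ℕ → Prop} [DecidablePred neg] {n : ℕ} {L : List ℕ}

theorem hasOptimalBoundary_of_isGeneric {z : (ℕ → ℝ) × (ℕ → ℝ)}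
    (hL : L.Perm ((List.range n).filter fun i => ¬ neg i)) (hs : HasSigns neg z.1 (List.range n))
    (hz : L.Pairwise (AngleLt z)) (hg : IsGeneric z.1 z.2 n) : HasOptimalBoundary neg n L z := by
  obtain ⟨s, hsn, hopt⟩ := exists_optimal z.1 z.2 n
  refine ⟨s, hsn, hopt, ?_⟩
  refine isRotated_of_triplewise (p := IsCcw z.1 z.2) (fun _ _ _ h => h.rotate)
    (fun _ _ _ h => h.not_swap) ?_ ?_ ?_
  · exact (boundary_perm neg s).trans ((hsn.filter _).trans hL.symm)
  · exact triplewise_boundary (hsn.nodup_iff.2 List.nodup_range)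
      (fun i hi => List.mem_range.1 (hsn.subset hi)) hg
      (fun i hi => hs i (hsn.subset hi)) fun t ht => hopt t (ht.trans hsn)
  · exact triplewise_of_pairwise (fun _ _ _ h₁ _ h₃ => h₁.isCcw h₃) hz

theorem hasOptimalBoundary_of_angleLt {z : (ℕ → ℝ) × (ℕ → ℝ)}
    (hL : L.Perm ((List.range n).filter fun i => ¬ neg i)) (hs : HasSigns neg z.1 (List.range n))
    (hz : L.Pairwise (AngleLt z)) : HasOptimalBoundary neg n L z := by
  have ho := (isOpen_hasSigns neg (List.range n)).inter (isOpen_pairwise isOpen_angleLt L)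
  refine closure_minimal ?_ (isClosed_hasOptimalBoundary neg n L)
    ((dense_isGeneric n).open_subset_closure_inter ho ⟨hs, hz⟩)
  rintro w ⟨⟨h₁, h₂⟩, h₃⟩
  exact hasOptimalBoundary_of_isGeneric hL h₁ h₂ h₃

end

end

section

open Filter Topology

/-! ### Sorting by angle -/

/-- The angle of the vector of `x` lies in `[0, π)`. -/
def IsUpper (z : (ℕ → ℝ) × (ℕ → ℝ)) (x : ℕ) : Prop :=
  0 < 1 - z.1 x ∨ (1 - z.1 x = 0 ∧ 0 < z.2 x)

/-- The angle of the vector of `x` lies in `[π, 2π)`. -/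
def IsLower (z : (ℕ → ℝ) × (ℕ → ℝ)) (x : ℕ) : Prop :=
  1 - z.1 x < 0 ∨ (1 - z.1 x = 0 ∧ z.2 x < 0)

/-- The vectors of `x` and `y` are nonzero, and `x` comes weakly before `y` in the order by
angle. -/
def AngleLe (z : (ℕ → ℝ) × (ℕ → ℝ)) (x y : ℕ) : Prop :=
  (IsUpper z x ∧ IsLower z y) ∨
    ((IsUpper z x ∧ IsUpper z y ∨ IsLower z x ∧ IsLower z y) ∧
      (0 < cross z.1 z.2 x y ∨ (cross z.1 z.2 x y = 0 ∧
        0 < z.2 x * z.2 y + (1 - z.1 x) * (1 - z.1 y))))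

/-- The vector of each function `i` turned counterclockwise by roughly `ε * pos i`. -/
def turn (pos : ℕ → ℕ) (z : (ℕ → ℝ) × (ℕ → ℝ)) (ε : ℝ) : (ℕ → ℝ) × (ℕ → ℝ) :=
  (fun i => z.1 i - ε * pos i * z.2 i, fun i => z.2 i - ε * pos i * (1 - z.1 i))

theorem continuous_turn (pos : ℕ → ℕ) (z : (ℕ → ℝ) × (ℕ → ℝ)) : Continuous (turn pos z) := by
  refine Continuous.prodMk (continuous_pi fun i => ?_) (continuous_pi fun i => ?_) <;> fun_prop

theorem turn_zero (pos : ℕ → ℕ) (z : (ℕ → ℝ) × (ℕ → ℝ)) : turn pos z 0 = z := by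
  simp [turn]

theorem eventually_of_isOpen_turn (pos : ℕ → ℕ) (z : (ℕ → ℝ) × (ℕ → ℝ))
    {S : Set ((ℕ → ℝ) × (ℕ → ℝ))} (hS : IsOpen S) (hz : z ∈ S) :
    ∀ᶠ ε in 𝓝[>] (0 : ℝ), turn pos z ε ∈ S := by
  have : Tendsto (turn pos z) (𝓝[>] 0) (𝓝 z) := by
    have := (continuous_turn pos z).tendsto 0
    rw [turn_zero] at this
    exact this.mono_left nhdsWithin_le_nhds
  exact this (hS.mem_nhds hz)

theorem IsUpper.eventually_turn {pos : ℕ → ℕ} {z : (ℕ → ℝ) × (ℕ → ℝ)} {x : ℕ} (h : IsUpper z x)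
    (hp : 0 < pos x) : ∀ᶠ ε in 𝓝[>] (0 : ℝ), 0 < 1 - (turn pos z ε).1 x := by
  rcases h with h | ⟨h, h'⟩
  · exact eventually_of_isOpen_turn pos z (S := {w | 0 < 1 - w.1 x})
      (isOpen_lt continuous_const (by fun_prop)) h
  · filter_upwards [self_mem_nhdsWithin] with ε hε
    have : 0 < ε * pos x * z.2 x :=
      mul_pos (mul_pos (Set.mem_Ioi.1 hε) (Nat.cast_pos.2 hp)) h'
    simp only [turn]; linarith

theorem IsLower.eventually_turn {pos : ℕ → ℕ} {z : (ℕ → ℝ) × (ℕ → ℝ)} {x : ℕ} (h : IsLower z x)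
    (hp : 0 < pos x) : ∀ᶠ ε in 𝓝[>] (0 : ℝ), 1 - (turn pos z ε).1 x < 0 := by
  rcases h with h | ⟨h, h'⟩
  · exact eventually_of_isOpen_turn pos z (S := {w | 1 - w.1 x < 0})
      (isOpen_lt (by fun_prop) continuous_const) h
  · filter_upwards [self_mem_nhdsWithin] with ε hε
    have : ε * pos x * z.2 x < 0 :=
      mul_neg_of_pos_of_neg (mul_pos (Set.mem_Ioi.1 hε) (Nat.cast_pos.2 hp)) h'
    simp only [turn]; linarith

theorem AngleLe.eventually_turn {pos : ℕ → ℕ} {z : (ℕ → ℝ) × (ℕ → ℝ)} {x y : ℕ}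
    (h : AngleLe z x y) (hx : 0 < pos x) (hxy : pos x < pos y) :
    ∀ᶠ ε in 𝓝[>] (0 : ℝ), AngleLt (turn pos z ε) x y := by
  have hy : 0 < pos y := hx.trans hxy
  rcases h with ⟨ux, ly⟩ | ⟨hu, hc⟩
  · filter_upwards [ux.eventually_turn hx, ly.eventually_turn hy] with ε h₁ h₂
    exact Or.inl ⟨h₁, h₂⟩
  · have hc' : ∀ᶠ ε in 𝓝[>] (0 : ℝ), 0 < cross (turn pos z ε).1 (turn pos z ε).2 x y := by
      rcases hc with hc | ⟨hc, hd⟩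
      · exact eventually_of_isOpen_turn pos z (S := {w | 0 < cross w.1 w.2 x y})
          (isOpen_lt continuous_const (continuous_cross x y)) hc
      · filter_upwards [self_mem_nhdsWithin] with ε hε
        have e : cross (turn pos z ε).1 (turn pos z ε).2 x y
            = cross z.1 z.2 x y * (1 + ε ^ 2 * pos x * pos y) + ε * ((pos y : ℝ) - pos x) *
              (z.2 x * z.2 y + (1 - z.1 x) * (1 - z.1 y)) := by
          simp only [cross, turn]; ring
        rw [e, hc, zero_mul, zero_add]
        exact mul_pos (mul_pos (Set.mem_Ioi.1 hε) (sub_pos.2 (Nat.cast_lt.2 hxy))) hd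
    rcases hu with ⟨ux, uy⟩ | ⟨ux, uy⟩
    · filter_upwards [ux.eventually_turn hx, uy.eventually_turn hy, hc'] with ε h₁ h₂ h₃
      exact Or.inr ⟨Or.inl ⟨h₁, h₂⟩, h₃⟩
    · filter_upwards [ux.eventually_turn hx, uy.eventually_turn hy, hc'] with ε h₁ h₂ h₃
      exact Or.inr ⟨Or.inr ⟨h₁, h₂⟩, h₃⟩

theorem eventually_pairwise {X : Type*} {F : Filter X} {R : X → ℕ → ℕ → Prop} {L : List ℕ}
    (h : L.Pairwise fun i j => ∀ᶠ z in F, R z i j) : ∀ᶠ z in F, L.Pairwise (R z) := by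
  induction L with
  | nil => simp
  | cons x L ih =>
    rw [List.pairwise_cons] at h
    simp only [List.pairwise_cons]
    exact ((List.finite_toSet L).eventually_all.2 h.1).and (ih h.2)

/-- The position of a vector relative to the angles `0` and `π`, for a nondecreasing function of
slope `a` and intercept `b`: angle `0` (or zero vector), upper half-plane, angle `π`, lower
half-plane. Decreasing functions come last. -/
noncomputable def angleClass (a b : ℝ) : ℕ :=
  if a < 0 then 4 else if a < 1 then 1 else if 1 < a then 3 else if b < 0 then 2 else 0

/-- The order by angle inside the upper and the lower half-plane: the negative of the cotangent of
the angle. For horizontal vectors the value is zero. -/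
noncomputable def angleRatio (a b : ℝ) : ℝ := (0 - b) / (1 - a)

/-- The order by angle that the algorithm computes. -/
def KeyLe (z : (ℕ → ℝ) × (ℕ → ℝ)) (x y : ℕ) : Prop :=
  angleClass (z.1 x) (z.2 x) < angleClass (z.1 y) (z.2 y) ∨
    (angleClass (z.1 x) (z.2 x) = angleClass (z.1 y) (z.2 y) ∧
      angleRatio (z.1 x) (z.2 x) ≤ angleRatio (z.1 y) (z.2 y))

/-- The vectors of the nondecreasing functions scaled by `1 - t`, with zero vectors moved to angle
zero. Decreasing functions are left alone. -/
noncomputable def shrink (z : (ℕ → ℝ) × (ℕ → ℝ)) (t : ℝ) : (ℕ → ℝ) × (ℕ → ℝ) :=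
  (fun i => if z.1 i < 0 then z.1 i else z.1 i + t * (1 - z.1 i),
    fun i => if z.1 i < 0 then z.2 i else
      (1 - t) * z.2 i + t * (if z.1 i = 1 ∧ z.2 i = 0 then 1 else 0))

theorem continuous_shrink (z : (ℕ → ℝ) × (ℕ → ℝ)) : Continuous (shrink z) := by
  refine Continuous.prodMk (continuous_pi fun i => ?_) (continuous_pi fun i => ?_)
  · split_ifs <;> fun_prop
  · by_cases h : z.1 i < 0
    · simp only [h, if_true]; fun_prop
    · simp only [h, if_false]; fun_prop

theorem shrink_zero (z : (ℕ → ℝ) × (ℕ → ℝ)) : shrink z 0 = z := by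
  simp [shrink]

/-- What the angle class says about the vector `(X, Y)` after shrinking. -/
theorem shrink_spec (z : (ℕ → ℝ) × (ℕ → ℝ)) {t : ℝ} (h₀ : 0 < t) (h₁ : t < 1) {i : ℕ}
    (hi : ¬ z.1 i < 0) :
    (angleClass (z.1 i) (z.2 i) = 0 ∧ 1 - (shrink z t).1 i = 0 ∧ 0 < (shrink z t).2 i) ∨
    (angleClass (z.1 i) (z.2 i) = 1 ∧ 0 < 1 - (shrink z t).1 i ∧
      (shrink z t).2 i = -angleRatio (z.1 i) (z.2 i) * (1 - (shrink z t).1 i)) ∨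
    (angleClass (z.1 i) (z.2 i) = 2 ∧ 1 - (shrink z t).1 i = 0 ∧ (shrink z t).2 i < 0) ∨
    (angleClass (z.1 i) (z.2 i) = 3 ∧ 1 - (shrink z t).1 i < 0 ∧
      (shrink z t).2 i = -angleRatio (z.1 i) (z.2 i) * (1 - (shrink z t).1 i)) := by
  have ht : 0 < 1 - t := by linarith
  simp only [shrink, hi, if_false, angleClass, angleRatio]
  rcases lt_trichotomy (z.1 i) 1 with h | h | h
  · have hne : 1 - z.1 i ≠ 0 := by linarith
    refine Or.inr (Or.inl ⟨by simp [h], ?_, ?_⟩)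
    · have := mul_pos ht (sub_pos.2 h); linarith
    · simp only [h.ne, false_and, if_false]; field_simp; ring
  · rcases lt_trichotomy (z.2 i) 0 with hb | hb | hb
    · refine Or.inr (Or.inr (Or.inl ⟨by simp [h, hb], by simp [h], ?_⟩))
      have := mul_neg_of_pos_of_neg ht hb
      simp only [hb.ne, and_false, if_false]; linarith
    · exact Or.inl ⟨by simp [h, hb], by simp [h], by simp [h, hb, h₀]⟩
    · refine Or.inl ⟨by simp [h, hb.le], by simp [h], ?_⟩
      have := mul_pos ht hb
      simp only [hb.ne', and_false, if_false]; linarith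
  · have hne : 1 - z.1 i ≠ 0 := by linarith
    refine Or.inr (Or.inr (Or.inr ⟨by simp [h, h.le], ?_, ?_⟩))
    · have := mul_pos ht (sub_pos.2 h); linarith
    · simp only [h.ne', false_and, if_false]; field_simp; ring

theorem KeyLe.angleLe_shrink {z : (ℕ → ℝ) × (ℕ → ℝ)} {t : ℝ} (h₀ : 0 < t) (h₁ : t < 1)
    {x y : ℕ} (hx : ¬ z.1 x < 0) (hy : ¬ z.1 y < 0) (h : KeyLe z x y) :
    AngleLe (shrink z t) x y := by
  have sx := shrink_spec z h₀ h₁ hx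
  have sy := shrink_spec z h₀ h₁ hy
  unfold KeyLe at h
  unfold AngleLe IsUpper IsLower cross
  generalize angleClass (z.1 x) (z.2 x) = c at *
  generalize angleClass (z.1 y) (z.2 y) = d at *
  generalize angleRatio (z.1 x) (z.2 x) = r at *
  generalize angleRatio (z.1 y) (z.2 y) = q at *
  generalize 1 - (shrink z t).1 x = Y at *
  generalize 1 - (shrink z t).1 y = Y' at *
  generalize (shrink z t).2 x = X at *
  generalize (shrink z t).2 y = X' at *
  have hsame : ∀ {Y Y' r q : ℝ}, 0 < Y * Y' → r ≤ q →
      0 < -r * Y * Y' - -q * Y' * Y ∨ (-r * Y * Y' - -q * Y' * Y = 0 ∧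
        0 < -r * Y * (-q * Y') + Y * Y') := by
    intro Y Y' r q hp hrq
    rcases hrq.lt_or_eq with hrq | rfl
    · left; nlinarith [mul_pos (sub_pos.2 hrq) hp]
    · right
      exact ⟨by ring, by nlinarith [mul_nonneg (sq_nonneg r) hp.le]⟩
  rcases sx with ⟨rfl, e₁, e₂⟩ | ⟨rfl, e₁, e₂⟩ | ⟨rfl, e₁, e₂⟩ | ⟨rfl, e₁, e₂⟩ <;>
    rcases sy with ⟨rfl, f₁, f₂⟩ | ⟨rfl, f₁, f₂⟩ | ⟨rfl, f₁, f₂⟩ | ⟨rfl, f₁, f₂⟩ <;>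
    norm_num at h
  · exact Or.inr ⟨Or.inl ⟨Or.inr ⟨e₁, e₂⟩, Or.inr ⟨f₁, f₂⟩⟩, Or.inr ⟨by simp [e₁, f₁],
      by simpa [e₁, f₁] using mul_pos e₂ f₂⟩⟩
  · refine Or.inr ⟨Or.inl ⟨Or.inr ⟨e₁, e₂⟩, Or.inl f₁⟩, Or.inl ?_⟩
    rw [e₁]; simpa using mul_pos e₂ f₁
  · exact Or.inl ⟨Or.inr ⟨e₁, e₂⟩, Or.inr ⟨f₁, f₂⟩⟩
  · exact Or.inl ⟨Or.inr ⟨e₁, e₂⟩, Or.inl f₁⟩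
  · refine Or.inr ⟨Or.inl ⟨Or.inl e₁, Or.inl f₁⟩, ?_⟩
    rw [e₂, f₂]; exact hsame (mul_pos e₁ f₁) h
  · exact Or.inl ⟨Or.inl e₁, Or.inr ⟨f₁, f₂⟩⟩
  · exact Or.inl ⟨Or.inl e₁, Or.inl f₁⟩
  · exact Or.inr ⟨Or.inr ⟨Or.inr ⟨e₁, e₂⟩, Or.inr ⟨f₁, f₂⟩⟩, Or.inr ⟨by simp [e₁, f₁],
      by simpa [e₁, f₁] using mul_pos_of_neg_of_neg e₂ f₂⟩⟩
  · refine Or.inr ⟨Or.inr ⟨Or.inr ⟨e₁, e₂⟩, Or.inl f₁⟩, Or.inl ?_⟩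
    rw [e₁]; simpa using mul_pos_of_neg_of_neg e₂ f₁
  · refine Or.inr ⟨Or.inr ⟨Or.inl e₁, Or.inl f₁⟩, ?_⟩
    rw [e₂, f₂]; exact hsame (mul_pos_of_neg_of_neg e₁ f₁) h

section

variable {neg : ℕ → Prop} [DecidablePred neg] {n : ℕ} {L : List ℕ}

theorem hasOptimalBoundary_of_angleLe {z : (ℕ → ℝ) × (ℕ → ℝ)} {pos : ℕ → ℕ}
    (hL : L.Perm ((List.range n).filter fun i => ¬ neg i)) (hs : HasSigns neg z.1 (List.range n))
    (hz : L.Pairwise fun x y => (0 < pos x ∧ pos x < pos y) ∧ AngleLe z x y) :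
    HasOptimalBoundary neg n L z := by
  have h₁ := eventually_of_isOpen_turn pos z (isOpen_hasSigns neg (List.range n)) hs
  have h₂ : ∀ᶠ ε in 𝓝[>] (0 : ℝ), L.Pairwise (AngleLt (turn pos z ε)) :=
    eventually_pairwise (hz.imp fun h => h.2.eventually_turn h.1.1 h.1.2)
  have hc : Tendsto (turn pos z) (𝓝[>] 0) (𝓝 z) := by
    have := (continuous_turn pos z).tendsto 0
    rw [turn_zero] at this
    exact this.mono_left nhdsWithin_le_nhds
  refine (isClosed_hasOptimalBoundary neg n L).mem_of_tendsto hc ?_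
  filter_upwards [h₁, h₂] with ε h₁ h₂
  exact hasOptimalBoundary_of_angleLt hL h₁ h₂

/-- For every input, if the list `L` of the nondecreasing functions is sorted by angle, with ties
broken arbitrarily, then some optimal ordering has boundary `L` up to rotation. -/
theorem hasOptimalBoundary_of_keyLe {z : (ℕ → ℝ) × (ℕ → ℝ)} {pos : ℕ → ℕ}
    (hneg : ∀ i, neg i ↔ z.1 i < 0) (hL : L.Perm ((List.range n).filter fun i => ¬ neg i))
    (hz : L.Pairwise fun x y => (0 < pos x ∧ pos x < pos y) ∧ KeyLe z x y) :
    HasOptimalBoundary neg n L z := by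
  have hc : Tendsto (shrink z) (𝓝[>] 0) (𝓝 z) := by
    have := (continuous_shrink z).tendsto 0
    rw [shrink_zero] at this
    exact this.mono_left nhdsWithin_le_nhds
  refine (isClosed_hasOptimalBoundary neg n L).mem_of_tendsto hc ?_
  filter_upwards [Ioo_mem_nhdsGT (zero_lt_one' ℝ)] with t ht
  refine hasOptimalBoundary_of_angleLe (pos := pos) hL ?_ ?_
  · intro i _
    refine ⟨fun h => ?_, fun h => ?_⟩
    · have h' := (hneg i).1 h
      simp [shrink, h']
    · have h' := mt (hneg i).2 h
      have h'' := mul_nonneg (sub_pos.2 ht.2).le (not_lt.1 h')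
      have := ht.1
      simp only [shrink, h', if_false]; linarith
  · refine hz.imp_of_mem fun {x y} hx hy h => ⟨h.1, ?_⟩
    have hm : ∀ {x}, x ∈ L → ¬ z.1 x < 0 := fun hx => by
      have := List.mem_filter.1 (hL.subset hx)
      rw [← hneg]; simpa using this.2
    exact h.2.angleLe_shrink ht.1 ht.2 (hm hx) (hm hy)

end

end

/-! ### Orderings as paths of a dynamic program -/

/-- `SuffixState E N m k J u p l`: the list `l` is a suffix of an ordering built by prepending
functions one by one. The functions in `l` are `E p, …, E (p + u - 1)` and the `N i` for which the
bit `i` of `J` is set. The interval `[p, p + u)` may be extended on both sides, inside `[0, 3m)`,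
where `E` will be periodic with period `m`. -/
inductive SuffixState (E N : ℕ → ℕ) (m k : ℕ) : ℕ → ℕ → ℕ → List ℕ → Prop
  | nil (p : ℕ) : p ≤ 2 * m → SuffixState E N m k 0 0 p []
  | right {J u p : ℕ} {l : List ℕ} : SuffixState E N m k J u p l → u < m →
      SuffixState E N m k J (u + 1) p (E (p + u) :: l)
  | left {J u p : ℕ} {l : List ℕ} : SuffixState E N m k J u (p + 1) l → u < m → p < 2 * m →
      SuffixState E N m k J (u + 1) p (E p :: l)
  | neg {J u p i : ℕ} {l : List ℕ} : SuffixState E N m k J u p l → i < k →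
      J.testBit i = false → SuffixState E N m k (J + 2 ^ i) u p (N i :: l)

theorem testBit_add_two_pow {J i : ℕ} (h : J.testBit i = false) (j : ℕ) :
    (J + 2 ^ i).testBit j = (J.testBit j || decide (j = i)) := by
  rcases lt_trichotomy j i with hj | rfl | hj
  · rw [add_comm, Nat.testBit_two_pow_add_gt hj]; simp [hj.ne]
  · rw [add_comm, Nat.testBit_two_pow_add_eq]; simp [h]
  · obtain ⟨d, rfl⟩ := Nat.exists_eq_add_of_lt hj
    have hlt : J % 2 ^ (i + 1) < 2 ^ i := by
      by_contra hc
      have h1 : (J % 2 ^ (i + 1)).testBit i = true :=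
        Nat.testBit_of_two_pow_le_and_two_pow_add_one_gt (not_lt.1 hc)
          (Nat.mod_lt _ (by positivity))
      rw [Nat.testBit_mod_two_pow] at h1
      simp [h] at h1
    have hdiv : (J + 2 ^ i) / 2 ^ (i + 1) = J / 2 ^ (i + 1) := by
      have e := Nat.div_add_mod J (2 ^ (i + 1))
      have e2 : 2 ^ (i + 1) = 2 ^ i + 2 ^ i := by ring
      have : J + 2 ^ i = J % 2 ^ (i + 1) + 2 ^ i + 2 ^ (i + 1) * (J / 2 ^ (i + 1)) := by omega
      rw [this, Nat.add_mul_div_left _ _ (by positivity), Nat.div_eq_of_lt (by omega), zero_add]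
    have e : i + d + 1 = d + (i + 1) := by ring
    rw [e, ← Nat.testBit_div_two_pow, hdiv, Nat.testBit_div_two_pow]
    have : d + (i + 1) ≠ i := by omega
    simp [this]

theorem add_two_pow_lt {J i k : ℕ} (hJ : J < 2 ^ k) (hi : i < k) (h : J.testBit i = false) :
    J + 2 ^ i < 2 ^ k := by
  refine Nat.lt_pow_two_of_testBit _ fun j hj => ?_
  rw [testBit_add_two_pow h,
    Nat.testBit_lt_two_pow (hJ.trans_le (Nat.pow_le_pow_right (by norm_num) hj))]
  simp; omega

section

variable {E N : ℕ → ℕ} {m k : ℕ}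

theorem SuffixState.bounds {J u p : ℕ} {l : List ℕ} (h : SuffixState E N m k J u p l) :
    J < 2 ^ k ∧ u ≤ m ∧ p ≤ 2 * m := by
  induction h with
  | nil p hp => exact ⟨by positivity, Nat.zero_le _, hp⟩
  | right _ hu ih => exact ⟨ih.1, hu, ih.2.2⟩
  | left _ hu hp ih => exact ⟨ih.1, hu, hp.le⟩
  | neg _ hi hJ ih => exact ⟨add_two_pow_lt ih.1 hi hJ, ih.2⟩

/-- The functions of a state, in some fixed order. -/
def stateContent (E N : ℕ → ℕ) (k J u p : ℕ) : List ℕ :=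
  (List.range u).map (fun i => E (p + i)) ++ ((List.range k).filter J.testBit).map N

theorem filter_testBit_add_two_pow {J i k : ℕ} (hi : i < k) (h : J.testBit i = false) :
    ((List.range k).filter (J + 2 ^ i).testBit).Perm (i :: (List.range k).filter J.testBit) := by
  rw [List.perm_ext_iff_of_nodup (List.nodup_range.filter _)]
  · intro j
    simp only [List.mem_filter, List.mem_range, List.mem_cons, testBit_add_two_pow h,
      Bool.or_eq_true, decide_eq_true_eq]
    constructor
    · rintro ⟨h₁, h₂ | h₂⟩
      · exact Or.inr ⟨h₁, h₂⟩
      · exact Or.inl h₂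
    · rintro (rfl | ⟨h₁, h₂⟩)
      · exact ⟨hi, Or.inr rfl⟩
      · exact ⟨h₁, Or.inl h₂⟩
  · rw [List.nodup_cons]
    exact ⟨by simp [h], List.nodup_range.filter _⟩

theorem SuffixState.perm {J u p : ℕ} {l : List ℕ} (h : SuffixState E N m k J u p l) :
    l.Perm (stateContent E N k J u p) := by
  induction h with
  | nil p hp => simp [stateContent]
  | @right J u p l _ hu ih =>
    refine (ih.cons _).trans ?_
    unfold stateContent
    rw [List.range_succ, List.map_append, List.append_assoc]
    exact List.perm_middle.symm
  | @left J u p l _ hu hp ih =>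
    refine (ih.cons _).trans ?_
    unfold stateContent
    rw [List.range_succ_eq_map, List.map_cons, List.map_map, List.cons_append]
    refine List.Perm.of_eq ?_
    congr 3
    funext i; simp only [Function.comp]; congr 1; omega
  | @neg J u p i l _ hi hJ ih =>
    refine (ih.cons _).trans ?_
    unfold stateContent
    refine List.perm_middle.symm.trans (List.Perm.append_left _ ?_)
    rw [← List.map_cons]
    exact (filter_testBit_add_two_pow hi hJ).symm.map N

/-- The number under which the state `J, u, p` is stored. -/
def stateCode (m J u p : ℕ) : ℕ := (J * (m + 1) + u) * (2 * m + 1) + p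

theorem stateCode_add (m J J' u p : ℕ) :
    stateCode m (J + J') u p = stateCode m J u p + J' * ((m + 1) * (2 * m + 1)) := by
  unfold stateCode; ring

theorem stateCode_succ_u (m J u p : ℕ) :
    stateCode m J (u + 1) p = stateCode m J u p + (2 * m + 1) := by
  unfold stateCode; ring

theorem stateCode_succ_p (m J u p : ℕ) : stateCode m J u (p + 1) = stateCode m J u p + 1 := by
  unfold stateCode; ring

/-- The pairs of the number of a preceding state and the function whose prepending leads from that
state to the state `J, u, p`. -/
def predecessors (E N : ℕ → ℕ) (m k J u p : ℕ) : Set (ℕ × ℕ) :=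
  {x | 0 < u ∧ x.1 + (2 * m + 1) = stateCode m J u p ∧ x.2 = E (p + u - 1)} ∪
  {x | (0 < u ∧ p < 2 * m) ∧ x.1 + (2 * m + 1) = stateCode m J u p + 1 ∧ x.2 = E p} ∪
  {x | ∃ i < k, J.testBit i = true ∧
    x.1 + 2 ^ i * ((m + 1) * (2 * m + 1)) = stateCode m J u p ∧ x.2 = N i}

/-- `Trace el pr c l`: following the predecessor links `pr` from `c` and listing the functions `el`
met on the way gives the list `l`. -/
inductive Trace (el pr : ℕ → ℕ) : ℕ → List ℕ → Prop
  | nil (c : ℕ) : Trace el pr c []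
  | cons {c : ℕ} {l : List ℕ} : pr c < c → Trace el pr (pr c) l → Trace el pr c (el c :: l)

theorem Trace.congr {el pr el' pr' : ℕ → ℕ} {c : ℕ} {l : List ℕ} (h : Trace el pr c l) {B : ℕ}
    (hc : c < B) (h₁ : ∀ q < B, el' q = el q) (h₂ : ∀ q < B, pr' q = pr q) :
    Trace el' pr' c l := by
  induction h with
  | nil c => exact .nil c
  | @cons c l hlt _ ih =>
    rw [← h₁ c hc]
    refine .cons (by rwa [h₂ c hc]) ?_
    rw [h₂ c hc]; exact ih (hlt.trans hc)

/-- The table entries of the state `J, u, p` describe an optimal list of this state. -/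
def IsSolved (E N : ℕ → ℕ) (m k : ℕ) (a b A V : ℕ → ℝ) (el pr : ℕ → ℕ) (J u p : ℕ) : Prop :=
  ∃ l, SuffixState E N m k J u p l ∧ Trace el pr (stateCode m J u p) l ∧
    A (stateCode m J u p) = slopeProd a l ∧ V (stateCode m J u p) = constTerm a b l ∧
    ∀ l', SuffixState E N m k J u p l' → V (stateCode m J u p) ≤ constTerm a b l'

theorem IsSolved.congr {a b A V A' V' : ℕ → ℝ} {el pr el' pr' : ℕ → ℕ} {J u p B : ℕ}
    (h : IsSolved E N m k a b A V el pr J u p) (hB : stateCode m J u p < B)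
    (h₁ : ∀ q < B, el' q = el q) (h₂ : ∀ q < B, pr' q = pr q) (h₃ : ∀ q < B, A' q = A q)
    (h₄ : ∀ q < B, V' q = V q) : IsSolved E N m k a b A' V' el' pr' J u p := by
  obtain ⟨l, hl, ht, hA, hV, hopt⟩ := h
  exact ⟨l, hl, ht.congr hB h₁ h₂, by rw [h₃ _ hB, hA], by rw [h₄ _ hB, hV],
    fun l' hl' => by rw [h₄ _ hB]; exact hopt l' hl'⟩

/-- The table entries at the state `J, u, p` come from the best of the predecessors `S`. -/
def IsBest (b a A V : ℕ → ℝ) (el pr : ℕ → ℕ) (c : ℕ) (S : Set (ℕ × ℕ)) : Prop :=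
  (pr c, el c) ∈ S ∧ A c = A (pr c) * a (el c) ∧ V c = V (pr c) + A (pr c) * b (el c) ∧
    ∀ x ∈ S, V c ≤ V x.1 + A x.1 * b x.2

/-- A nonempty list of a state arises from a list of a predecessor by prepending a function. -/
theorem SuffixState.predecessor {J u p : ℕ} {l : List ℕ} (h : SuffixState E N m k J u p l) :
    (J = 0 ∧ u = 0 ∧ l = []) ∨ ∃ J' u' p' e l', SuffixState E N m k J' u' p' l' ∧ l = e :: l' ∧
      (stateCode m J' u' p', e) ∈ predecessors E N m k J u p := by
  cases h with
  | nil p hp => exact Or.inl ⟨rfl, rfl, rfl⟩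
  | @right J u p l h hu =>
    refine Or.inr ⟨J, u, p, _, l, h, rfl, Or.inl (Or.inl ⟨Nat.succ_pos _, ?_, ?_⟩)⟩
    · rw [stateCode_succ_u]
    · congr 1
  | @left J u p l h hu hp =>
    refine Or.inr ⟨J, u, p + 1, _, l, h, rfl, Or.inl (Or.inr ⟨⟨Nat.succ_pos _, hp⟩, ?_, rfl⟩)⟩
    rw [stateCode_succ_u, stateCode_succ_p]; ring
  | @neg J u p i l h hi hJ =>
    refine Or.inr ⟨J, u, p, _, l, h, rfl, Or.inr ⟨i, hi, ?_, ?_, rfl⟩⟩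
    · rw [testBit_add_two_pow hJ]; simp
    · rw [stateCode_add]

/-- Every pair in `predecessors` comes from a state, whose lists may be extended. -/
theorem exists_state_of_mem_predecessors {J u p : ℕ} (hJ : J < 2 ^ k) (hu : u ≤ m)
    (hp : p ≤ 2 * m) {x : ℕ × ℕ} (hx : x ∈ predecessors E N m k J u p) :
    ∃ J' u' p', J' < 2 ^ k ∧ u' ≤ m ∧ p' ≤ 2 * m ∧ x.1 = stateCode m J' u' p' ∧
      x.1 < stateCode m J u p ∧
      ∀ l, SuffixState E N m k J' u' p' l → SuffixState E N m k J u p (x.2 :: l) := by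
  obtain ⟨q, e⟩ := x
  rcases hx with (⟨h₁, h₂, h₃⟩ | ⟨⟨h₁, h₁'⟩, h₂, h₃⟩) | ⟨i, hi, hb, h₂, h₃⟩
  · obtain ⟨u, rfl⟩ : ∃ v, u = v + 1 := ⟨u - 1, by omega⟩
    dsimp only at h₂ h₃ ⊢
    subst h₃
    rw [stateCode_succ_u] at h₂ ⊢
    refine ⟨J, u, p, hJ, by omega, hp, by omega, by omega, fun l hl => ?_⟩
    exact .right hl hu
  · obtain ⟨u, rfl⟩ : ∃ v, u = v + 1 := ⟨u - 1, by omega⟩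
    dsimp only at h₂ h₃ ⊢
    subst h₃
    rw [stateCode_succ_u] at h₂ ⊢
    refine ⟨J, u, p + 1, hJ, by omega, h₁', ?_, by omega, fun l hl => .left hl hu h₁'⟩
    rw [stateCode_succ_p]; omega
  · have hle : 2 ^ i ≤ J := Nat.ge_two_pow_of_testBit hb
    obtain ⟨J, rfl⟩ := Nat.exists_eq_add_of_le' hle
    dsimp only at h₂ h₃ ⊢
    subst h₃
    have hb' : J.testBit i = false := by
      rw [add_comm, Nat.testBit_two_pow_add_eq] at hb; simpa using hb
    rw [stateCode_add] at h₂ ⊢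
    have : 0 < 2 ^ i * ((m + 1) * (2 * m + 1)) := by positivity
    exact ⟨J, u, p, (Nat.le_add_right _ _).trans_lt hJ, hu, hp, by omega, by omega,
      fun l hl => .neg hl hi hb'⟩

/-- Bellman's principle: the best extension of a best list of a predecessor is a best list, because
all lists of a predecessor have the same slope. -/
theorem isSolved_of_isBest {a b A V : ℕ → ℝ} {el pr : ℕ → ℕ} {J u p : ℕ} (hJ : J < 2 ^ k)
    (hu : u ≤ m) (hp : p ≤ 2 * m)
    (hprev : ∀ J' u' p', J' < 2 ^ k → u' ≤ m → p' ≤ 2 * m →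
      stateCode m J' u' p' < stateCode m J u p → IsSolved E N m k a b A V el pr J' u' p')
    (h : (J = 0 ∧ u = 0) ∧ A (stateCode m J u p) = 1 ∧ V (stateCode m J u p) = 0 ∨
      ¬ (J = 0 ∧ u = 0) ∧
        IsBest b a A V el pr (stateCode m J u p) (predecessors E N m k J u p)) :
    IsSolved E N m k a b A V el pr J u p := by
  have hcont : ∀ {l}, SuffixState E N m k 0 0 p l → l = [] := by
    intro l hl
    have e : (List.range k).filter (Nat.testBit 0) = [] := by
      rw [List.filter_eq_nil_iff]; simp
    have := hl.perm
    unfold stateContent at this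
    rw [e] at this
    simpa using this
  rcases h with ⟨⟨rfl, rfl⟩, h₁, h₂⟩ | ⟨hne, hmem, hA, hV, hmin⟩
  · refine ⟨[], .nil p hp, .nil _, by simp [h₁], by simp [h₂], fun l hl => ?_⟩
    rw [hcont hl, h₂]; rfl
  · obtain ⟨J', u', p', hJ', hu', hp', e, hlt, hext⟩ :=
      exists_state_of_mem_predecessors hJ hu hp hmem
    dsimp only at e hlt hext
    obtain ⟨l, hl, ht, hAl, hVl, -⟩ := hprev J' u' p' hJ' hu' hp' (e ▸ hlt)
    rw [← e] at ht hAl hVl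
    refine ⟨_ :: l, hext l hl, .cons hlt ht, ?_, ?_, fun l' hl' => ?_⟩
    · rw [hA, hAl, slopeProd_cons, mul_comm]
    · rw [hV, hAl, hVl, constTerm_cons]
    · rcases hl'.predecessor with ⟨h₁, h₂, -⟩ | ⟨J₁, u₁, p₁, f, l₁, hs, rfl, hm⟩
      · exact absurd ⟨h₁, h₂⟩ hne
      · obtain ⟨J₂, u₂, p₂, -, -, -, -, hlt₂, -⟩ := exists_state_of_mem_predecessors hJ hu hp hm
        have hb := hs.bounds
        obtain ⟨l₂, hl₂, -, hA₂, -, hopt⟩ := hprev J₁ u₁ p₁ hb.1 hb.2.1 hb.2.2 hlt₂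
        refine (hmin _ hm).trans ?_
        dsimp only
        rw [constTerm_cons, hA₂, slopeProd_perm a (hl₂.perm.trans hs.perm.symm)]
        have := hopt l₁ hs
        linarith

/-- The functions `0, …, n - 1` are the nondecreasing ones `E 0, …, E (m - 1)`, repeated
periodically, and the decreasing ones `N 0, …, N (k - 1)`. -/
structure IsLayout (neg : ℕ → Prop) (n m k : ℕ) (E N : ℕ → ℕ) : Prop where
  perm : ((List.range m).map E ++ (List.range k).map N).Perm (List.range n)
  not_neg : ∀ x < m, ¬ neg (E x)
  neg : ∀ i < k, neg (N i)
  periodic : ∀ x < 2 * m, E (x + m) = E x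

theorem IsLayout.stateContent_full {neg : ℕ → Prop} {n : ℕ} (h : IsLayout neg n m k E N) {p : ℕ}
    (hp : p ≤ 2 * m) : (stateContent E N k (2 ^ k - 1) m p).Perm (List.range n) := by
  refine List.Perm.trans ?_ h.perm
  unfold stateContent
  refine List.Perm.append ?_ (List.Perm.of_eq ?_)
  · induction p with
    | zero => simp
    | succ p ih =>
      refine List.Perm.trans ?_ (ih (by omega))
      have e := h.periodic p (by omega)
      have h₁ : (List.range (m + 1)).map (fun i => E (p + i)) =
          (List.range m).map (fun i => E (p + i)) ++ [E p] := by
        rw [List.range_succ, List.map_append]; simp [e]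
      have h₂ : (List.range (m + 1)).map (fun i => E (p + i)) =
          E p :: (List.range m).map (fun i => E (p + 1 + i)) := by
        rw [List.range_succ_eq_map, List.map_cons, List.map_map]
        congr 2
        funext i; simp only [Function.comp]; congr 1; omega
      have h₃ : (E p :: (List.range m).map (fun i => E (p + 1 + i))).Perm
          (E p :: (List.range m).map (fun i => E (p + i))) := by
        rw [← h₂, h₁]; exact List.perm_append_singleton _ _
      exact (List.perm_cons _).1 h₃
  · congr 1
    rw [List.filter_eq_self]
    intro i hi
    simpa using hi

/-- An ordering whose boundary is an interval of the periodic sequence `E` is met by the dynamic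
program: its suffixes have subintervals as their boundaries. -/
theorem IsLayout.exists_suffixState {neg : ℕ → Prop} [DecidablePred neg] {n : ℕ}
    (h : IsLayout neg n m k E N) {t : List ℕ} (hnd : t.Nodup) (ht : ∀ i ∈ t, i < n) {p u : ℕ}
    (hb : boundary neg t = (List.range u).map fun i => E (p + i)) (hpu : p + u ≤ 2 * m)
    (hu : u ≤ m) :
    ∃ J, (∀ i < k, J.testBit i = true ↔ N i ∈ t) ∧ SuffixState E N m k J u p t := by
  have hnodup := (h.perm.nodup_iff.2 List.nodup_range)
  have hinj : ∀ i < k, ∀ j < k, N i = N j → i = j := by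
    intro i hi j hj hij
    exact List.inj_on_of_nodup_map (List.nodup_append.1 hnodup).2.1 (List.mem_range.2 hi)
      (List.mem_range.2 hj) hij
  induction t generalizing p u with
  | nil =>
    have : u = 0 := by
      have := congrArg List.length hb
      simpa [boundary] using this.symm
    subst this
    exact ⟨0, by simp, .nil p (by omega)⟩
  | cons z t ih =>
    rw [List.nodup_cons] at hnd
    have ht' : ∀ i ∈ t, i < n := fun i hi => ht i (List.mem_cons_of_mem _ hi)
    unfold boundary at hb
    by_cases hn : neg z
    · rw [if_pos hn] at hb
      obtain ⟨J, hJ, hs⟩ := ih hnd.2 ht' hb hpu hu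
      have hz : z ∈ (List.range m).map E ++ (List.range k).map N :=
        h.perm.mem_iff.2 (List.mem_range.2 (ht z List.mem_cons_self))
      obtain ⟨i, hi, rfl⟩ : ∃ i < k, N i = z := by
        rcases List.mem_append.1 hz with hz | hz
        · obtain ⟨x, hx, rfl⟩ := List.mem_map.1 hz
          exact absurd hn (h.not_neg x (List.mem_range.1 hx))
        · obtain ⟨i, hi, rfl⟩ := List.mem_map.1 hz
          exact ⟨i, List.mem_range.1 hi, rfl⟩
      have hbit : J.testBit i = false := by
        rw [← Bool.not_eq_true, hJ i hi]; exact hnd.1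
      refine ⟨J + 2 ^ i, fun j hj => ?_, .neg hs hi hbit⟩
      rw [testBit_add_two_pow hbit, Bool.or_eq_true, hJ j hj, List.mem_cons, decide_eq_true_eq]
      constructor
      · rintro (h' | rfl)
        · exact Or.inr h'
        · exact Or.inl rfl
      · rintro (h' | h')
        · exact Or.inr (hinj j hj i hi h')
        · exact Or.inl h'
    · rw [if_neg hn] at hb
      have hmem : ∀ J : ℕ, (∀ i < k, J.testBit i = true ↔ N i ∈ t) →
          ∀ i < k, J.testBit i = true ↔ N i ∈ z :: t := by
        intro J hJ i hi
        rw [hJ i hi, List.mem_cons]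
        refine ⟨Or.inr, fun h' => h'.resolve_left fun e => hn (e ▸ h.neg i hi)⟩
      cases u with
      | zero => split_ifs at hb <;> simp at hb
      | succ u =>
        split_ifs at hb
        · rw [List.range_succ_eq_map, List.map_cons, List.map_map, List.cons.injEq] at hb
          obtain ⟨J, hJ, hs⟩ := ih hnd.2 ht' (p := p + 1) (u := u) (by
            rw [hb.2]; congr 1
            funext i; simp only [Function.comp]; congr 1; omega) (by omega) (by omega)
          refine ⟨J, hmem J hJ, ?_⟩
          have := SuffixState.left hs (by omega) (by omega)
          rwa [hb.1]
        · rw [List.range_succ, List.map_append, List.map_singleton] at hb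
          have hb' := List.append_inj' hb rfl
          obtain ⟨J, hJ, hs⟩ := ih hnd.2 ht' hb'.1 (by omega) (by omega)
          refine ⟨J, hmem J hJ, ?_⟩
          have := SuffixState.right hs (by omega)
          rw [List.singleton_inj.1 hb'.2]; exact this

/-- The dynamic program considers an optimal ordering: its boundary is a rotation of `E 0, …,
E (m - 1)`, that is, an interval of length `m` of the periodic sequence `E`. -/
theorem IsLayout.exists_optimal_suffixState {neg : ℕ → Prop} [DecidablePred neg] {n : ℕ}
    {z : (ℕ → ℝ) × (ℕ → ℝ)} (h : IsLayout neg n m k E N)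
    (hopt : HasOptimalBoundary neg n ((List.range m).map E) z) :
    ∃ s p, s.Perm (List.range n) ∧
      (∀ t : List ℕ, t.Perm (List.range n) → constTerm z.1 z.2 s ≤ constTerm z.1 z.2 t) ∧
      p ≤ 2 * m ∧ SuffixState E N m k (2 ^ k - 1) m p s := by
  obtain ⟨s, hs, hmin, hrot⟩ := hopt
  obtain ⟨q, hq, e⟩ := List.isRotated_iff_mod.1 hrot.symm
  simp only [List.length_map, List.length_range] at hq
  have hb : boundary neg s = (List.range m).map fun i => E (q + i) := by
    rw [← e]
    refine List.ext_getElem (by simp) fun i h₁ h₂ => ?_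
    simp only [List.length_map, List.length_range] at h₂
    rw [List.getElem_rotate]
    simp only [List.getElem_map, List.getElem_range, List.length_map, List.length_range]
    rcases lt_or_ge (i + q) m with hlt | hge
    · rw [Nat.mod_eq_of_lt hlt, add_comm]
    · rw [Nat.mod_eq_sub_mod hge, Nat.mod_eq_of_lt (by omega)]
      have := h.periodic (i + q - m) (by omega)
      rw [Nat.sub_add_cancel hge] at this
      rw [← this, add_comm]
  obtain ⟨J, hJ, hst⟩ := h.exists_suffixState (hs.nodup_iff.2 List.nodup_range)
    (fun i hi => List.mem_range.1 (hs.subset hi)) hb (by omega) le_rfl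
  have hJk : J = 2 ^ k - 1 := by
    refine Nat.eq_of_testBit_eq fun i => ?_
    rw [Nat.testBit_two_pow_sub_one]
    by_cases hi : i < k
    · have hmem : N i ∈ s := by
        refine hs.mem_iff.2 (h.perm.subset (List.mem_append_right _ ?_))
        exact List.mem_map.2 ⟨i, List.mem_range.2 hi, rfl⟩
      rw [(hJ i hi).2 hmem]; simp [hi]
    · rw [Nat.testBit_lt_two_pow (hst.bounds.1.trans_le
        (Nat.pow_le_pow_right (by norm_num) (not_lt.1 hi)))]
      simp [hi]
  subst hJk
  exact ⟨s, q, hs, hmin, by omega, hst⟩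

end

/-! ### Sorting by counting -/

/-- The strict order by angle, with ties broken by the index. -/
def KeyLt (z : (ℕ → ℝ) × (ℕ → ℝ)) (x y : ℕ) : Prop :=
  angleClass (z.1 x) (z.2 x) < angleClass (z.1 y) (z.2 y) ∨
    (angleClass (z.1 x) (z.2 x) = angleClass (z.1 y) (z.2 y) ∧
      (angleRatio (z.1 x) (z.2 x) < angleRatio (z.1 y) (z.2 y) ∨
        (angleRatio (z.1 x) (z.2 x) = angleRatio (z.1 y) (z.2 y) ∧ x < y)))

theorem KeyLt.keyLe {z : (ℕ → ℝ) × (ℕ → ℝ)} {x y : ℕ} (h : KeyLt z x y) : KeyLe z x y := by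
  rcases h with h | ⟨h, h' | ⟨h', -⟩⟩
  · exact Or.inl h
  · exact Or.inr ⟨h, h'.le⟩
  · exact Or.inr ⟨h, h'.le⟩

theorem KeyLt.irrefl (z : (ℕ → ℝ) × (ℕ → ℝ)) (x : ℕ) : ¬ KeyLt z x x := by simp [KeyLt]

theorem KeyLt.trans {z : (ℕ → ℝ) × (ℕ → ℝ)} {x y w : ℕ} (h : KeyLt z x y) (h' : KeyLt z y w) :
    KeyLt z x w := by
  unfold KeyLt at *
  rcases h with h | ⟨h, h₂ | ⟨h₂, h₃⟩⟩ <;> rcases h' with k | ⟨k, k₂ | ⟨k₂, k₃⟩⟩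
  · exact Or.inl (h.trans k)
  · exact Or.inl (k ▸ h)
  · exact Or.inl (k ▸ h)
  · exact Or.inl (h ▸ k)
  · exact Or.inr ⟨h.trans k, Or.inl (h₂.trans k₂)⟩
  · exact Or.inr ⟨h.trans k, Or.inl (k₂ ▸ h₂)⟩
  · exact Or.inl (h ▸ k)
  · exact Or.inr ⟨h.trans k, Or.inl (h₂ ▸ k₂)⟩
  · exact Or.inr ⟨h.trans k, Or.inr ⟨h₂.trans k₂, h₃.trans k₃⟩⟩

theorem KeyLt.trichotomy (z : (ℕ → ℝ) × (ℕ → ℝ)) (x y : ℕ) :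
    KeyLt z x y ∨ x = y ∨ KeyLt z y x := by
  unfold KeyLt
  rcases lt_trichotomy (angleClass (z.1 x) (z.2 x)) (angleClass (z.1 y) (z.2 y)) with h | h | h
  · exact Or.inl (Or.inl h)
  · rcases lt_trichotomy (angleRatio (z.1 x) (z.2 x)) (angleRatio (z.1 y) (z.2 y)) with k | k | k
    · exact Or.inl (Or.inr ⟨h, Or.inl k⟩)
    · rcases lt_trichotomy x y with l | l | l
      · exact Or.inl (Or.inr ⟨h, Or.inr ⟨k, l⟩⟩)
      · exact Or.inr (Or.inl l)
      · exact Or.inr (Or.inr (Or.inr ⟨h.symm, Or.inr ⟨k.symm, l⟩⟩))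
    · exact Or.inr (Or.inr (Or.inr ⟨h.symm, Or.inl k⟩))
  · exact Or.inr (Or.inr (Or.inl h))

open Classical in
/-- The number of the indices below `n` that come before `x`. -/
noncomputable def rank (z : (ℕ → ℝ) × (ℕ → ℝ)) (n x : ℕ) : ℕ := Nat.count (fun y => KeyLt z y x) n

section

variable {z : (ℕ → ℝ) × (ℕ → ℝ)} {n : ℕ}

theorem rank_lt_rank {x y : ℕ} (hx : x < n) (h : KeyLt z x y) : rank z n x < rank z n y := by
  classical
  unfold rank
  rw [Nat.count_eq_card_filter_range, Nat.count_eq_card_filter_range]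
  refine Finset.card_lt_card ((Finset.ssubset_iff_of_subset fun w hw => ?_).2 ⟨x, ?_, ?_⟩)
  · rw [Finset.mem_filter] at hw ⊢
    exact ⟨hw.1, hw.2.trans h⟩
  · rw [Finset.mem_filter]; exact ⟨Finset.mem_range.2 hx, h⟩
  · rw [Finset.mem_filter]; exact fun h' => KeyLt.irrefl z x h'.2

theorem keyLt_of_rank_lt {x y : ℕ} (hy : y < n) (h : rank z n x < rank z n y) :
    KeyLt z x y := by
  rcases KeyLt.trichotomy z x y with h' | rfl | h'
  · exact h'
  · exact absurd h (lt_irrefl _)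
  · exact absurd h (rank_lt_rank hy h').le.not_gt

theorem rank_inj {x y : ℕ} (hx : x < n) (hy : y < n) (h : rank z n x = rank z n y) : x = y := by
  rcases KeyLt.trichotomy z x y with h' | h' | h'
  · exact absurd h (rank_lt_rank hx h').ne
  · exact h'
  · exact absurd h (rank_lt_rank hy h').ne'

theorem rank_lt {x : ℕ} (hx : x < n) : rank z n x < n := by
  classical
  unfold rank
  rw [Nat.count_eq_card_filter_range]
  refine (Finset.card_lt_card (t := Finset.range n) ?_).trans_eq (Finset.card_range n)
  exact Finset.filter_ssubset.2 ⟨x, Finset.mem_range.2 hx, KeyLt.irrefl z x⟩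

theorem map_rank_perm (z : (ℕ → ℝ) × (ℕ → ℝ)) (n : ℕ) :
    ((List.range n).map (rank z n)).Perm (List.range n) := by
  have hnd : ((List.range n).map (rank z n)).Nodup :=
    List.Nodup.map_on (fun x hx y hy h =>
      rank_inj (List.mem_range.1 hx) (List.mem_range.1 hy) h) List.nodup_range
  refine (List.subperm_of_subset hnd fun x hx => ?_).perm_of_length_le (by simp)
  obtain ⟨y, hy, rfl⟩ := List.mem_map.1 hx
  exact List.mem_range.2 (rank_lt (List.mem_range.1 hy))

theorem exists_rank_eq {x : ℕ} (hx : x < n) : ∃ y < n, rank z n y = x := by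
  obtain ⟨y, hy, h⟩ := List.mem_map.1 ((map_rank_perm z n).mem_iff.2 (List.mem_range.2 hx))
  exact ⟨y, List.mem_range.1 hy, h⟩

theorem angleClass_lt_four {a b : ℝ} : angleClass a b < 4 ↔ ¬ a < 0 := by
  unfold angleClass; split_ifs <;> simp_all

theorem angleClass_eq_four {a b : ℝ} (h : a < 0) : angleClass a b = 4 := by
  simp [angleClass, h]

open Classical in
theorem rank_lt_count {x : ℕ} (hx : x < n) :
    rank z n x < Nat.count (fun i => ¬ z.1 i < 0) n ↔ ¬ z.1 x < 0 := by
  unfold rank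
  rw [Nat.count_eq_card_filter_range, Nat.count_eq_card_filter_range]
  constructor
  · intro h hneg
    refine absurd h (not_lt.2 (Finset.card_le_card fun w hw => ?_))
    rw [Finset.mem_filter] at hw ⊢
    refine ⟨hw.1, Or.inl ?_⟩
    rw [angleClass_eq_four hneg]
    exact angleClass_lt_four.2 hw.2
  · intro h
    refine Finset.card_lt_card ((Finset.ssubset_iff_of_subset fun w hw => ?_).2 ⟨x, ?_, ?_⟩)
    · rw [Finset.mem_filter] at hw ⊢
      refine ⟨hw.1, angleClass_lt_four.1
        (lt_of_le_of_lt ?_ (angleClass_lt_four (b := z.2 x).2 h) :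
          angleClass (z.1 w) (z.2 w) < 4)⟩
      rcases hw.2 with h' | h'
      · exact h'.le
      · exact h'.1.le
    · rw [Finset.mem_filter]; exact ⟨Finset.mem_range.2 hx, h⟩
    · rw [Finset.mem_filter]; exact fun h' => KeyLt.irrefl z x h'.2

open Classical in
theorem count_add_count (z : (ℕ → ℝ) × (ℕ → ℝ)) (n : ℕ) :
    Nat.count (fun i => ¬ z.1 i < 0) n + Nat.count (fun i => z.1 i < 0) n = n := by
  induction n with
  | zero => simp
  | succ n ih => rw [Nat.count_succ, Nat.count_succ]; split_ifs <;> omega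

/-- The arrays written by the sorting phase of the algorithm. -/
def IsSorted (z : (ℕ → ℝ) × (ℕ → ℝ)) (n m : ℕ) (E N : ℕ → ℕ) (x : ℕ) : Prop :=
  (¬ z.1 x < 0 → E (rank z n x) = x ∧ E (rank z n x + m) = x ∧ E (rank z n x + m + m) = x) ∧
    (z.1 x < 0 → N (rank z n x - m) = x)

open Classical in
theorem isLayout_of_isSorted {m k : ℕ} {E N : ℕ → ℕ}
    (hm : m = Nat.count (fun i => ¬ z.1 i < 0) n) (hk : k = Nat.count (fun i => z.1 i < 0) n)
    (h : ∀ x < n, IsSorted z n m E N x) : IsLayout (fun i => z.1 i < 0) n m k E N := by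
  have hmk : m + k = n := by rw [hm, hk]; exact count_add_count z n
  have hlt : ∀ {x}, x < n → (rank z n x < m ↔ ¬ z.1 x < 0) := fun hx => by
    rw [hm]; exact rank_lt_count hx
  have hE : ∀ x < m, ∃ y < n, rank z n y = x ∧ ¬ z.1 y < 0 := fun x hx => by
    obtain ⟨y, hy, rfl⟩ := exists_rank_eq (z := z) (show x < n by omega)
    exact ⟨y, hy, rfl, (hlt hy).1 hx⟩
  refine ⟨?_, ?_, ?_, ?_⟩
  · set g : ℕ → ℕ := fun x => if x < m then E x else N (x - m) with hg
    have hgr : ∀ x < n, g (rank z n x) = x := by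
      intro x hx
      by_cases hneg : z.1 x < 0
      · have : ¬ rank z n x < m := fun h' => (hlt hx).1 h' hneg
        simp only [hg, this, if_false]; exact (h x hx).2 hneg
      · have : rank z n x < m := (hlt hx).2 hneg
        simp only [hg, this, if_true]; exact ((h x hx).1 hneg).1
    have h₁ : (List.range m).map E ++ (List.range k).map N = (List.range n).map g := by
      rw [← hmk, List.range_add, List.map_append, List.map_map]
      congr 1
      · refine List.map_congr_left fun x hx => ?_
        simp [hg, List.mem_range.1 hx]
      · refine List.map_congr_left fun x hx => ?_
        simp [hg]
    have h₂ : ((List.range n).map (rank z n)).map g = List.range n := by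
      rw [List.map_map]
      conv_rhs => rw [← List.map_id (List.range n)]
      exact List.map_congr_left fun x hx => hgr x (List.mem_range.1 hx)
    rw [h₁]
    have := (map_rank_perm z n).map g
    rw [h₂] at this
    exact this.symm
  · intro x hx
    obtain ⟨y, hy, rfl, hn⟩ := hE x hx
    rw [((h y hy).1 hn).1]; exact hn
  · intro i hi
    obtain ⟨y, hy, hr⟩ := exists_rank_eq (z := z) (show m + i < n by omega)
    have hn : z.1 y < 0 := by
      by_contra hc
      have := (hlt hy).2 hc
      omega
    have := (h y hy).2 hn
    rw [hr, Nat.add_sub_cancel_left] at this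
    simpa [this] using hn
  · intro x hx
    rcases lt_or_ge x m with hxm | hxm
    · obtain ⟨y, hy, rfl, hn⟩ := hE x hxm
      rw [((h y hy).1 hn).1, ((h y hy).1 hn).2.1]
    · obtain ⟨y, hy, hr, hn⟩ := hE (x - m) (by omega)
      have hs := (h y hy).1 hn
      have e : rank z n y + m = x := by omega
      rw [e] at hs
      rw [hs.2.1, hs.2.2]

open Classical in
theorem pairwise_of_isSorted {m : ℕ} {E N : ℕ → ℕ}
    (hm : m = Nat.count (fun i => ¬ z.1 i < 0) n) (h : ∀ x < n, IsSorted z n m E N x) :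
    ((List.range m).map E).Pairwise fun x y =>
      (0 < rank z n x + 1 ∧ rank z n x + 1 < rank z n y + 1) ∧ KeyLe z x y := by
  have hmn : m ≤ n := by rw [hm]; exact Nat.count_le _
  have hE : ∀ x < m, E x < n ∧ rank z n (E x) = x := fun x hx => by
    obtain ⟨y, hy, rfl⟩ := exists_rank_eq (z := z) (show x < n by omega)
    have := (rank_lt_count hy).1 (hm ▸ hx)
    rw [((h y hy).1 this).1]; exact ⟨hy, rfl⟩
  rw [List.pairwise_map]
  refine List.pairwise_lt_range.imp_of_mem fun {x y} hx hy hxy => ?_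
  have hx' := hE x (List.mem_range.1 hx)
  have hy' := hE y (List.mem_range.1 hy)
  rw [hx'.2, hy'.2]
  refine ⟨⟨Nat.succ_pos _, by omega⟩, (keyLt_of_rank_lt hy'.1 ?_).keyLe⟩
  rw [hx'.2, hy'.2]; exact hxy

end

/-! ### Reasoning about programs -/

/-- `Runs p s T Q`: started with memory `s`, the program `p` halts after at most `T` steps with a
memory satisfying `Q`. -/
def Runs (p : Program) (s : Mem) (T : ℕ) (Q : Mem → Prop) : Prop :=
  ∃ s' t, Exec p s s' t ∧ t ≤ T ∧ Q s'

/-- The weakest precondition of a program without loops. -/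
def wp : Program → (Mem → Prop) → Mem → Prop
  | .skip, Q, s => Q s
  | .setNat a i e, Q, s => Q (s.setNat a (i.eval s) (e.eval s))
  | .setReal a i e, Q, s => Q (s.setReal a (i.eval s) (e.eval s))
  | .seq p q, Q, s => wp p (wp q Q) s
  | .ite c p q, Q, s => (c.eval s → wp p Q s) ∧ (¬ c.eval s → wp q Q s)
  | .while _ _, _, _ => False

/-- A bound for the running time of a program without loops. -/
def loopFreeCost : Program → ℕ
  | .skip => 1
  | .setNat _ i e => i.cost + e.cost + 1
  | .setReal _ i e => i.cost + e.cost + 1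
  | .seq p q => loopFreeCost p + loopFreeCost q
  | .ite c p q => c.cost + (loopFreeCost p + loopFreeCost q) + 1
  | .while _ _ => 0

theorem Runs.of_wp {p : Program} {s : Mem} {Q : Mem → Prop} (h : wp p Q s) :
    Runs p s (loopFreeCost p) Q := by
  induction p generalizing s Q with
  | skip => exact ⟨s, _, .skip s, le_rfl, h⟩
  | setNat a i e => exact ⟨_, _, .setNat s a i e, le_rfl, h⟩
  | setReal a i e => exact ⟨_, _, .setReal s a i e, le_rfl, h⟩
  | seq p q ihp ihq =>
    obtain ⟨s₁, t₁, h₁, l₁, q₁⟩ := ihp h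
    obtain ⟨s₂, t₂, h₂, l₂, q₂⟩ := ihq q₁
    exact ⟨s₂, _, .seq h₁ h₂, Nat.add_le_add l₁ l₂, q₂⟩
  | ite c p q ihp ihq =>
    by_cases hc : c.eval s
    · obtain ⟨s₁, t₁, h₁, l₁, q₁⟩ := ihp (h.1 hc)
      exact ⟨s₁, _, .iteTrue hc h₁, by simp only [loopFreeCost]; omega, q₁⟩
    · obtain ⟨s₁, t₁, h₁, l₁, q₁⟩ := ihq (h.2 hc)
      exact ⟨s₁, _, .iteFalse hc h₁, by simp only [loopFreeCost]; omega, q₁⟩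
  | _ => exact h.elim

theorem Runs.mono {p : Program} {s : Mem} {T T' : ℕ} {Q Q' : Mem → Prop} (h : Runs p s T Q)
    (hT : T ≤ T') (hQ : ∀ s, Q s → Q' s) : Runs p s T' Q' := by
  obtain ⟨s', t, he, ht, hq⟩ := h
  exact ⟨s', t, he, ht.trans hT, hQ _ hq⟩

theorem Runs.seq {p q : Program} {s : Mem} {T₁ T₂ : ℕ} {R Q : Mem → Prop} (h : Runs p s T₁ R)
    (h' : ∀ s, R s → Runs q s T₂ Q) : Runs (.seq p q) s (T₁ + T₂) Q := by
  obtain ⟨s₁, t₁, h₁, l₁, q₁⟩ := h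
  obtain ⟨s₂, t₂, h₂, l₂, q₂⟩ := h' _ q₁
  exact ⟨s₂, _, .seq h₁ h₂, Nat.add_le_add l₁ l₂, q₂⟩

/-- A loop that is run through `M` times, with invariant `I i` after `i` rounds. -/
theorem Runs.loop {c : Cond} {p : Program} {s : Mem} {T M : ℕ} (I : ℕ → Mem → Prop) (h₀ : I 0 s)
    (hstep : ∀ i < M, ∀ s, I i s → c.eval s ∧ Runs p s T (I (i + 1)))
    (hend : ∀ s, I M s → ¬ c.eval s) :
    Runs (.while c p) s (M * (T + c.cost + 1) + (c.cost + 1)) (I M) := by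
  have key : ∀ d i, i + d = M → ∀ s, I i s →
      Runs (.while c p) s (d * (T + c.cost + 1) + (c.cost + 1)) (I M) := by
    intro d
    induction d with
    | zero =>
      intro i hi s hs
      have : i = M := by omega
      subst this
      exact ⟨s, _, .whileFalse (hend s hs), by omega, hs⟩
    | succ d ih =>
      intro i hi s hs
      obtain ⟨hc, s₁, t₁, h₁, l₁, q₁⟩ := hstep i (by omega) s hs
      obtain ⟨s₂, t₂, h₂, l₂, q₂⟩ := ih (i + 1) (by omega) s₁ q₁
      refine ⟨s₂, _, .whileTrue hc h₁ h₂, ?_, q₂⟩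
      have : (d + 1) * (T + c.cost + 1) = d * (T + c.cost + 1) + (T + c.cost + 1) := by ring
      omega
  exact key M 0 (by omega) s h₀

@[simp] theorem nat_setNat (s : Mem) (a i v a' i' : ℕ) :
    (s.setNat a i v).nat a' i' = if a' = a ∧ i' = i then v else s.nat a' i' := by
  unfold Mem.setNat
  by_cases h : a' = a
  · subst h
    simp [Function.update_apply]
  · simp [h]

@[simp] theorem real_setNat (s : Mem) (a i v : ℕ) : (s.setNat a i v).real = s.real := rfl

@[simp] theorem nat_setReal (s : Mem) (a i : ℕ) (v : ℝ) : (s.setReal a i v).nat = s.nat := rfl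

@[simp] theorem real_setReal (s : Mem) (a i : ℕ) (v : ℝ) (a' i' : ℕ) :
    (s.setReal a i v).real a' i' = if a' = a ∧ i' = i then v else s.real a' i' := by
  unfold Mem.setReal
  by_cases h : a' = a
  · subst h
    simp [Function.update_apply]
  · simp [h]

/-! ### The sorting phase of the program -/

/-! The program uses the natural arrays `0`: `n`, `1`: output, `2`: angle classes, `3`: the sequence
`E`, `4`: the sequence `N`, `5`: the distances `2 ^ i * (m + 1) * (2 * m + 1)` of state numbers,
`6`: `m`, `7`: `k`, `8`: `2 * m + 1`, `9`: the functions and `10`: the predecessor links of the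
table, and `11`, …, `24` for single variables. The real arrays are `0`: slopes, `1`: intercepts,
`2`: angle ratios, and `3`, `4`: the slopes and constant terms of the table. -/

/-- The variable stored in cell `0` of the natural array `x`. -/
def var (x : ℕ) : NExp := .get x (.const 0)

/-- Assignment to a variable. -/
def assign (x : ℕ) (e : NExp) : Program := .setNat x (.const 0) e

/-- Increment of a variable. -/
def incr (x : ℕ) : Program := assign x (.add (var x) (.const 1))

/-- The memory holds the numbers and coefficients of the functions. -/
def HasInput (z : (ℕ → ℝ) × (ℕ → ℝ)) (n : ℕ) (s : Mem) : Prop :=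
  s.nat 0 0 = n ∧ (∀ i, s.real 0 i = z.1 i) ∧ ∀ i, s.real 1 i = z.2 i

/-- Computes the class and the ratio of the function with index `var 11`, and counts it. -/
def classifyBody : Program :=
  .seq (.ite (.realLt (.get 0 (var 11)) (.const 0))
    (.seq (.setNat 2 (var 11) (.const 4)) (incr 7))
    (.seq (.ite (.realLt (.get 0 (var 11)) (.const 1)) (.setNat 2 (var 11) (.const 1))
      (.ite (.realLt (.const 1) (.get 0 (var 11))) (.setNat 2 (var 11) (.const 3))
        (.ite (.realLt (.get 1 (var 11)) (.const 0)) (.setNat 2 (var 11) (.const 2))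
          (.setNat 2 (var 11) (.const 0))))) (incr 6)))
  (.seq (.setReal 2 (var 11) (.div (.sub (.const 0) (.get 1 (var 11)))
    (.sub (.const 1) (.get 0 (var 11))))) (incr 11))

/-- Computes classes and ratios, and the numbers `m` and `k`. -/
def classify : Program :=
  .seq (.seq (assign 11 (.const 0)) (.seq (assign 6 (.const 0)) (assign 7 (.const 0))))
    (.while (.natLt (var 11) (var 0)) classifyBody)

open Classical in
/-- The memory holds the input, and the first `i` functions have been classified and counted. -/
def IsClassified (z : (ℕ → ℝ) × (ℕ → ℝ)) (n i : ℕ) (s : Mem) : Prop :=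
  HasInput z n s ∧ s.nat 6 0 = Nat.count (fun i => ¬ z.1 i < 0) i ∧
    s.nat 7 0 = Nat.count (fun i => z.1 i < 0) i ∧
    ∀ j < i, s.nat 2 j = angleClass (z.1 j) (z.2 j) ∧ s.real 2 j = angleRatio (z.1 j) (z.2 j)

theorem runs_classify {z : (ℕ → ℝ) × (ℕ → ℝ)} {n : ℕ} {s : Mem} (h : HasInput z n s) :
    Runs classify s (100 * (n + 1)) (IsClassified z n n) := by
  have h₀ : wp (.seq (assign 11 (.const 0)) (.seq (assign 6 (.const 0)) (assign 7 (.const 0))))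
      (fun s => s.nat 11 0 = 0 ∧ IsClassified z n 0 s) s := by
    simpa [wp, assign, NExp.eval, IsClassified, HasInput] using h
  refine ((Runs.of_wp h₀).seq fun s hs => Runs.loop (M := n)
    (fun i s => s.nat 11 0 = i ∧ IsClassified z n i s) hs
    (T := loopFreeCost classifyBody) ?_ ?_).mono ?_ (fun s hs => hs.2)
  · rintro i hi s ⟨h₁, ⟨h₂, h₃, h₄⟩, h₅, h₆, h₇⟩
    refine ⟨by simpa [Cond.eval, NExp.eval, var, h₁, h₂] using hi, Runs.of_wp ?_⟩
    have hj : ∀ c : ℕ, c = angleClass (z.1 i) (z.2 i) → ∀ j < i + 1,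
        (if j = i then c else s.nat 2 j) = angleClass (z.1 j) (z.2 j) ∧
        (if j = i then angleRatio (z.1 i) (z.2 i) else s.real 2 j) =
          angleRatio (z.1 j) (z.2 j) := by
      intro c hc j hj
      rcases Nat.lt_succ_iff_lt_or_eq.1 hj with hj | rfl
      · simpa [hj.ne] using h₇ j hj
      · simp [hc]
    by_cases c₁ : z.1 i < 0 <;> by_cases c₂ : z.1 i < 1 <;> by_cases c₃ : 1 < z.1 i <;>
      by_cases c₄ : z.2 i < 0 <;>
      simp [wp, classifyBody, NExp.eval, RExp.eval, Cond.eval, var, assign, incr, IsClassified,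
        HasInput, h₁, h₂, h₃, h₄, h₅, h₆, Nat.count_succ, c₁, c₂, c₃, c₄] <;>
      simpa [angleRatio] using hj _ (by simp [angleClass, c₁, c₂, c₃, c₄])
  · rintro s ⟨h₁, ⟨h₂, -⟩, -⟩
    simp [Cond.eval, NExp.eval, var, h₁, h₂]
  · have e₁ : loopFreeCost classifyBody ≤ 80 := by decide
    have e₂ : (Cond.natLt (var 11) (var 0)).cost ≤ 10 := by decide
    have e₃ : loopFreeCost (.seq (assign 11 (.const 0))
      (.seq (assign 6 (.const 0)) (assign 7 (.const 0)))) ≤ 20 := by decide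
    nlinarith

/-- Disjunction of tests. -/
def orCond (c d : Cond) : Cond := .not (.and (.not c) (.not d))

/-- Tests whether the function `var 12` comes before the function `var 11` in the order `KeyLt`. -/
def keyLtCond : Cond :=
  orCond (.natLt (.get 2 (var 12)) (.get 2 (var 11)))
    (.and (.natEq (.get 2 (var 12)) (.get 2 (var 11)))
      (orCond (.realLt (.get 2 (var 12)) (.get 2 (var 11)))
        (.and (.realEq (.get 2 (var 12)) (.get 2 (var 11))) (.natLt (var 12) (var 11)))))

/-- Counts the function `var 12` if it comes before the function `var 11`. -/
def rankBody : Program := .seq (.ite keyLtCond (incr 13) .skip) (incr 12)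

/-- Enters the function `var 11` of rank `var 13` into the sequence `E` or `N`. -/
def place : Program :=
  .ite (.natLt (.get 2 (var 11)) (.const 4))
    (.seq (.setNat 3 (var 13) (var 11))
      (.seq (.setNat 3 (.add (var 13) (var 6)) (var 11))
        (.setNat 3 (.add (.add (var 13) (var 6)) (var 6)) (var 11))))
    (.setNat 4 (.sub (var 13) (var 6)) (var 11))

/-- Computes the rank of the function `var 11` and enters it into the sequence `E` or `N`. -/
def sortBody : Program :=
  .seq (.seq (assign 12 (.const 0)) (assign 13 (.const 0)))
    (.seq (.while (.natLt (var 12) (var 0)) rankBody) (.seq place (incr 11)))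

/-- Computes the sequences `E` and `N`. -/
def sortProgram : Program :=
  .seq (assign 11 (.const 0)) (.while (.natLt (var 11) (var 0)) sortBody)

open Classical in
/-- The number of nondecreasing functions. -/
noncomputable def numMono (z : (ℕ → ℝ) × (ℕ → ℝ)) (n : ℕ) : ℕ := Nat.count (fun i => ¬ z.1 i < 0) n

open Classical in
/-- The number of decreasing functions. -/
noncomputable def numNeg (z : (ℕ → ℝ) × (ℕ → ℝ)) (n : ℕ) : ℕ := Nat.count (fun i => z.1 i < 0) n

open Classical in
theorem runs_rank {z : (ℕ → ℝ) × (ℕ → ℝ)} {n i : ℕ} (hi : i < n) {E N : ℕ → ℕ} {s : Mem}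
    (h : IsClassified z n n s) (h₁ : s.nat 11 0 = i) (hE : s.nat 3 = E) (hN : s.nat 4 = N)
    (h₂ : s.nat 12 0 = 0) (h₃ : s.nat 13 0 = 0) :
    Runs (.while (.natLt (var 12) (var 0)) rankBody) s (100 * (n + 1)) (fun s =>
      IsClassified z n n s ∧ s.nat 11 0 = i ∧ s.nat 3 = E ∧ s.nat 4 = N ∧
        s.nat 13 0 = rank z n i) := by
  refine (Runs.loop (M := n) (T := loopFreeCost rankBody) (fun j s => s.nat 12 0 = j ∧
    IsClassified z n n s ∧ s.nat 11 0 = i ∧ s.nat 3 = E ∧ s.nat 4 = N ∧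
      s.nat 13 0 = Nat.count (fun y => KeyLt z y i) j) ⟨h₂, h, h₁, hE, hN, by simpa using h₃⟩
      ?_ ?_).mono ?_ (fun s hs => hs.2)
  · rintro j hj s ⟨h₁, ⟨⟨h₂, h₃, h₄⟩, h₅, h₆, h₇⟩, h₈, rfl, rfl, h₁₁⟩
    refine ⟨by simpa [Cond.eval, NExp.eval, var, h₁, h₂] using hj, Runs.of_wp ?_⟩
    have hk : keyLtCond.eval s ↔ KeyLt z j i := by
      simp only [keyLtCond, orCond, Cond.eval, NExp.eval, RExp.eval, var, h₁, h₈,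
        (h₇ j hj).1, (h₇ j hj).2, (h₇ i hi).1, (h₇ i hi).2, KeyLt]
      tauto
    simp only [rankBody, wp, hk]
    by_cases hc : KeyLt z j i <;>
      simpa [hc, wp, assign, incr, var, NExp.eval, IsClassified, HasInput, h₁, h₂, h₃, h₄, h₅, h₆,
        h₈, h₁₁, Nat.count_succ, funext_iff] using h₇
  · rintro s ⟨h₁, ⟨⟨h₂, -⟩, -⟩, -⟩
    simp [Cond.eval, NExp.eval, var, h₁, h₂]
  · have e₁ : loopFreeCost rankBody ≤ 80 := by decide
    have e₂ : (Cond.natLt (var 12) (var 0)).cost ≤ 10 := by decide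
    nlinarith

theorem runs_place {z : (ℕ → ℝ) × (ℕ → ℝ)} {n i : ℕ} (hi : i < n) {s : Mem}
    (h : IsClassified z n n s) (h₁ : s.nat 11 0 = i) (h₂ : s.nat 13 0 = rank z n i)
    (h₃ : ∀ x < i, IsSorted z n (numMono z n) (s.nat 3) (s.nat 4) x) :
    Runs (.seq place (incr 11)) s (loopFreeCost (.seq place (incr 11))) (fun s =>
      s.nat 11 0 = i + 1 ∧ IsClassified z n n s ∧
        ∀ x < i + 1, IsSorted z n (numMono z n) (s.nat 3) (s.nat 4) x) := by
  classical
  refine Runs.of_wp ?_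
  obtain ⟨⟨h₄, h₅, h₆⟩, h₇, h₈, h₉⟩ := h
  have h₇' : s.nat 6 0 = numMono z n := h₇
  have hlt : ∀ {x}, x < n → (rank z n x < numMono z n ↔ ¬ z.1 x < 0) := fun hx => rank_lt_count hx
  have hcl : (s.nat 2 i < 4) ↔ ¬ z.1 i < 0 := by rw [(h₉ i hi).1]; exact angleClass_lt_four
  have hri := hlt hi
  by_cases hneg : z.1 i < 0
  · have hc : ¬ s.nat 2 i < 4 := fun h' => hcl.1 h' hneg
    have hr : ¬ rank z n i < numMono z n := fun h' => hri.1 h' hneg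
    have key : ∀ x < i + 1, IsSorted z n (numMono z n) (s.nat 3)
        (fun y => if y = rank z n i - numMono z n then i else s.nat 4 y) x := by
      intro x hx
      rcases Nat.lt_succ_iff_lt_or_eq.1 hx with hx | rfl
      · refine ⟨(h₃ x hx).1, fun hxn => ?_⟩
        have h1 : ¬ rank z n x < numMono z n := fun h' => (hlt (hx.trans hi)).1 h' hxn
        have h2 : rank z n x ≠ rank z n i := fun h' => hx.ne (rank_inj (hx.trans hi) hi h')
        have h3 : rank z n x - numMono z n ≠ rank z n i - numMono z n := by omega
        simpa [h3] using (h₃ x hx).2 hxn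
      · exact ⟨fun h' => absurd hneg h', fun _ => by simp⟩
    simpa [place, wp, assign, incr, var, NExp.eval, Cond.eval, IsClassified, HasInput, h₁, h₂, h₄,
      h₅, h₆, h₇', h₈, hc, numMono, IsSorted] using And.intro h₉ key
  · have hc : s.nat 2 i < 4 := hcl.2 hneg
    have hr : rank z n i < numMono z n := hri.2 hneg
    have key : ∀ x < i + 1, IsSorted z n (numMono z n)
        (fun y => if y = rank z n i + numMono z n + numMono z n then i else
          if y = rank z n i + numMono z n then i else if y = rank z n i then i else s.nat 3 y)
        (s.nat 4) x := by
      intro x hx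
      rcases Nat.lt_succ_iff_lt_or_eq.1 hx with hx | rfl
      · refine ⟨fun hxn => ?_, (h₃ x hx).2⟩
        have h1 : rank z n x < numMono z n := (hlt (hx.trans hi)).2 hxn
        have h2 : rank z n x ≠ rank z n i := fun h' => hx.ne (rank_inj (hx.trans hi) hi h')
        obtain ⟨s₁, s₂, s₃⟩ := (h₃ x hx).1 hxn
        dsimp only
        refine ⟨?_, ?_, ?_⟩
        · rw [if_neg (by omega), if_neg (by omega), if_neg (by omega), s₁]
        · rw [if_neg (by omega), if_neg (by omega), if_neg (by omega), s₂]
        · rw [if_neg (by omega), if_neg (by omega), if_neg (by omega), s₃]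
      · refine ⟨fun _ => ⟨?_, ?_, ?_⟩, fun h' => absurd h' hneg⟩ <;> simp
    simpa [place, wp, assign, incr, var, NExp.eval, Cond.eval, IsClassified, HasInput, h₁, h₂, h₄,
      h₅, h₆, h₇', h₈, hc, numMono, IsSorted] using And.intro h₉ key

theorem runs_sortProgram {z : (ℕ → ℝ) × (ℕ → ℝ)} {n : ℕ} {s : Mem} (h : IsClassified z n n s) :
    Runs sortProgram s (300 * (n + 1) * (n + 1)) (fun s => IsClassified z n n s ∧
      ∀ x < n, IsSorted z n (numMono z n) (s.nat 3) (s.nat 4) x) := by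
  have h₀ : wp (assign 11 (.const 0)) (fun s => s.nat 11 0 = 0 ∧ IsClassified z n n s ∧
      ∀ x < 0, IsSorted z n (numMono z n) (s.nat 3) (s.nat 4) x) s := by
    simpa [wp, assign, NExp.eval, IsClassified, HasInput] using h
  refine ((Runs.of_wp h₀).seq fun s hs => Runs.loop (M := n)
    (T := loopFreeCost (.seq (assign 12 (.const 0)) (assign 13 (.const 0))) +
      (100 * (n + 1) + loopFreeCost (.seq place (incr 11))))
    (fun i s => s.nat 11 0 = i ∧ IsClassified z n n s ∧
      ∀ x < i, IsSorted z n (numMono z n) (s.nat 3) (s.nat 4) x) hs ?_ ?_).mono ?_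
      (fun s hs => hs.2)
  · rintro i hi s ⟨h₁, h₂, h₃⟩
    refine ⟨by simpa [Cond.eval, NExp.eval, var, h₁, h₂.1.1] using hi, ?_⟩
    have h₄ : wp (.seq (assign 12 (.const 0)) (assign 13 (.const 0))) (fun s' =>
        IsClassified z n n s' ∧ s'.nat 11 0 = i ∧ s'.nat 3 = s.nat 3 ∧ s'.nat 4 = s.nat 4 ∧
          s'.nat 12 0 = 0 ∧ s'.nat 13 0 = 0) s := by
      simpa [wp, assign, NExp.eval, IsClassified, HasInput, funext_iff, h₁] using h₂
    refine (Runs.of_wp h₄).seq fun s' hs' => (runs_rank hi hs'.1 hs'.2.1 hs'.2.2.1 hs'.2.2.2.1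
      hs'.2.2.2.2.1 hs'.2.2.2.2.2).seq fun s'' hs'' => ?_
    refine runs_place hi hs''.1 hs''.2.1 hs''.2.2.2.2 fun x hx => ?_
    rw [hs''.2.2.1, hs''.2.2.2.1]; exact h₃ x hx
  · rintro s ⟨h₁, ⟨⟨h₂, -⟩, -⟩, -⟩
    simp [Cond.eval, NExp.eval, var, h₁, h₂]
  · have e₁ : loopFreeCost (.seq (assign 12 (.const 0)) (assign 13 (.const 0))) ≤ 20 := by decide
    have e₂ : (Cond.natLt (var 11) (var 0)).cost ≤ 10 := by decide
    have e₃ : loopFreeCost (assign 11 (.const 0)) ≤ 20 := by decide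
    have e₄ : loopFreeCost (.seq place (incr 11)) ≤ 80 := by decide
    nlinarith

/-- The memory holds the input, the numbers `m` and `k` of nondecreasing and decreasing functions,
and the sequences `E` and `N`. -/
def HasSequences (z : (ℕ → ℝ) × (ℕ → ℝ)) (n m k : ℕ) (E N : ℕ → ℕ) (s : Mem) : Prop :=
  HasInput z n s ∧ s.nat 6 0 = m ∧ s.nat 7 0 = k ∧ (∀ x, s.nat 3 x = E x) ∧ ∀ x, s.nat 4 x = N x

/-- In addition, the memory holds the width `2 * m + 1` and the distances of state numbers. -/
def IsPrepared (z : (ℕ → ℝ) × (ℕ → ℝ)) (n m k : ℕ) (E N : ℕ → ℕ) (s : Mem) : Prop :=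
  HasSequences z n m k E N s ∧ s.nat 8 0 = 2 * m + 1 ∧
    ∀ i ≤ k, s.nat 5 i = 2 ^ i * ((m + 1) * (2 * m + 1))

/-- Adds `2 * m + 1` to the first distance. -/
def widthBody : Program :=
  .seq (.setNat 5 (.const 0) (.add (.get 5 (.const 0)) (var 8))) (incr 11)

/-- Doubles a distance. -/
def doubleBody : Program :=
  .seq (.setNat 5 (.add (var 12) (.const 1)) (.add (.get 5 (var 12)) (.get 5 (var 12)))) (incr 12)

/-- Initializes the computation of the distances. -/
def prepareInit : Program :=
  .seq (assign 8 (.add (.add (var 6) (var 6)) (.const 1)))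
    (.seq (.setNat 5 (.const 0) (.const 0)) (.seq (assign 11 (.const 0)) (assign 12 (.const 0))))

/-- Computes the distances of state numbers. -/
def prepare : Program :=
  .seq prepareInit (.seq (.while (.natLt (var 11) (.add (var 6) (.const 1))) widthBody)
    (.while (.natLt (var 12) (var 7)) doubleBody))

theorem runs_prepare {z : (ℕ → ℝ) × (ℕ → ℝ)} {n m k : ℕ} {E N : ℕ → ℕ} {s : Mem}
    (h : HasSequences z n m k E N s) :
    Runs prepare s (100 * (m + k + 2)) (IsPrepared z n m k E N) := by
  have h₀ : wp prepareInit (fun s => s.nat 11 0 = 0 ∧ s.nat 12 0 = 0 ∧ s.nat 8 0 = 2 * m + 1 ∧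
      s.nat 5 0 = 0 * (2 * m + 1) ∧ HasSequences z n m k E N s) s := by
    obtain ⟨⟨h₁, h₂, h₃⟩, h₄, h₅, h₆, h₇⟩ := h
    simp [prepareInit, wp, assign, NExp.eval, var, HasSequences, HasInput, h₁, h₂, h₃, h₄, h₅, h₆,
      h₇, two_mul]
  refine ((Runs.of_wp h₀).seq fun s hs => (Runs.loop (M := m + 1) (T := loopFreeCost widthBody)
    (fun i s => s.nat 11 0 = i ∧ s.nat 12 0 = 0 ∧ s.nat 8 0 = 2 * m + 1 ∧
      s.nat 5 0 = i * (2 * m + 1) ∧ HasSequences z n m k E N s) hs ?_ ?_).seq fun s hs =>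
    Runs.loop (M := k) (T := loopFreeCost doubleBody)
    (fun j s => s.nat 12 0 = j ∧ s.nat 8 0 = 2 * m + 1 ∧
      (∀ i ≤ j, s.nat 5 i = 2 ^ i * ((m + 1) * (2 * m + 1))) ∧ HasSequences z n m k E N s)
      ⟨hs.2.1, hs.2.2.1, ?_, hs.2.2.2.2⟩ ?_ ?_).mono ?_ ?_
  · rintro i hi s ⟨h₁, h₂, h₃, h₄, ⟨h₅, h₆, h₇⟩, h₈, h₉, h₁₀, h₁₁⟩
    refine ⟨by simpa [Cond.eval, NExp.eval, var, h₁, h₈] using hi, Runs.of_wp ?_⟩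
    simp [widthBody, incr, wp, assign, NExp.eval, var, HasSequences, HasInput, h₁, h₂, h₃, h₄, h₅,
      h₆, h₇, h₈, h₉, h₁₀, h₁₁]
    ring
  · rintro s ⟨h₁, -, -, -, -, h₂, -⟩
    simp [Cond.eval, NExp.eval, var, h₁, h₂]
  · intro i hi
    rw [Nat.le_zero.1 hi, hs.2.2.2.1]; simp
  · rintro j hj s ⟨h₁, h₂, h₃, ⟨h₅, h₆, h₇⟩, h₈, h₉, h₁₀, h₁₁⟩
    refine ⟨by simpa [Cond.eval, NExp.eval, var, h₁, h₉] using hj, Runs.of_wp ?_⟩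
    have key : ∀ i ≤ j + 1, (if i = j + 1 then s.nat 5 j + s.nat 5 j else s.nat 5 i) =
        2 ^ i * ((m + 1) * (2 * m + 1)) := by
      intro i hi
      by_cases hij : i = j + 1
      · rw [if_pos hij, hij, h₃ j le_rfl]; ring
      · rw [if_neg hij]; exact h₃ i (by omega)
    simpa [doubleBody, incr, wp, assign, NExp.eval, var, HasSequences, HasInput, h₁, h₂, h₅,
      h₆, h₇, h₈, h₉, h₁₀, h₁₁] using key
  · rintro s ⟨h₁, -, -, -, -, h₂, -⟩
    simp [Cond.eval, NExp.eval, var, h₁, h₂]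
  · have e₁ : loopFreeCost prepareInit ≤ 50 := by decide
    have e₂ : (Cond.natLt (var 11) (.add (var 6) (.const 1))).cost ≤ 10 := by decide
    have e₃ : (Cond.natLt (var 12) (var 7)).cost ≤ 10 := by decide
    have e₄ : loopFreeCost widthBody ≤ 40 := by decide
    have e₅ : loopFreeCost doubleBody ≤ 40 := by decide
    nlinarith
  · rintro s ⟨-, h₁, h₂, h₃⟩
    exact ⟨h₃, h₁, h₂⟩

/-! ### The dynamic program -/

theorem wp_mono {p : Program} {Q Q' : Mem → Prop} {s : Mem} (h : wp p Q s)
    (hQ : ∀ s, Q s → Q' s) : wp p Q' s := by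
  induction p generalizing s Q Q' with
  | skip => exact hQ _ h
  | setNat a i e => exact hQ _ h
  | setReal a i e => exact hQ _ h
  | seq p q ihp ihq => exact ihp h fun s hs => ihq hs hQ
  | ite c p q ihp ihq => exact ⟨fun hc => ihp (h.1 hc) hQ, fun hc => ihq (h.2 hc) hQ⟩
  | _ => exact h.elim

/-- The constant term of the list obtained by prepending the function `var 22` to the best list of
the state `var 21`. -/
def candidate : RExp :=
  .add (.get 4 (var 21)) (.mul (.get 3 (var 21)) (.get 1 (var 22)))

/-- Updates the table at the state `var 17` if prepending the function `var 22` to the best list of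
the state `var 21` is an improvement, or if nothing has been entered yet (`var 18` is zero). -/
def relax : Program :=
  .ite (orCond (.natEq (var 18) (.const 0)) (.realLt candidate (.get 4 (var 17))))
    (.seq (.setReal 4 (var 17) candidate)
      (.seq (.setReal 3 (var 17) (.mul (.get 3 (var 21)) (.get 0 (var 22))))
        (.seq (.setNat 9 (var 17) (var 22))
          (.seq (.setNat 10 (var 17) (var 21)) (assign 18 (.const 1))))))
    .skip

/-- The table is correct for all states with numbers below `c`. -/
def IsTable (z : (ℕ → ℝ) × (ℕ → ℝ)) (m k : ℕ) (E N : ℕ → ℕ) (c : ℕ) (s : Mem) : Prop :=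
  ∀ J u p, J < 2 ^ k → u ≤ m → p ≤ 2 * m → stateCode m J u p < c →
    IsSolved E N m k z.1 z.2 (s.real 3) (s.real 4) (s.nat 9) (s.nat 10) J u p

/-- The memory while the state `J, u, p` is processed. Instead of `J`, the number
`stateCode m J 0 0` is kept, from which the bits of `J` are recovered by subtracting the
distances from array `5`. -/
def IsAt (z : (ℕ → ℝ) × (ℕ → ℝ)) (n m k : ℕ) (E N : ℕ → ℕ) (J u p : ℕ) (s : Mem) : Prop :=
  IsPrepared z n m k E N s ∧ s.nat 14 0 = J * ((m + 1) * (2 * m + 1)) ∧ s.nat 15 0 = u ∧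
    s.nat 16 0 = p ∧ s.nat 17 0 = stateCode m J u p ∧ IsTable z m k E N (stateCode m J u p) s

/-- The memories `s` and `s'` differ at most in variables and in table entries from `c` on. -/
def SameBelow (c : ℕ) (s s' : Mem) : Prop :=
  (∀ x ≤ 8, ∀ i, s'.nat x i = s.nat x i) ∧ (∀ x ≤ 2, ∀ i, s'.real x i = s.real x i) ∧
    ∀ q < c, s'.nat 9 q = s.nat 9 q ∧ s'.nat 10 q = s.nat 10 q ∧ s'.real 3 q = s.real 3 q ∧
      s'.real 4 q = s.real 4 q

/-- The table entries at `c` are the best ones for the set `S` of predecessors. -/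
def IsBestAt (z : (ℕ → ℝ) × (ℕ → ℝ)) (c : ℕ) (S : Set (ℕ × ℕ)) (s : Mem) : Prop :=
  (S = ∅ ∧ s.nat 18 0 = 0) ∨
    (s.nat 18 0 = 1 ∧ IsBest z.2 z.1 (s.real 3) (s.real 4) (s.nat 9) (s.nat 10) c S ∧
      ∀ x ∈ S, x.1 < c)

section

variable {z : (ℕ → ℝ) × (ℕ → ℝ)} {n m k : ℕ} {E N : ℕ → ℕ} {J u p : ℕ}

theorem IsPrepared.sameBelow {c : ℕ} {s s' : Mem} (h : IsPrepared z n m k E N s)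
    (h' : SameBelow c s s') : IsPrepared z n m k E N s' := by
  obtain ⟨⟨⟨h₁, h₂, h₃⟩, h₄, h₅, h₆, h₇⟩, h₈, h₉⟩ := h
  obtain ⟨g, r, -⟩ := h'
  refine ⟨⟨⟨?_, fun i => ?_, fun i => ?_⟩, ?_, ?_, fun x => ?_, fun x => ?_⟩, ?_, fun i hi => ?_⟩
  · rw [g 0 (by norm_num), h₁]
  · rw [r 0 (by norm_num), h₂]
  · rw [r 1 (by norm_num), h₃]
  · rw [g 6 (by norm_num), h₄]
  · rw [g 7 (by norm_num), h₅]
  · rw [g 3 (by norm_num), h₆]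
  · rw [g 4 (by norm_num), h₇]
  · rw [g 8 (by norm_num), h₈]
  · rw [g 5 (by norm_num), h₉ i hi]

theorem IsTable.sameBelow {c : ℕ} {s s' : Mem} (h : IsTable z m k E N c s)
    (h' : SameBelow c s s') : IsTable z m k E N c s' := fun J u p hJ hu hp hc =>
  (h J u p hJ hu hp hc).congr hc (fun q hq => (h'.2.2 q hq).1) (fun q hq => (h'.2.2 q hq).2.1)
    (fun q hq => (h'.2.2 q hq).2.2.1) (fun q hq => (h'.2.2 q hq).2.2.2)

theorem IsAt.sameBelow {s s' : Mem} (h : IsAt z n m k E N J u p s)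
    (h' : SameBelow (stateCode m J u p) s s')
    (hv : ∀ x, 14 ≤ x → x ≤ 17 → s'.nat x 0 = s.nat x 0) : IsAt z n m k E N J u p s' := by
  obtain ⟨h₁, h₂, h₃, h₄, h₅, h₆⟩ := h
  refine ⟨h₁.sameBelow h', ?_, ?_, ?_, ?_, h₆.sameBelow h'⟩
  · rw [hv 14 (by norm_num) (by norm_num), h₂]
  · rw [hv 15 (by norm_num) (by norm_num), h₃]
  · rw [hv 16 (by norm_num) (by norm_num), h₄]
  · rw [hv 17 (by norm_num) (by norm_num), h₅]

/-- Assignments to variables other than those describing the current state are harmless. -/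
theorem IsAt.assign {s : Mem} (h : IsAt z n m k E N J u p s) {x v : ℕ} (hx : 18 ≤ x) :
    IsAt z n m k E N J u p (s.setNat x 0 v) := by
  refine h.sameBelow ⟨fun y hy i => ?_, fun y hy i => rfl, fun q hq => ⟨?_, ?_, rfl, rfl⟩⟩
    fun y h₁ h₂ => ?_
  · rw [nat_setNat, if_neg (by omega)]
  · rw [nat_setNat, if_neg (by omega)]
  · rw [nat_setNat, if_neg (by omega)]
  · rw [nat_setNat, if_neg (by omega)]

theorem IsBestAt.assign {c : ℕ} {S : Set (ℕ × ℕ)} {s : Mem} (h : IsBestAt z c S s) {x v : ℕ}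
    (hx : 19 ≤ x) : IsBestAt z c S (s.setNat x 0 v) := by
  have e : ∀ y, y ≤ 18 → (s.setNat x 0 v).nat y = s.nat y := fun y hy => by
    funext i; rw [nat_setNat, if_neg (by omega)]
  unfold IsBestAt
  rw [e 18 (by norm_num), e 9 (by norm_num), e 10 (by norm_num)]
  exact h

/-- One relaxation step extends the set of predecessors that have been taken into account. -/
theorem wp_relax {S : Set (ℕ × ℕ)} {q e : ℕ} {s : Mem} (h : IsAt z n m k E N J u p s)
    (hS : IsBestAt z (stateCode m J u p) S s) (hq : s.nat 21 0 = q) (he : s.nat 22 0 = e)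
    (hlt : q < stateCode m J u p) :
    wp relax (fun s' => IsAt z n m k E N J u p s' ∧
      IsBestAt z (stateCode m J u p) (S ∪ {(q, e)}) s' ∧ s'.nat 19 0 = s.nat 19 0 ∧
        s'.nat 20 0 = s.nat 20 0) s := by
  have hc : s.nat 17 0 = stateCode m J u p := h.2.2.2.2.1
  obtain ⟨h₀, h₁⟩ := h.1.1.1.2
  generalize hcc : stateCode m J u p = c at *
  refine ⟨fun hcond => ?_, fun hcond => ?_⟩
  · simp only [orCond, Cond.eval, NExp.eval, RExp.eval, candidate, var, hc, hq, he, h₁] at hcond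
    have hsame : SameBelow c s
        (((((s.setReal 4 c (s.real 4 q + s.real 3 q * z.2 e)).setReal 3 c
          (s.real 3 q * z.1 e)).setNat 9 c e).setNat 10 c q).setNat 18 0 1) := by
      refine ⟨fun x hx i => ?_, fun x hx i => ?_, fun r hr => ?_⟩
      · simp [show x ≠ 18 by omega, show x ≠ 10 by omega, show x ≠ 9 by omega]
      · simp [show x ≠ 3 by omega, show x ≠ 4 by omega]
      · simp [hr.ne]
    have hbest : IsBestAt z c (S ∪ {(q, e)})
        (((((s.setReal 4 c (s.real 4 q + s.real 3 q * z.2 e)).setReal 3 c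
          (s.real 3 q * z.1 e)).setNat 9 c e).setNat 10 c q).setNat 18 0 1) := by
      refine Or.inr ⟨by simp, ⟨?_, ?_, ?_, ?_⟩, ?_⟩
      · simp
      · simp [hlt.ne]
      · simp [hlt.ne]
      · rintro x (hx | rfl)
        · rcases hS with ⟨rfl, -⟩ | ⟨hS₁, hS₂, hS₃⟩
          · exact absurd hx (Set.notMem_empty _)
          · have hlt' : s.real 4 q + s.real 3 q * z.2 e < s.real 4 c := by
              by_contra hcon
              exact hcond ⟨by simp [hS₁], hcon⟩
            have := hS₂.2.2.2 x hx
            simp [(hS₃ x hx).ne]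
            linarith
        · simp [hlt.ne]
      · rintro x (hx | rfl)
        · rcases hS with ⟨rfl, -⟩ | ⟨-, -, hS₃⟩
          · exact absurd hx (Set.notMem_empty _)
          · exact hS₃ x hx
        · exact hlt
    have hat := (h.sameBelow (s' := _) (hcc.symm ▸ hsame) (fun x hx hx' => by
      simp [show x ≠ 18 by omega, show x ≠ 10 by omega, show x ≠ 9 by omega]))
    rw [hcc] at hat
    simpa [wp, CompositionOrdering.assign, NExp.eval, RExp.eval, candidate, var, hc, hq, he, h₀,
      h₁, hlt.ne] using And.intro hat hbest
  · simp only [orCond, Cond.eval, NExp.eval, RExp.eval, candidate, var, hc, hq, he, h₁, not_not]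
      at hcond
    refine ⟨h, ?_, rfl, rfl⟩
    rcases hS with ⟨-, h18⟩ | ⟨hS₁, hS₂, hS₃⟩
    · exact absurd h18 hcond.1
    · refine Or.inr ⟨hS₁, ⟨Or.inl hS₂.1, hS₂.2.1, hS₂.2.2.1, ?_⟩, ?_⟩
      · rintro x (hx | rfl)
        · exact hS₂.2.2.2 x hx
        · exact not_lt.1 hcond.2
      · rintro x (hx | rfl)
        · exact hS₃ x hx
        · exact hlt

/-- Enters the empty list at the root states. -/
def initState : Program :=
  .seq (assign 18 (.const 0))
    (.ite (.and (.natEq (var 15) (.const 0)) (.natEq (var 14) (.const 0)))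
      (.seq (.setReal 3 (var 17) (.const 1)) (.setReal 4 (var 17) (.const 0))) .skip)

/-- Tries the predecessors with a shorter interval. -/
def tryInterval : Program :=
  .ite (.natLt (.const 0) (var 15))
    (.seq (.seq (assign 21 (.sub (var 17) (var 8)))
        (assign 22 (.get 3 (.sub (.add (var 16) (var 15)) (.const 1)))))
      (.seq relax
        (.ite (.natLt (var 16) (.add (var 6) (var 6)))
          (.seq (.seq (assign 21 (.add (.sub (var 17) (var 8)) (.const 1)))
            (assign 22 (.get 3 (var 16)))) relax)
          .skip)))
    .skip

/-- Tries the predecessor without the decreasing function `N (var 20 - 1)`; the bits of `J` below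
the current one are kept in `var 19`. -/
def tryNeg : Program :=
  .seq (assign 20 (.sub (var 20) (.const 1)))
    (.ite (.natLt (var 19) (.get 5 (var 20))) .skip
      (.seq (.seq (assign 19 (.sub (var 19) (.get 5 (var 20))))
        (.seq (assign 21 (.sub (var 17) (.get 5 (var 20)))) (assign 22 (.get 4 (var 20)))))
        relax))

/-- Moves on to the next state. -/
def advance : Program :=
  .seq (incr 17)
    (.ite (.natLt (var 16) (.add (var 6) (var 6))) (incr 16)
      (.seq (assign 16 (.const 0))
        (.ite (.natLt (var 15) (var 6)) (incr 15)
          (.seq (assign 15 (.const 0)) (assign 14 (var 17))))))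

/-- Processes a state. -/
def stateBody : Program :=
  .seq (.seq initState (.seq tryInterval (.seq (assign 19 (var 14)) (assign 20 (var 7)))))
    (.seq (.while (.natLt (.const 0) (var 20)) tryNeg) advance)

/-- Fills the table. -/
def fillTable : Program :=
  .seq (.seq (.seq (assign 14 (.const 0)) (assign 15 (.const 0)))
      (.seq (assign 16 (.const 0)) (assign 17 (.const 0))))
    (.while (.natLt (var 17) (.get 5 (var 7))) stateBody)

/-- The entries at the state `J, u, p` are right if `S` is the set of all its predecessors. -/
def IsStateBest (z : (ℕ → ℝ) × (ℕ → ℝ)) (m J u p : ℕ) (S : Set (ℕ × ℕ)) (s : Mem) : Prop :=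
  (J = 0 ∧ u = 0) ∧ s.real 3 (stateCode m J u p) = 1 ∧ s.real 4 (stateCode m J u p) = 0 ∨
    ¬ (J = 0 ∧ u = 0) ∧ IsBestAt z (stateCode m J u p) S s

theorem IsStateBest.assign {S : Set (ℕ × ℕ)} {s : Mem} (h : IsStateBest z m J u p S s) {x v : ℕ}
    (hx : 19 ≤ x) : IsStateBest z m J u p S (s.setNat x 0 v) :=
  h.imp id fun h => ⟨h.1, h.2.assign hx⟩

theorem wp_initState {s : Mem} (h : IsAt z n m k E N J u p s) :
    wp initState (fun s' => IsAt z n m k E N J u p s' ∧ IsStateBest z m J u p ∅ s') s := by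
  have h14 := h.2.1
  have h15 := h.2.2.1
  have h17 := h.2.2.2.2.1
  have hJ : s.nat 14 0 = 0 ↔ J = 0 := by
    rw [h14]
    have : (m + 1) * (2 * m + 1) ≠ 0 := by positivity
    simp
  have hs := h.assign (x := 18) (v := 0) le_rfl
  refine ⟨fun hc => ?_, fun hc => ?_⟩
  · simp only [NExp.eval, var, Cond.eval, nat_setNat] at hc
    norm_num at hc
    rw [hJ, h15] at hc
    obtain ⟨rfl, rfl⟩ := hc
    have hs' : SameBelow (stateCode m 0 0 p) (s.setNat 18 0 0)
        (((s.setNat 18 0 0).setReal 3 (stateCode m 0 0 p) 1).setReal 4 (stateCode m 0 0 p) 0) := by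
      refine ⟨fun x hx i => rfl, fun x hx i => ?_, fun r hr => ?_⟩
      · simp [show x ≠ 3 by omega, show x ≠ 4 by omega]
      · simp [hr.ne]
    have := hs.sameBelow hs' fun x _ _ => rfl
    simpa [wp, NExp.eval, RExp.eval, var, h17, IsStateBest] using this
  · simp only [NExp.eval, var, Cond.eval, nat_setNat] at hc
    norm_num at hc
    rw [hJ, h15] at hc
    refine ⟨hs, Or.inr ⟨fun h' => hc h'.2 h'.1, Or.inl ⟨rfl, by simp [NExp.eval]⟩⟩⟩

/-- The predecessors with a shorter interval. -/
def intervalPredecessors (E : ℕ → ℕ) (m J u p : ℕ) : Set (ℕ × ℕ) :=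
  {x | 0 < u ∧ x.1 + (2 * m + 1) = stateCode m J u p ∧ x.2 = E (p + u - 1)} ∪
  {x | (0 < u ∧ p < 2 * m) ∧ x.1 + (2 * m + 1) = stateCode m J u p + 1 ∧ x.2 = E p}

theorem wp_tryInterval {s : Mem} (h : IsAt z n m k E N J u p s)
    (hS : IsStateBest z m J u p ∅ s) :
    wp tryInterval (fun s' => IsAt z n m k E N J u p s' ∧
      IsStateBest z m J u p (intervalPredecessors E m J u p) s') s := by
  have h15 := h.2.2.1
  refine ⟨fun hc => ?_, fun hc => ?_⟩
  · simp only [NExp.eval, var, Cond.eval, h15] at hc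
    have hroot : ¬ (J = 0 ∧ u = 0) := fun h' => by omega
    have hcode : 2 * m + 1 ≤ stateCode m J u p := by
      obtain ⟨v, rfl⟩ : ∃ v, u = v + 1 := ⟨u - 1, by omega⟩
      rw [stateCode_succ_u]; omega
    have hS' : IsBestAt z (stateCode m J u p) ∅ s := by
      rcases hS with ⟨h', -⟩ | ⟨-, h'⟩
      · exact absurd h' hroot
      · exact h'
    have h6 : s.nat 6 0 = m := h.1.1.2.1
    have h8 : s.nat 8 0 = 2 * m + 1 := h.1.2.1
    have h16 : s.nat 16 0 = p := h.2.2.2.1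
    have h17 : s.nat 17 0 = stateCode m J u p := h.2.2.2.2.1
    have hE : ∀ x, s.nat 3 x = E x := h.1.1.2.2.2.1
    have a₁ : IsAt z n m k E N J u p ((s.setNat 21 0 (stateCode m J u p - (2 * m + 1))).setNat 22 0
        (E (p + u - 1))) := (h.assign (by norm_num)).assign (by norm_num)
    have b₁ : IsBestAt z (stateCode m J u p) ∅ ((s.setNat 21 0
        (stateCode m J u p - (2 * m + 1))).setNat 22 0 (E (p + u - 1))) :=
      (hS'.assign (by norm_num)).assign (by norm_num)
    have hr₁ := wp_relax a₁ b₁ (q := stateCode m J u p - (2 * m + 1)) (e := E (p + u - 1))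
      (by simp) (by simp) (by omega)
    have goal₁ : wp relax (wp (.ite (.natLt (var 16) (.add (var 6) (var 6)))
          (.seq (.seq (assign 21 (.add (.sub (var 17) (var 8)) (.const 1)))
            (assign 22 (.get 3 (var 16)))) relax)
          .skip) (fun s' => IsAt z n m k E N J u p s' ∧
      IsStateBest z m J u p (intervalPredecessors E m J u p) s'))
        ((s.setNat 21 0 (stateCode m J u p - (2 * m + 1))).setNat 22 0 (E (p + u - 1))) := by
      refine wp_mono hr₁ ?_
      rintro s₁ ⟨a, b, -, -⟩
      have g6 : s₁.nat 6 0 = m := a.1.1.2.1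
      have g8 : s₁.nat 8 0 = 2 * m + 1 := a.1.2.1
      have g16 : s₁.nat 16 0 = p := a.2.2.2.1
      have g17 : s₁.nat 17 0 = stateCode m J u p := a.2.2.2.2.1
      have gE : ∀ x, s₁.nat 3 x = E x := a.1.1.2.2.2.1
      refine ⟨fun hc' => ?_, fun hc' => ?_⟩
      · simp only [NExp.eval, var, Cond.eval, g6, g16] at hc'
        have a₂ : IsAt z n m k E N J u p ((s₁.setNat 21 0
            (stateCode m J u p - (2 * m + 1) + 1)).setNat 22 0 (E p)) :=
          (a.assign (by norm_num)).assign (by norm_num)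
        have b₂ := (b.assign (x := 21) (v := stateCode m J u p - (2 * m + 1) + 1)
          (by norm_num)).assign (x := 22) (v := E p) (by norm_num)
        have hr₂ := wp_relax a₂ b₂ (q := stateCode m J u p - (2 * m + 1) + 1) (e := E p)
          (by simp) (by simp) (by omega)
        have : wp relax (fun s' => IsAt z n m k E N J u p s' ∧
            IsStateBest z m J u p (intervalPredecessors E m J u p) s') ((s₁.setNat 21 0
            (stateCode m J u p - (2 * m + 1) + 1)).setNat 22 0 (E p)) := by
          refine wp_mono hr₂ ?_
          rintro s₂ ⟨a', b', -, -⟩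
          refine ⟨a', Or.inr ⟨hroot, ?_⟩⟩
          convert b' using 1
          ext ⟨x, y⟩
          simp only [intervalPredecessors, Set.mem_union, Set.mem_ofPred_eq,
            Set.mem_empty_iff_false, Set.mem_singleton_iff, Prod.mk.injEq, false_or]
          have i₁ : x + (2 * m + 1) = stateCode m J u p ↔ x = stateCode m J u p - (2 * m + 1) := by
            omega
          have i₂ : x + (2 * m + 1) = stateCode m J u p + 1 ↔
            x = stateCode m J u p - (2 * m + 1) + 1 := by omega
          have i₃ : p < 2 * m := by omega
          simp [i₁, i₂, i₃, hc]
        simpa [wp, CompositionOrdering.assign, NExp.eval, var, g6, g8, g16, g17, gE] using this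
      · simp only [NExp.eval, var, Cond.eval, g6, g16] at hc'
        refine ⟨a, Or.inr ⟨hroot, ?_⟩⟩
        convert b using 1
        ext ⟨x, y⟩
        simp only [intervalPredecessors, Set.mem_union, Set.mem_ofPred_eq,
          Set.mem_empty_iff_false, Set.mem_singleton_iff, Prod.mk.injEq, false_or]
        have i₁ : x + (2 * m + 1) = stateCode m J u p ↔ x = stateCode m J u p - (2 * m + 1) := by
          omega
        have i₃ : ¬ p < 2 * m := by omega
        simp [i₁, i₃, hc]
    have heq : ((s.setNat 21 0 (stateCode m J u p - (2 * m + 1))).setNat 22 0 (E (p + u - 1))) =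
      (s.setNat 21 0 ((NExp.sub (var 17) (var 8)).eval s)).setNat 22 0
        ((NExp.get 3 (.sub (.add (var 16) (var 15)) (.const 1))).eval
          (s.setNat 21 0 ((NExp.sub (var 17) (var 8)).eval s))) := by
      simp [NExp.eval, var, h8, h15, h16, h17, hE]
    rw [heq] at goal₁
    exact goal₁
  · simp only [NExp.eval, var, Cond.eval, h15] at hc
    refine ⟨h, ?_⟩
    have : intervalPredecessors E m J u p = ∅ := by
      ext x; simp [intervalPredecessors, hc]
    rw [this]; exact hS

end

section

variable {z : (ℕ → ℝ) × (ℕ → ℝ)} {n m k : ℕ} {E N : ℕ → ℕ} {J u p : ℕ}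

/-- The predecessors without one of the decreasing functions `N i` with `l ≤ i`. -/
def negPredecessors (N : ℕ → ℕ) (m k J u p l : ℕ) : Set (ℕ × ℕ) :=
  {x | ∃ i < k, J.testBit i = true ∧
    x.1 + 2 ^ i * ((m + 1) * (2 * m + 1)) = stateCode m J u p ∧ x.2 = N i ∧ l ≤ i}

theorem negPredecessors_succ_of_false {l : ℕ} (h : J.testBit l = false) :
    negPredecessors N m k J u p l = negPredecessors N m k J u p (l + 1) := by
  ext x
  constructor
  · rintro ⟨i, h₁, h₂, h₃, h₄, h₅⟩
    refine ⟨i, h₁, h₂, h₃, h₄, lt_of_le_of_ne h₅ ?_⟩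
    rintro rfl
    rw [h] at h₂; cases h₂
  · rintro ⟨i, h₁, h₂, h₃, h₄, h₅⟩
    exact ⟨i, h₁, h₂, h₃, h₄, by omega⟩

theorem two_pow_mul_le_stateCode {l : ℕ} (h : J.testBit l = true) :
    2 ^ l * ((m + 1) * (2 * m + 1)) ≤ stateCode m J u p := by
  obtain ⟨J', rfl⟩ := Nat.exists_eq_add_of_le' (Nat.ge_two_pow_of_testBit h)
  rw [stateCode_add]; exact Nat.le_add_left _ _

theorem negPredecessors_succ_of_true {l : ℕ} (hl : l < k) (h : J.testBit l = true) :
    negPredecessors N m k J u p l = negPredecessors N m k J u p (l + 1) ∪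
      {(stateCode m J u p - 2 ^ l * ((m + 1) * (2 * m + 1)), N l)} := by
  have hle : 2 ^ l * ((m + 1) * (2 * m + 1)) ≤ stateCode m J u p := two_pow_mul_le_stateCode h
  ext x
  constructor
  · rintro ⟨i, h₁, h₂, h₃, h₄, h₅⟩
    rcases h₅.eq_or_lt with rfl | h₅
    · right
      refine Prod.ext ?_ h₄
      dsimp only; omega
    · exact Or.inl ⟨i, h₁, h₂, h₃, h₄, h₅⟩
  · rintro (⟨i, h₁, h₂, h₃, h₄, h₅⟩ | rfl)
    · exact ⟨i, h₁, h₂, h₃, h₄, by omega⟩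
    · exact ⟨l, hl, h, by dsimp only; omega, rfl, le_rfl⟩

theorem mod_two_pow_succ (J l : ℕ) :
    J % 2 ^ (l + 1) = J % 2 ^ l + if J.testBit l = true then 2 ^ l else 0 := by
  rw [Nat.mod_pow_succ, Nat.testBit_eq_decide_div_mod_eq]
  rcases Nat.mod_two_eq_zero_or_one (J / 2 ^ l) with h | h <;> simp [h]

/-- The memory in the loop over the decreasing functions, before `N (l - 1)` is tried. -/
def IsAtNeg (z : (ℕ → ℝ) × (ℕ → ℝ)) (n m k : ℕ) (E N : ℕ → ℕ) (J u p l : ℕ) (s : Mem) : Prop :=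
  IsAt z n m k E N J u p s ∧
    IsStateBest z m J u p (intervalPredecessors E m J u p ∪ negPredecessors N m k J u p l) s ∧
    s.nat 19 0 = (J % 2 ^ l) * ((m + 1) * (2 * m + 1)) ∧ s.nat 20 0 = l

theorem wp_tryNeg {l : ℕ} {s : Mem} (hl : l < k) (h : IsAtNeg z n m k E N J u p (l + 1) s) :
    wp tryNeg (IsAtNeg z n m k E N J u p l) s := by
  obtain ⟨h₁, h₂, h₃, h₄⟩ := h
  have hT : 0 < (m + 1) * (2 * m + 1) := by positivity
  have h5 : s.nat 5 l = 2 ^ l * ((m + 1) * (2 * m + 1)) := h₁.1.2.2 l hl.le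
  have hN : ∀ x, s.nat 4 x = N x := h₁.1.1.2.2.2.2
  have h17 : s.nat 17 0 = stateCode m J u p := h₁.2.2.2.2.1
  have a := h₁.assign (x := 20) (v := l) (by norm_num)
  have b := h₂.assign (x := 20) (v := l) (by norm_num)
  rw [mod_two_pow_succ] at h₃
  have hmod : J % 2 ^ l < 2 ^ l := Nat.mod_lt _ (by positivity)
  have hval : (NExp.sub (var 20) (.const 1)).eval s = l := by simp [NExp.eval, var, h₄]
  change wp _ _ (s.setNat 20 ((NExp.const 0).eval s) ((NExp.sub (var 20) (.const 1)).eval s))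
  rw [hval]
  by_cases hb : J.testBit l = true
  · rw [if_pos hb] at h₃
    refine ⟨fun hc => ?_, fun hc => ?_⟩
    · exfalso
      simp only [Cond.eval, NExp.eval, var, nat_setNat] at hc
      norm_num at hc
      rw [h₃, h5] at hc
      exact absurd (Nat.lt_of_mul_lt_mul_right hc) (by omega)
    · have hroot : ¬ (J = 0 ∧ u = 0) := by
        rintro ⟨rfl, -⟩; simp at hb
      have hbest : IsBestAt z (stateCode m J u p) (intervalPredecessors E m J u p ∪
          negPredecessors N m k J u p (l + 1)) (s.setNat 20 0 l) := by
        rcases b with ⟨h', -⟩ | ⟨-, h'⟩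
        · exact absurd h' hroot
        · exact h'
      have hle : 2 ^ l * ((m + 1) * (2 * m + 1)) ≤ stateCode m J u p := two_pow_mul_le_stateCode hb
      have hpos : 0 < 2 ^ l * ((m + 1) * (2 * m + 1)) := by positivity
      have a' := ((a.assign (x := 19) (v := (J % 2 ^ l) * ((m + 1) * (2 * m + 1)))
        (by norm_num)).assign (x := 21)
        (v := stateCode m J u p - 2 ^ l * ((m + 1) * (2 * m + 1))) (by norm_num)).assign (x := 22)
        (v := N l) (by norm_num)
      have b' := ((hbest.assign (x := 19) (v := (J % 2 ^ l) * ((m + 1) * (2 * m + 1)))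
        (by norm_num)).assign (x := 21)
        (v := stateCode m J u p - 2 ^ l * ((m + 1) * (2 * m + 1))) (by norm_num)).assign (x := 22)
        (v := N l) (by norm_num)
      have hr := wp_relax a' b' (q := stateCode m J u p - 2 ^ l * ((m + 1) * (2 * m + 1)))
        (e := N l) (by simp) (by simp) (by omega)
      have := wp_mono hr (Q' := IsAtNeg z n m k E N J u p l) (by
        rintro s' ⟨c₁, c₂, c₃, c₄⟩
        refine ⟨c₁, Or.inr ⟨hroot, ?_⟩, by rw [c₃]; simp, by rw [c₄]; simp⟩
        rw [negPredecessors_succ_of_true hl hb, ← Set.union_assoc]; exact c₂)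
      have hsub : (J % 2 ^ l + 2 ^ l) * ((m + 1) * (2 * m + 1)) - 2 ^ l * ((m + 1) * (2 * m + 1))
          = (J % 2 ^ l) * ((m + 1) * (2 * m + 1)) := by rw [add_mul]; omega
      simpa [wp, CompositionOrdering.assign, NExp.eval, var, h₃, h5, hN, h17, hsub] using this
  · rw [if_neg hb, add_zero] at h₃
    refine ⟨fun hc => ?_, fun hc => ?_⟩
    · refine ⟨a, ?_, by simp [NExp.eval, h₃], by simp [NExp.eval]⟩
      rw [negPredecessors_succ_of_false (by simpa using hb)]; exact b
    · exfalso
      simp only [Cond.eval, NExp.eval, var, nat_setNat] at hc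
      norm_num at hc
      rw [h₃, h5] at hc
      exact absurd (Nat.le_of_mul_le_mul_right hc hT) (by omega)

theorem predecessors_eq : predecessors E N m k J u p =
    intervalPredecessors E m J u p ∪ negPredecessors N m k J u p 0 := by
  unfold predecessors intervalPredecessors negPredecessors
  simp

theorem predecessors_nonempty (hJ : J < 2 ^ k) (h : ¬ (J = 0 ∧ u = 0)) :
    (predecessors E N m k J u p).Nonempty := by
  by_cases hu : u = 0
  · have hJ0 : J ≠ 0 := fun h' => h ⟨h', hu⟩
    obtain ⟨i, hi⟩ := Nat.exists_testBit_of_ne_zero hJ0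
    have hik : i < k := by
      by_contra hc
      rw [Nat.testBit_lt_two_pow (hJ.trans_le (Nat.pow_le_pow_right (by norm_num)
        (not_lt.1 hc)))] at hi
      cases hi
    exact ⟨(stateCode m J u p - 2 ^ i * ((m + 1) * (2 * m + 1)), N i), Or.inr ⟨i, hik, hi,
      Nat.sub_add_cancel (two_pow_mul_le_stateCode hi), rfl⟩⟩
  · obtain ⟨v, rfl⟩ : ∃ v, u = v + 1 := ⟨u - 1, by omega⟩
    exact ⟨(stateCode m J v p, E (p + (v + 1) - 1)), Or.inl (Or.inl ⟨Nat.succ_pos _,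
      (stateCode_succ_u _ _ _ _).symm, rfl⟩)⟩

theorem mul_add_inj {W a b p q : ℕ} (hp : p < W) (hq : q < W) (h : a * W + p = b * W + q) :
    a = b ∧ p = q := by
  have hW : 0 < W := by omega
  have h₁ := congrArg (· / W) h
  simp only [mul_comm _ W, Nat.mul_add_div hW, Nat.div_eq_of_lt hp, Nat.div_eq_of_lt hq,
    add_zero] at h₁
  subst h₁
  exact ⟨rfl, by omega⟩

theorem stateCode_inj {J' u' p' : ℕ} (hu : u ≤ m) (hp : p ≤ 2 * m) (hu' : u' ≤ m)
    (hp' : p' ≤ 2 * m) (h : stateCode m J u p = stateCode m J' u' p') :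
    J = J' ∧ u = u' ∧ p = p' := by
  unfold stateCode at h
  obtain ⟨h₁, h₂⟩ := mul_add_inj (by omega) (by omega) h
  obtain ⟨h₃, h₄⟩ := mul_add_inj (by omega) (by omega) h₁
  exact ⟨h₃, h₄, h₂⟩

theorem IsTable.succ {s : Mem} (hJ : J < 2 ^ k) (hu : u ≤ m) (hp : p ≤ 2 * m)
    (h : IsTable z m k E N (stateCode m J u p) s)
    (hbest : IsStateBest z m J u p (predecessors E N m k J u p) s) :
    IsTable z m k E N (stateCode m J u p + 1) s := by
  intro J' u' p' hJ' hu' hp' hlt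
  rcases Nat.lt_succ_iff_lt_or_eq.1 hlt with hlt | heq
  · exact h J' u' p' hJ' hu' hp' hlt
  · obtain ⟨rfl, rfl, rfl⟩ := stateCode_inj hu' hp' hu hp heq
    refine isSolved_of_isBest hJ' hu' hp' h ?_
    rcases hbest with h' | ⟨hr, ⟨he, -⟩ | h'⟩
    · exact Or.inl h'
    · exact absurd he (predecessors_nonempty hJ' hr).ne_empty
    · exact Or.inr ⟨hr, h'.2.1⟩

/-- The memory before the state with number `c` is processed. -/
def IsFilled (z : (ℕ → ℝ) × (ℕ → ℝ)) (n m k : ℕ) (E N : ℕ → ℕ) (c : ℕ) (s : Mem) : Prop :=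
  ∃ J u p, u ≤ m ∧ p ≤ 2 * m ∧ c = stateCode m J u p ∧ IsAt z n m k E N J u p s

theorem wp_advance {s : Mem} (hu : u ≤ m) (hp : p ≤ 2 * m) (h : IsAt z n m k E N J u p s)
    (h' : IsTable z m k E N (stateCode m J u p + 1) s) :
    wp advance (IsFilled z n m k E N (stateCode m J u p + 1)) s := by
  obtain ⟨h₁, h14, h15, h16, h17, -⟩ := h
  have h6 : s.nat 6 0 = m := h₁.1.2.1
  have hsame : ∀ a b c d : ℕ, SameBelow (stateCode m J u p + 1) s
      ((((s.setNat 17 0 d).setNat 16 0 c).setNat 15 0 b).setNat 14 0 a) := by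
    intro a b c d
    refine ⟨fun x hx i => ?_, fun x hx i => rfl, fun q hq => by simp⟩
    simp [show x ≠ 17 by omega, show x ≠ 16 by omega, show x ≠ 15 by omega,
      show x ≠ 14 by omega]
  have key : ∀ (J' u' p' : ℕ) (s' : Mem), u' ≤ m → p' ≤ 2 * m →
      stateCode m J u p + 1 = stateCode m J' u' p' → SameBelow (stateCode m J u p + 1) s s' →
      s'.nat 14 0 = J' * ((m + 1) * (2 * m + 1)) → s'.nat 15 0 = u' → s'.nat 16 0 = p' →
      s'.nat 17 0 = stateCode m J u p + 1 →
      IsFilled z n m k E N (stateCode m J u p + 1) s' := by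
    intro J' u' p' s' hu' hp' hc hs g₁ g₂ g₃ g₄
    exact ⟨J', u', p', hu', hp', hc, h₁.sameBelow hs, g₁, g₂, g₃, by rw [g₄, hc],
      by rw [← hc]; exact h'.sameBelow hs⟩
  have hframe : ∀ x v, 14 ≤ x → ∀ s', SameBelow (stateCode m J u p + 1) s s' →
      SameBelow (stateCode m J u p + 1) s (s'.setNat x 0 v) := by
    intro x v hx s' hs
    refine ⟨fun y hy i => ?_, hs.2.1, fun q hq => ?_⟩
    · rw [nat_setNat, if_neg (by omega), hs.1 y hy]
    · rw [nat_setNat, if_neg (by omega), nat_setNat, if_neg (by omega)]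
      exact hs.2.2 q hq
  have hrefl : SameBelow (stateCode m J u p + 1) s s :=
    ⟨fun _ _ _ => rfl, fun _ _ _ => rfl, fun _ _ => ⟨rfl, rfl, rfl, rfl⟩⟩
  have hs₁ := hframe 17 (s.nat 17 0 + 1) (by norm_num) s hrefl
  refine ⟨fun hc => ?_, fun hc => ⟨fun hc' => ?_, fun hc' => ?_⟩⟩
  · simp only [Cond.eval, NExp.eval, var, nat_setNat] at hc
    norm_num at hc
    rw [h6, h16] at hc
    refine key J u (p + 1) _ hu (by omega) (stateCode_succ_p _ _ _ _).symm
      (hframe 16 _ (by norm_num) _ hs₁) ?_ ?_ ?_ ?_ <;>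
      simp [NExp.eval, var, h14, h15, h16, h17]
  · simp only [Cond.eval, NExp.eval, var, nat_setNat] at hc hc'
    norm_num at hc hc'
    rw [h6, h16] at hc
    rw [h6, h15] at hc'
    have hp' : p = 2 * m := by omega
    refine key J (u + 1) 0 _ (by omega) (by omega) ?_
      (hframe 15 _ (by norm_num) _ (hframe 16 _ (by norm_num) _ hs₁)) ?_ ?_ ?_ ?_
    · rw [stateCode_succ_u, hp']; unfold stateCode; ring
    all_goals simp [NExp.eval, var, h14, h15, h17]
  · simp only [Cond.eval, NExp.eval, var, nat_setNat] at hc hc'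
    norm_num at hc hc'
    rw [h6, h16] at hc
    rw [h6, h15] at hc'
    have hp' : p = 2 * m := by omega
    have hu' : u = m := by omega
    have hcode : stateCode m J u p + 1 = (J + 1) * ((m + 1) * (2 * m + 1)) := by
      rw [hp', hu']; unfold stateCode; ring
    refine key (J + 1) 0 0 _ (by omega) (by omega) ?_
      (hframe 14 _ (by norm_num) _ (hframe 15 _ (by norm_num) _
        (hframe 16 _ (by norm_num) _ hs₁))) ?_ ?_ ?_ ?_
    · rw [hcode]; unfold stateCode; ring
    · simp [NExp.eval, var, h17, hcode]
    all_goals simp [NExp.eval, var, h17]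

theorem runs_stateBody {s : Mem} {c : ℕ} (hc : c < 2 ^ k * ((m + 1) * (2 * m + 1)))
    (h : IsFilled z n m k E N c s) :
    Runs stateBody s (400 * (k + 1)) (IsFilled z n m k E N (c + 1)) := by
  obtain ⟨J, u, p, hu, hp, rfl, h⟩ := h
  have hJ : J < 2 ^ k := by
    by_contra hcon
    have h₁ := Nat.mul_le_mul_right ((m + 1) * (2 * m + 1)) (not_lt.1 hcon)
    have h₂ : J * ((m + 1) * (2 * m + 1)) ≤ stateCode m J u p := by
      have : stateCode m J u p = J * ((m + 1) * (2 * m + 1)) + (u * (2 * m + 1) + p) := by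
        unfold stateCode; ring
      omega
    omega
  have h₀ : wp (.seq initState (.seq tryInterval (.seq (assign 19 (var 14)) (assign 20 (var 7)))))
      (IsAtNeg z n m k E N J u p k) s := by
    change wp initState (fun s => wp tryInterval (fun s =>
      wp (.seq (assign 19 (var 14)) (assign 20 (var 7))) (IsAtNeg z n m k E N J u p k) s) s) s
    refine wp_mono (wp_initState h) ?_
    rintro s₁ ⟨a, b⟩
    refine wp_mono (wp_tryInterval a b) ?_
    rintro s₂ ⟨a, b⟩
    have h7 : s₂.nat 7 0 = k := a.1.1.2.2.1
    have h14 := a.2.1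
    have e : negPredecessors N m k J u p k = ∅ := by
      ext x
      simp only [negPredecessors, Set.mem_ofPred_eq, Set.mem_empty_iff_false, iff_false]
      rintro ⟨i, h₁, -, -, -, h₂⟩
      omega
    refine ⟨(a.assign (by norm_num)).assign (by norm_num), ?_, ?_, ?_⟩
    · rw [e, Set.union_empty]
      exact (b.assign (by norm_num)).assign (by norm_num)
    · simp [NExp.eval, var, h14, Nat.mod_eq_of_lt hJ]
    · simp [NExp.eval, var, h7]
  refine ((Runs.of_wp h₀).seq fun s hs => (Runs.loop (M := k) (T := loopFreeCost tryNeg)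
    (fun i => IsAtNeg z n m k E N J u p (k - i)) hs ?_ ?_).seq fun s hs =>
      Runs.of_wp (Q := IsFilled z n m k E N (stateCode m J u p + 1)) ?_).mono ?_ fun s hs => hs
  · intro i hi s hs
    have e : k - i = k - (i + 1) + 1 := by omega
    refine ⟨by simp [Cond.eval, NExp.eval, var, hs.2.2.2]; omega, ?_⟩
    rw [e] at hs
    exact Runs.of_wp (wp_tryNeg (by omega) hs)
  · intro s hs
    simp [Cond.eval, NExp.eval, var, hs.2.2.2]
  · rw [Nat.sub_self] at hs
    refine wp_advance hu hp hs.1 (hs.1.2.2.2.2.2.succ hJ hu hp ?_)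
    rw [predecessors_eq]; exact hs.2.1
  · have e₁ : loopFreeCost (.seq initState (.seq tryInterval
      (.seq (assign 19 (var 14)) (assign 20 (var 7))))) + loopFreeCost advance ≤ 350 := by decide
    have e₂ : loopFreeCost tryNeg ≤ 140 := by decide
    have e₃ : (Cond.natLt (.const 0) (var 20)).cost ≤ 10 := by decide
    nlinarith

theorem runs_fillTable {s : Mem} (h : IsPrepared z n m k E N s) :
    Runs fillTable s (1000 * ((k + 1) * (2 ^ k * ((m + 1) * (2 * m + 1))))) (fun s =>
      IsPrepared z n m k E N s ∧ IsTable z m k E N (2 ^ k * ((m + 1) * (2 * m + 1))) s) := by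
  have h₀ : wp (.seq (.seq (assign 14 (.const 0)) (assign 15 (.const 0)))
      (.seq (assign 16 (.const 0)) (assign 17 (.const 0)))) (IsFilled z n m k E N 0) s := by
    refine ⟨0, 0, 0, by omega, by omega, by simp [stateCode], ?_, ?_, ?_, ?_, ?_, ?_⟩
    · refine h.sameBelow (c := 0) ⟨fun x hx i => ?_, fun _ _ _ => rfl, fun q hq => by omega⟩
      simp [NExp.eval, show x ≠ 17 by omega, show x ≠ 16 by omega, show x ≠ 15 by omega,
        show x ≠ 14 by omega]
    · simp [NExp.eval]
    · simp [NExp.eval]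
    · simp [NExp.eval]
    · simp [NExp.eval, stateCode]
    · intro J u p _ _ _ hlt
      simp [stateCode] at hlt
  refine ((Runs.of_wp h₀).seq fun s hs => Runs.loop (T := 400 * (k + 1))
    (M := 2 ^ k * ((m + 1) * (2 * m + 1))) (IsFilled z n m k E N) hs ?_ ?_).mono ?_ ?_
  · intro c hc s hs
    refine ⟨?_, runs_stateBody hc hs⟩
    obtain ⟨J, u, p, hu, hp, e, h⟩ := hs
    have h7 : s.nat 7 0 = k := h.1.1.2.2.1
    have h17 : s.nat 17 0 = stateCode m J u p := h.2.2.2.2.1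
    simp only [Cond.eval, NExp.eval, var, h7, h17, h.1.2.2 k le_rfl]
    omega
  · rintro s ⟨J, u, p, hu, hp, e, h⟩
    have h7 : s.nat 7 0 = k := h.1.1.2.2.1
    have h17 : s.nat 17 0 = stateCode m J u p := h.2.2.2.2.1
    simp only [Cond.eval, NExp.eval, var, h7, h17, h.1.2.2 k le_rfl]
    omega
  · have e₁ : loopFreeCost (.seq (.seq (assign 14 (.const 0)) (assign 15 (.const 0)))
      (.seq (assign 16 (.const 0)) (assign 17 (.const 0)))) ≤ 40 := by decide
    have e₂ : (Cond.natLt (var 17) (.get 5 (var 7))).cost ≤ 10 := by decide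
    have hX : 1 ≤ 2 ^ k * ((m + 1) * (2 * m + 1)) := Nat.one_le_iff_ne_zero.2 (by positivity)
    generalize 2 ^ k * ((m + 1) * (2 * m + 1)) = X at *
    nlinarith [Nat.zero_le (k * X), Nat.zero_le k]
  · rintro s ⟨J, u, p, hu, hp, e, h⟩
    rw [e]
    exact ⟨h.1, h.2.2.2.2.2⟩

end

/-! ### The output phase and the whole program -/

/-- Compares the final state `var 24` with the best one found so far, `var 23`. -/
def selectBody : Program :=
  .seq (.ite (.realLt (.get 4 (var 24)) (.get 4 (var 23))) (assign 23 (var 24)) .skip) (incr 24)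

/-- Determines the best of the last `2 * m + 1` states, in which all functions have been used. -/
def selectBest : Program :=
  .seq (.seq (assign 24 (.sub (.get 5 (var 7)) (var 8))) (assign 23 (var 24)))
    (.while (.natLt (var 24) (.get 5 (var 7))) selectBody)

/-- Outputs the function entered at the state `var 24`, and proceeds to the predecessor. -/
def outputBody : Program :=
  .seq (.setNat 1 (var 12) (.get 9 (var 24))) (.seq (assign 24 (.get 10 (var 24))) (incr 12))

/-- Outputs the functions along the path of predecessors of the state `var 23`. -/
def output : Program :=
  .seq (.seq (assign 24 (var 23)) (assign 12 (.const 0)))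
    (.while (.natLt (var 12) (var 0)) outputBody)

/-- Computes a minimum permutation. -/
def minProgram : Program :=
  .seq classify (.seq sortProgram (.seq prepare (.seq fillTable (.seq selectBest output))))

section

variable {z : (ℕ → ℝ) × (ℕ → ℝ)} {n m k : ℕ} {E N : ℕ → ℕ}

theorem stateCode_full_add (m k p : ℕ) :
    stateCode m (2 ^ k - 1) m p + (2 * m + 1) = 2 ^ k * ((m + 1) * (2 * m + 1)) + p := by
  obtain ⟨X, hX⟩ := Nat.exists_eq_add_of_le' (Nat.one_le_two_pow (n := k))
  rw [hX, Nat.add_sub_cancel]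
  unfold stateCode
  ring

theorem runs_selectBest {s : Mem} (h : IsPrepared z n m k E N s)
    (h' : IsTable z m k E N (2 ^ k * ((m + 1) * (2 * m + 1))) s) :
    Runs selectBest s (200 * (m + 1)) (fun s => IsPrepared z n m k E N s ∧
      IsTable z m k E N (2 ^ k * ((m + 1) * (2 * m + 1))) s ∧
      ∃ p ≤ 2 * m, s.nat 23 0 = stateCode m (2 ^ k - 1) m p ∧ ∀ p' ≤ 2 * m,
        s.real 4 (stateCode m (2 ^ k - 1) m p) ≤ s.real 4 (stateCode m (2 ^ k - 1) m p')) := by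
  set I : ℕ → Mem → Prop := fun i s => (IsPrepared z n m k E N s ∧
      IsTable z m k E N (2 ^ k * ((m + 1) * (2 * m + 1))) s) ∧
      s.nat 24 0 = stateCode m (2 ^ k - 1) m i ∧
      ∃ p ≤ 2 * m, s.nat 23 0 = stateCode m (2 ^ k - 1) m p ∧ ∀ p' < i,
        s.real 4 (stateCode m (2 ^ k - 1) m p) ≤ s.real 4 (stateCode m (2 ^ k - 1) m p') with hI
  have hframe : ∀ {s : Mem} {x v : ℕ}, 11 ≤ x → (IsPrepared z n m k E N s ∧
      IsTable z m k E N (2 ^ k * ((m + 1) * (2 * m + 1))) s) →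
      (IsPrepared z n m k E N (s.setNat x 0 v) ∧
        IsTable z m k E N (2 ^ k * ((m + 1) * (2 * m + 1))) (s.setNat x 0 v)) := by
    intro s x v hx hs
    have : SameBelow (2 ^ k * ((m + 1) * (2 * m + 1))) s (s.setNat x 0 v) := by
      refine ⟨fun y hy i => ?_, fun _ _ _ => rfl, fun q _ => ⟨?_, ?_, rfl, rfl⟩⟩ <;>
        rw [nat_setNat, if_neg (by omega)]
    exact ⟨hs.1.sameBelow this, hs.2.sameBelow this⟩
  have hcode := stateCode_full_add m k
  have hend : ∀ s, IsPrepared z n m k E N s →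
      s.nat 5 (s.nat 7 0) = 2 ^ k * ((m + 1) * (2 * m + 1)) := fun s hs => by
    rw [hs.1.2.2.1, hs.2.2 k le_rfl]
  have h₀ : wp (.seq (assign 24 (.sub (.get 5 (var 7)) (var 8))) (assign 23 (var 24))) (I 0) s := by
    have h24 : s.nat 5 (s.nat 7 0) - s.nat 8 0 = stateCode m (2 ^ k - 1) m 0 := by
      rw [hend s h, h.2.1]; have := hcode 0; omega
    refine ⟨hframe (by norm_num) (hframe (by norm_num) ⟨h, h'⟩), ?_, 0, Nat.zero_le _, ?_, ?_⟩
    · simp [NExp.eval, var, h24]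
    · simp [NExp.eval, var, h24]
    · intro p' hp'; omega
  refine ((Runs.of_wp h₀).seq fun s hs => Runs.loop (M := 2 * m + 1)
    (T := loopFreeCost selectBody) I hs ?_ ?_).mono ?_ ?_
  · rintro i hi s ⟨hs, h24, p, hp, h23, hle⟩
    refine ⟨?_, Runs.of_wp ?_⟩
    · simp only [Cond.eval, NExp.eval, var, h24, hend s hs.1]
      have := hcode i
      omega
    · refine ⟨fun hc => ?_, fun hc => ?_⟩
      · simp only [Cond.eval, RExp.eval, NExp.eval, var, h24, h23] at hc
        refine ⟨hframe (by norm_num) (hframe (by norm_num) hs), ?_, i, by omega, ?_, ?_⟩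
        · simp [NExp.eval, var, h24, stateCode_succ_p]
        · simp [NExp.eval, var, h24]
        · intro p' hp'
          rcases Nat.lt_succ_iff_lt_or_eq.1 hp' with hp' | rfl
          · exact hc.le.trans (hle p' hp')
          · exact le_rfl
      · simp only [Cond.eval, RExp.eval, NExp.eval, var, h24, h23, not_lt] at hc
        refine ⟨hframe (by norm_num) hs, ?_, p, hp, ?_, ?_⟩
        · simp [NExp.eval, var, h24, stateCode_succ_p]
        · simp [h23]
        · intro p' hp'
          rcases Nat.lt_succ_iff_lt_or_eq.1 hp' with hp' | rfl
          · exact hle p' hp'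
          · exact hc
  · rintro s ⟨hs, h24, -⟩
    simp only [Cond.eval, NExp.eval, var, h24, hend s hs.1]
    have := hcode (2 * m + 1)
    omega
  · have e₁ : loopFreeCost (.seq (assign 24 (.sub (.get 5 (var 7)) (var 8)))
      (assign 23 (var 24))) ≤ 30 := by decide
    have e₂ : loopFreeCost selectBody ≤ 50 := by decide
    have e₃ : (Cond.natLt (var 24) (.get 5 (var 7))).cost ≤ 10 := by decide
    nlinarith
  · rintro s ⟨hs, -, p, hp, h23, hle⟩
    exact ⟨hs.1, hs.2, p, hp, h23, fun p' hp' => hle p' (by omega)⟩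

theorem runs_output {s : Mem} {l : List ℕ} (h : s.nat 0 0 = l.length)
    (hl : Trace (s.nat 9) (s.nat 10) (s.nat 23 0) l) :
    Runs output s (100 * (l.length + 1)) (fun s => ∀ i (hi : i < l.length), s.nat 1 i = l[i]) := by
  set I : ℕ → Mem → Prop := fun i s => s.nat 0 0 = l.length ∧ s.nat 12 0 = i ∧
    Trace (s.nat 9) (s.nat 10) (s.nat 24 0) (l.drop i) ∧
    ∀ j (hj : j < l.length), j < i → s.nat 1 j = l[j] with hI
  have e : ∀ {s : Mem} {x i v y : ℕ}, y ≠ x → (s.setNat x i v).nat y = s.nat y := fun hxy => by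
    funext j; rw [nat_setNat, if_neg (fun h => hxy h.1)]
  have h₀ : wp (.seq (assign 24 (var 23)) (assign 12 (.const 0))) (I 0) s := by
    refine ⟨by simpa [NExp.eval, var] using h, by simp [NExp.eval], ?_, by omega⟩
    simpa [NExp.eval, var, e] using hl
  refine ((Runs.of_wp h₀).seq fun s hs => Runs.loop (M := l.length)
    (T := loopFreeCost outputBody) I hs ?_ ?_).mono ?_ fun s hs j hj => hs.2.2.2 j hj hj
  · rintro i hi s ⟨h₁, h₂, h₃, h₄⟩
    refine ⟨by simpa [Cond.eval, NExp.eval, var, h₁, h₂] using hi, Runs.of_wp ?_⟩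
    rw [List.drop_eq_getElem_cons hi] at h₃
    generalize hx : l[i] = x at h₃
    generalize hc : s.nat 24 0 = c at h₃
    cases h₃ with
    | cons hlt ht =>
      refine ⟨by simpa [NExp.eval, var] using h₁, by simp [NExp.eval, var, h₂], ?_, ?_⟩
      · simpa [NExp.eval, var, e, hc] using ht
      · intro j hj hji
        rcases Nat.lt_succ_iff_lt_or_eq.1 hji with hji | rfl
        · simpa [NExp.eval, var, h₂, hji.ne] using h₄ j hj hji
        · simp [NExp.eval, var, h₂, hc, hx]
  · rintro s ⟨h₁, h₂, -⟩
    simp [Cond.eval, NExp.eval, var, h₁, h₂]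
  · have e₁ : loopFreeCost (.seq (assign 24 (var 23)) (assign 12 (.const 0))) ≤ 30 := by decide
    have e₂ : loopFreeCost outputBody ≤ 50 := by decide
    have e₃ : (Cond.natLt (var 12) (var 0)).cost ≤ 10 := by decide
    nlinarith

/-- The best final state of a correct table yields an optimal ordering: by the theorem on optimal
boundaries, some optimal ordering is among the lists considered by the dynamic program. -/
theorem exists_optimal_trace {s : Mem} (hm : m = numMono z n) (hk : k = numNeg z n)
    (hE : ∀ x < n, IsSorted z n m E N x)
    (h : IsTable z m k E N (2 ^ k * ((m + 1) * (2 * m + 1))) s) {p : ℕ} (hp : p ≤ 2 * m)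
    (hbest : ∀ p' ≤ 2 * m,
      s.real 4 (stateCode m (2 ^ k - 1) m p) ≤ s.real 4 (stateCode m (2 ^ k - 1) m p')) :
    ∃ l, l.Perm (List.range n) ∧ Trace (s.nat 9) (s.nat 10) (stateCode m (2 ^ k - 1) m p) l ∧
      ∀ t : List ℕ, t.Perm (List.range n) → constTerm z.1 z.2 l ≤ constTerm z.1 z.2 t := by
  classical
  have hlay : IsLayout (fun i => z.1 i < 0) n m k E N := by
    refine isLayout_of_isSorted ?_ ?_ hE
    · rw [hm, numMono]
    · rw [hk, numNeg]
  have hm' : m = Nat.count (fun i => ¬ z.1 i < 0) n := by rw [hm, numMono]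
  have hperm : ((List.range m).map E).Perm ((List.range n).filter fun i => ¬ z.1 i < 0) := by
    have := hlay.perm.filter (fun i => ¬ z.1 i < 0)
    rw [List.filter_append, List.filter_eq_self.2, List.filter_eq_nil_iff.2,
      List.append_nil] at this
    · exact this
    · intro x hx
      obtain ⟨i, hi, rfl⟩ := List.mem_map.1 hx
      simpa using hlay.neg i (List.mem_range.1 hi)
    · intro x hx
      obtain ⟨i, hi, rfl⟩ := List.mem_map.1 hx
      simpa using hlay.not_neg i (List.mem_range.1 hi)
  have hopt := hasOptimalBoundary_of_keyLe (neg := fun i => z.1 i < 0) (n := n) (fun _ => Iff.rfl)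
    hperm (pairwise_of_isSorted hm' hE)
  obtain ⟨t₀, p₀, ht₀, hmin, hp₀, hst₀⟩ := hlay.exists_optimal_suffixState hopt
  have hsol : ∀ p ≤ 2 * m, IsSolved E N m k z.1 z.2 (s.real 3) (s.real 4) (s.nat 9) (s.nat 10)
      (2 ^ k - 1) m p := fun p hp => by
    refine h _ _ _ (Nat.sub_lt (by positivity) one_pos) le_rfl hp ?_
    have := stateCode_full_add m k p
    omega
  obtain ⟨l, hl, htr, -, hV, -⟩ := hsol p hp
  obtain ⟨-, -, -, -, -, hle⟩ := hsol p₀ hp₀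
  refine ⟨l, hl.perm.trans (hlay.stateContent_full hp), htr, fun t ht => ?_⟩
  rw [← hV]
  exact ((hbest p₀ hp₀).trans (hle t₀ hst₀)).trans (hmin t ht)

theorem runs_minProgram {s : Mem} (h : HasInput z n s) :
    Runs minProgram s (5000 * ((numNeg z n + 1) * (2 ^ numNeg z n * (n + 1) ^ 2))) (fun s =>
      ∃ l : List ℕ, l.Perm (List.range n) ∧
        (∀ t : List ℕ, t.Perm (List.range n) → constTerm z.1 z.2 l ≤ constTerm z.1 z.2 t) ∧
        ∀ i (hi : i < l.length), s.nat 1 i = l[i]) := by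
  classical
  have hmk : numMono z n + numNeg z n = n := by
    have := count_add_count z n
    rw [numMono, numNeg]
    convert this
  generalize hm : numMono z n = m at hmk
  generalize hk : numNeg z n = k at hmk ⊢
  refine ((runs_classify h).seq fun s hs => (runs_sortProgram hs).seq fun s hs =>
    Runs.seq (T₁ := 100 * (m + k + 2)) (T₂ := 1000 * ((k + 1) * (2 ^ k * ((m + 1) * (2 * m + 1)))) +
      (200 * (m + 1) + 100 * (n + 1))) (R := fun s' => IsPrepared z n m k (s.nat 3) (s.nat 4) s')
      ?_ fun s' hs' => ?_).mono ?_ fun s hs => hs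
  · refine runs_prepare ⟨hs.1.1, ?_, ?_, fun _ => rfl, fun _ => rfl⟩
    · rw [← hm, numMono, hs.1.2.1]
    · rw [← hk, numNeg, hs.1.2.2.1]
  · refine (runs_fillTable hs').seq fun s₁ h₁ => (runs_selectBest h₁.1 h₁.2).seq ?_
    rintro s₂ ⟨h₂, h₃, p, hp, h23, hbest⟩
    obtain ⟨l, hl, htr, hmin⟩ := exists_optimal_trace hm.symm hk.symm
      (by rw [← hm]; exact hs.2) h₃ hp hbest
    have hlen : l.length = n := by rw [hl.length_eq, List.length_range]
    have := runs_output (l := l) (s := s₂) (by rw [h₂.1.1.1, hlen]) (by rw [h23]; exact htr)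
    exact this.mono (by rw [hlen]) fun s hs => ⟨l, hl, hmin, hs⟩
  · have hmn : m ≤ n := by omega
    have e₁ : (m + 1) * (2 * m + 1) ≤ 2 * (n + 1) ^ 2 := by nlinarith
    have e₂ : (k + 1) * (2 ^ k * ((m + 1) * (2 * m + 1))) ≤
        (k + 1) * (2 ^ k * (2 * (n + 1) ^ 2)) := by gcongr
    have e₃ : (n + 1) ^ 2 ≤ (k + 1) * (2 ^ k * (n + 1) ^ 2) := by
      have : 1 ≤ (k + 1) * 2 ^ k := Nat.one_le_iff_ne_zero.2 (by positivity)
      calc (n + 1) ^ 2 = 1 * (n + 1) ^ 2 := (one_mul _).symm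
        _ ≤ (k + 1) * 2 ^ k * (n + 1) ^ 2 := Nat.mul_le_mul_right _ this
        _ = _ := by ring
    have e₄ : (k + 1) * (2 ^ k * (2 * (n + 1) ^ 2)) = 2 * ((k + 1) * (2 ^ k * (n + 1) ^ 2)) := by
      ring
    nlinarith

end

/-! ### Permutations and lists -/

/-- The slopes and intercepts of the functions, extended by zeros. -/
noncomputable def coefficients {n : ℕ} (f : Fin n → LinFun) : (ℕ → ℝ) × (ℕ → ℝ) :=
  ((inputMem f).real 0, (inputMem f).real 1)

/-- The list of values of a permutation. -/
def permList {n : ℕ} (σ : Equiv.Perm (Fin n)) : List ℕ := List.ofFn fun i => (σ i : ℕ)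

theorem permList_perm {n : ℕ} (σ : Equiv.Perm (Fin n)) : (permList σ).Perm (List.range n) := by
  refine (List.perm_ext_iff_of_nodup (List.nodup_ofFn_ofInjective fun i j h =>
    σ.injective (Fin.ext h)) List.nodup_range).2 fun x => ?_
  rw [List.mem_ofFn, List.mem_range]
  constructor
  · rintro ⟨i, rfl⟩; exact (σ i).2
  · exact fun hx => ⟨σ.symm ⟨x, hx⟩, by simp⟩

theorem exists_permList_eq {n : ℕ} {l : List ℕ} (h : l.Perm (List.range n)) :
    ∃ σ : Equiv.Perm (Fin n), permList σ = l := by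
  have hlen : l.length = n := by rw [h.length_eq, List.length_range]
  subst hlen
  have hlt : ∀ i : Fin l.length, l[i] < l.length := fun i =>
    List.mem_range.1 (h.subset (List.getElem_mem _))
  have hinj : Function.Injective fun i : Fin l.length => (⟨l[i], hlt i⟩ : Fin l.length) := by
    intro i j hij
    have : l[i] = l[j] := congrArg Fin.val hij
    exact Fin.ext ((h.nodup_iff.2 List.nodup_range).getElem_inj_iff.1 this)
  refine ⟨Equiv.ofBijective _ (Finite.injective_iff_bijective.1 hinj), ?_⟩
  rw [permList]
  refine List.ext_getElem (by simp) fun i h₁ h₂ => ?_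
  simp

theorem foldl_eval (L : List LinFun) (a b : ℕ → ℝ) (l : List ℕ)
    (ha : L.map LinFun.slope = l.map a) (hb : L.map LinFun.intercept = l.map b) (x : ℝ) :
    L.foldl (fun y g => g.eval y) x = slopeProd a l * x + constTerm a b l := by
  induction L generalizing l x with
  | nil =>
    have : l = [] := by simpa using ha.symm
    subst this; simp
  | cons g L ih =>
    cases l with
    | nil => simp at ha
    | cons i l =>
      simp only [List.map_cons, List.cons.injEq] at ha hb
      rw [List.foldl_cons, ih l ha.2 hb.2, slopeProd_cons, constTerm_cons, LinFun.eval, ha.1, hb.1]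
      ring

/-- The permutations enter only through the constant term, since the slope does not depend on them
(`slopeProd_permList`). -/
theorem composite_eq {n : ℕ} (f : Fin n → LinFun) (σ : Equiv.Perm (Fin n)) (x : ℝ) :
    composite f σ x = slopeProd (coefficients f).1 (permList σ) * x +
      constTerm (coefficients f).1 (coefficients f).2 (permList σ) := by
  refine foldl_eval _ _ _ _ ?_ ?_ x <;>
  · rw [permList, List.map_ofFn, List.map_ofFn]
    congr 1
    funext i
    simp [coefficients, inputMem]

theorem slopeProd_permList (a : ℕ → ℝ) {n : ℕ} (σ τ : Equiv.Perm (Fin n)) :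
    slopeProd a (permList σ) = slopeProd a (permList τ) :=
  slopeProd_perm a ((permList_perm σ).trans (permList_perm τ).symm)

theorem numNeg_coefficients {n : ℕ} (f : Fin n → LinFun) :
    numNeg (coefficients f) n = numDecreasing f := by
  classical
  rw [numNeg, Nat.count_eq_card_filter_range, numDecreasing]
  symm
  refine Finset.card_bij (fun i _ => (i : ℕ)) ?_ (fun i _ j _ h => Fin.ext h) ?_
  · intro i hi
    simpa [coefficients, inputMem] using hi
  · intro x hx
    rw [Finset.mem_filter, Finset.mem_range] at hx
    refine ⟨⟨x, hx.1⟩, ?_, rfl⟩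
    simpa [coefficients, inputMem, hx.1] using hx.2

theorem hasInput_inputMem {n : ℕ} (f : Fin n → LinFun) :
    HasInput (coefficients f) n (inputMem f) :=
  ⟨by simp [inputMem], fun _ => rfl, fun _ => rfl⟩

theorem numDecreasing_le {n : ℕ} (f : Fin n → LinFun) : numDecreasing f ≤ n := by
  simpa [numDecreasing] using Finset.card_filter_le (Finset.univ : Finset (Fin n)) _

theorem time_bound {k n : ℕ} (hk : 0 < k) (hn : k ≤ n) :
    (k + 1) * (2 ^ k * (n + 1) ^ 2) ≤ 8 * (k * 2 ^ k * n ^ 6) := by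
  have h₁ : (n + 1) ^ 2 ≤ 4 * n ^ 6 := by
    have : n ^ 2 ≤ n ^ 6 := Nat.pow_le_pow_right (by omega) (by norm_num)
    nlinarith
  calc (k + 1) * (2 ^ k * (n + 1) ^ 2) ≤ (2 * k) * (2 ^ k * (4 * n ^ 6)) := by
        gcongr; omega
    _ = 8 * (k * 2 ^ k * n ^ 6) := by ring

/-! ### Maximum permutations -/

/-- Negates the intercept of the function with index `var 11`. -/
def negateBody : Program :=
  .seq (.setReal 1 (var 11) (.sub (.const 0) (.get 1 (var 11)))) (incr 11)

/-- Computes a maximum permutation, which is a minimum permutation for the negated intercepts. -/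
def maxProgram : Program :=
  .seq (.while (.natLt (var 11) (var 0)) negateBody) minProgram

theorem constTerm_neg {ι R : Type*} [CommRing R] (a b : ι → R) (l : List ι) :
    constTerm a (fun i => -b i) l = -constTerm a b l := by
  induction l with
  | nil => simp
  | cons x l ih => rw [constTerm_cons, constTerm_cons, ih]; ring

theorem runs_negate {n : ℕ} (f : Fin n → LinFun) :
    Runs (.while (.natLt (var 11) (var 0)) negateBody) (inputMem f) (100 * (n + 1))
      (HasInput ((coefficients f).1, fun i => -(coefficients f).2 i) n) := by
  refine (Runs.loop (M := n) (T := loopFreeCost negateBody) (fun i s => s.nat 11 0 = i ∧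
    s.nat 0 0 = n ∧ (∀ j, s.real 0 j = (coefficients f).1 j) ∧
    ∀ j, s.real 1 j = if j < i then -(coefficients f).2 j else (coefficients f).2 j) ?_ ?_ ?_).mono
    ?_ ?_
  · refine ⟨by simp [inputMem], by simp [inputMem], fun _ => rfl, fun j => ?_⟩
    rw [if_neg (Nat.not_lt_zero _)]; rfl
  · rintro i hi s ⟨h₁, h₂, h₃, h₄⟩
    refine ⟨by simpa [Cond.eval, NExp.eval, var, h₁, h₂] using hi, Runs.of_wp ?_⟩
    refine ⟨by simp [NExp.eval, var, h₁], by simpa [NExp.eval, var] using h₂,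
      fun j => by simpa [NExp.eval, var] using h₃ j, fun j => ?_⟩
    rcases lt_trichotomy j i with hj | rfl | hj
    · simp [NExp.eval, RExp.eval, var, h₁, h₄, hj, hj.ne, hj.trans (Nat.lt_succ_self i)]
    · simp [NExp.eval, RExp.eval, var, h₁, h₄]
    · simp [NExp.eval, RExp.eval, var, h₁, h₄, hj.ne', hj.not_gt, show ¬ j < i + 1 by omega]
  · rintro s ⟨h₁, h₂, -⟩
    simp [Cond.eval, NExp.eval, var, h₁, h₂]
  · have e₁ : loopFreeCost negateBody ≤ 50 := by decide
    have e₂ : (Cond.natLt (var 11) (var 0)).cost ≤ 10 := by decide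
    nlinarith
  · rintro s ⟨-, h₂, h₃, h₄⟩
    refine ⟨h₂, h₃, fun j => ?_⟩
    rw [h₄]
    split_ifs with hj
    · rfl
    · simp [coefficients, inputMem, hj]

/-- A run of a program that outputs an ordering `l` as a list yields an output permutation. -/
theorem exists_outputsIn {n T : ℕ} {p : Program} {f : Fin n → LinFun} {P : List ℕ → Prop}
    (h : Runs p (inputMem f) T fun s => ∃ l : List ℕ, l.Perm (List.range n) ∧ P l ∧
      ∀ i (hi : i < l.length), s.nat 1 i = l[i]) :
    ∃ σ t, OutputsIn p f σ t ∧ P (permList σ) ∧ t ≤ T := by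
  obtain ⟨s, t, hs, ht, l, hl, hP, hout⟩ := h
  obtain ⟨σ, rfl⟩ := exists_permList_eq hl
  refine ⟨σ, t, ⟨s, hs, fun i => ?_⟩, hP, ht⟩
  rw [hout i (by simp [permList])]
  simp [permList]

end CompositionOrdering

theorem mainTheorem2 :
    (∃ (p : CompositionOrdering.Program) (C : ℕ),
      ∀ (n : ℕ) (f : Fin n → CompositionOrdering.LinFun),
        0 < CompositionOrdering.numDecreasing f →
        ∃ (σ : Equiv.Perm (Fin n)) (t : ℕ),
          CompositionOrdering.OutputsIn p f σ t ∧
          CompositionOrdering.IsMinimumPerm f σ ∧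
          t ≤ C * (CompositionOrdering.numDecreasing f *
            2 ^ CompositionOrdering.numDecreasing f * n ^ 6)) ∧
    (∃ (p : CompositionOrdering.Program) (C : ℕ),
      ∀ (n : ℕ) (f : Fin n → CompositionOrdering.LinFun),
        0 < CompositionOrdering.numDecreasing f →
        ∃ (σ : Equiv.Perm (Fin n)) (t : ℕ),
          CompositionOrdering.OutputsIn p f σ t ∧
          CompositionOrdering.IsMaximumPerm f σ ∧
          t ≤ C * (CompositionOrdering.numDecreasing f *
            2 ^ CompositionOrdering.numDecreasing f * n ^ 6)) := by
  open CompositionOrdering in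
  refine ⟨⟨minProgram, 40000, fun n f hf => ?_⟩, ⟨maxProgram, 50000, fun n f hf => ?_⟩⟩
  · have h := runs_minProgram (hasInput_inputMem f)
    rw [numNeg_coefficients] at h
    obtain ⟨σ, t, hσ, hmin, ht⟩ := exists_outputsIn (P := fun l => ∀ t : List ℕ,
      t.Perm (List.range n) → constTerm (coefficients f).1 (coefficients f).2 l ≤
        constTerm (coefficients f).1 (coefficients f).2 t) h
    refine ⟨σ, t, hσ, fun τ x => ?_, ht.trans ?_⟩
    · rw [composite_eq, composite_eq, slopeProd_permList _ σ τ]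
      have := hmin _ (permList_perm τ)
      linarith
    · have := time_bound hf (numDecreasing_le f)
      omega
  · have h := (runs_negate f).seq fun s hs => runs_minProgram hs
    have e : numNeg ((coefficients f).1, fun i => -(coefficients f).2 i) n = numDecreasing f :=
      numNeg_coefficients f
    rw [e] at h
    obtain ⟨σ, t, hσ, hmin, ht⟩ := exists_outputsIn (P := fun l => ∀ t : List ℕ,
      t.Perm (List.range n) → constTerm (coefficients f).1 (fun i => -(coefficients f).2 i) l ≤
        constTerm (coefficients f).1 (fun i => -(coefficients f).2 i) t) h
    refine ⟨σ, t, hσ, fun τ x => ?_, ht.trans ?_⟩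
    · rw [composite_eq, composite_eq, slopeProd_permList _ σ τ]
      have := hmin _ (permList_perm τ)
      rw [constTerm_neg, constTerm_neg] at this
      linarith
    · have h₁ := time_bound hf (numDecreasing_le f)
      have h₂ : n + 1 ≤ (numDecreasing f + 1) * (2 ^ numDecreasing f * (n + 1) ^ 2) := by
        have h₃ : 1 ≤ (numDecreasing f + 1) * 2 ^ numDecreasing f :=
          Nat.one_le_iff_ne_zero.2 (by positivity)
        calc n + 1 ≤ 1 * (n + 1) ^ 2 := by nlinarith
          _ ≤ (numDecreasing f + 1) * 2 ^ numDecreasing f * (n + 1) ^ 2 :=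
            Nat.mul_le_mul_right _ h₃
          _ = _ := by ring
      omega
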